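/- **Setting.** Let $T[1..n]$ and $P[1..m]$ be strings of integers, the characters of each being pairwise distinct, $n\ge 1$, $m \ge 1$. The Cartesian tree $CT(S)$ of a nonempty string $S$ has as its root the position $v$ of the minimum of $S$; its left and right subtrees are $CT(S[1..v-1])$ and $CT(S[v+1..|S|])$ ($CT$ of the empty string is empty). Cartesian trees are compared as ordered trees, without their labels. For a node $v$ of $CT(P)$ let $v.\mathrm L, v.\mathrm R$ be its children ($\mathit{nil}$ if missing) and $P_v$ the substring of $P$ that its subtree spans. An interval $[\ell,r]\subseteq[1,n]$ is a *fixed-interval with the pivot* $(v,i)$ if there are positions $I=(i_1<\dots<i_{|P_v|})$ of $T$ in $[\ell,r]$, with $i$ among them, such that $CT(T_I)=CT(P_v)$ and $T[i]=\min T_I$. Let $\mathsf{mfi}(v,i)=[L(v,i),R(v,i)]$ be the inclusion-minimal one (it is unique), and $[-\infty,\infty]$ if there is none. Two tables $A,B$ with $A[j]\in\{-\infty\}\cup[1,j]$ and $B[j]\in[j,n]\cup\{\infty\}$ are said to *record* $\mathsf{mfi}(u,\cdot)$ if for each $j$ either $A[j]$ and $B[j]$ are both finite and $\mathsf{mfi}(u,j)=[A[j],B[j]]$,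 or at least one of them is infinite and $\mathsf{mfi}(u,j)=[-\infty,\infty]$. The function UPDATE-LEFT-MAX for a node $v$ has to compute the table $$L[v][i]=\begin{cases} i & \text{if } v.\mathrm L=\mathit{nil},\\ \max\bigl(\{L[v.\mathrm L][j] : 1\le j\le i-1,\ T[i]<T[j],\ R[v.\mathrm L][j]<i\}\cup\{-\infty\}\bigr) & \text{otherwise,}\end{cases}\qquad 1\le i\le n,$$ where $L[v.\mathrm L],R[v.\mathrm L]$ are given tables that record $\mathsf{mfi}(v.\mathrm L,\cdot)$. UPDATE-RIGHT-MIN is the symmetric function for $R[v]$: $R[v][i]=i$ if $v.\mathrm R=\mathit{nil}$, and $R[v][i]=\min(\{R[v.\mathrm R][j] : i<j\le n,\ T[i]<T[j],\ i<L[v.\mathrm R][j]\}\cup\{\infty\})$ otherwise. **Algorithm.** If $v.\mathrm L=\mathit{nil}$, set $L[v][i]\leftarrow i$ for all $i$. Otherwise let $\mathcal S\leftarrow\emptyset$ be a set of intervals, kept in a van Emde Boas tree of their right ends with an array of the associated left ends. For each position $i$ in decreasing order of $T[i]$: set $L[v][i]$ to the left end of the interval of $\mathcal S$ with the largest right end less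 than $i$ (to $-\infty$ if there is none); then, for $[\ell,r]=[L[v.\mathrm L][i],R[v.\mathrm L][i]]$, delete from $\mathcal S$ all intervals that contain $[\ell,r]$, finding them one by one by a successor query for $r-1$; finally insert $[\ell,r]$, unless it contains the interval of $\mathcal S$ with the largest right end at most $r$. **Lemma.** On a word RAM of word size $w$, with $2^w\ge Cn$ and every character of $T$ less than $2^w$, the algorithm, given the positions of $T$ listed in decreasing order of their values, computes UPDATE-LEFT-MAX in $O(n\log\log n)$ time and $O(n)$ space. The same holds if that list is not given but is produced by radix sort within the time and space stated, provided that the characters of $T$ are at most $n^{d}$ for a fixed $d$ (the constants then depend on $d$). That is: 1. the output is the table $L[v]$ above; 2. $L[v][i]=L(v,i)$ for all $i$ with $\mathsf{mfi}(v,i)\ne[-\infty,\infty]$, and $L[v]$, together with the table $R[v]$ that UPDATE-RIGHT-MIN produces from tables that record $\mathsf{mfi}(v.\mathrm R,\cdot)$ (if $v.\mathrm R\neq\mathit{nil}$), records $\mathsf{mfi}(v,\cdot)$; 3. there is a constant $C$, independent of $n,m,w,T,P,v$ and the tables, such that at most $Cn\log\log n$ operations are executed if $n\ge 3$, and at most $Cn$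 words of memory are used; 4. if $v.\mathrm L\neq\mathit{nil}$, then (with the list given) after $t$ rounds of the main loop, for each $0\le t\le n$, $\mathcal S$ is the set of the inclusion-minimal members of $\{[L[v.\mathrm L][i],R[v.\mathrm L][i]] : i \text{ is one of the first } t \text{ positions}\}$. -/

import Mathlib

namespace CTMSeq

/-! ## Cartesian trees and minimal fixed-intervals

A string of length `n` is a function `S : ℕ → ℕ` of which only the values at `1, …, n` matter. -/

/-- The (0-based) index of the leftmost minimum of a list. -/
def minidx (S : List ℕ) : ℕ := S.idxOf (S.min?.getD 0)

theorem minidx_lt {S : List ℕ} (h : S ≠ []) : minidx S < S.length := by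
  unfold minidx
  apply List.idxOf_lt_length_of_mem
  cases hm : S.min? with
  | none => exact absurd (List.min?_eq_none_iff.mp hm) h
  | some a => exact List.min?_mem hm

/-- The Cartesian tree of a string, up to isomorphism of ordered trees: the root is the position of
the minimum, and its subtrees are the Cartesian trees of what stands to its left and right. -/
def cartesianTree (S : List ℕ) : BinaryTree Unit :=
  if h : S = [] then .nil
  else
    have := minidx_lt h
    .node () (cartesianTree (S.take (minidx S))) (cartesianTree (S.drop (minidx S + 1)))
termination_by S.length
decreasing_by
  · simp only [List.length_take]; omega
  · simp only [List.length_drop]; omega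

/-- The substring `S[a..b]`, empty if `b < a`. -/
def substring (S : ℕ → ℕ) (a b : ℕ) : List ℕ := (List.range' a (b + 1 - a)).map S

/-- `IsNode P m v a b`: the node `v` of the Cartesian tree of `P[1..m]` has the substring
`P_v = P[a..b]`. -/
inductive IsNode (P : ℕ → ℕ) (m : ℕ) : ℕ → ℕ → ℕ → Prop
  | root {v : ℕ} (hv : v ∈ Set.Icc 1 m) (hmin : ∀ k ∈ Set.Icc 1 m, P v ≤ P k) : IsNode P m v 1 m
  | left {v a b u : ℕ} (h : IsNode P m v a b) (hu : a ≤ u ∧ u < v)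
      (hmin : ∀ k, a ≤ k → k < v → P u ≤ P k) : IsNode P m u a (v - 1)
  | right {v a b u : ℕ} (h : IsNode P m v a b) (hu : v < u ∧ u ≤ b)
      (hmin : ∀ k, v < k → k ≤ b → P u ≤ P k) : IsNode P m u (v + 1) b

/-- `u = v.L`. -/
def IsLeftChild (P : ℕ → ℕ) (m v u : ℕ) : Prop :=
  ∃ a b, IsNode P m v a b ∧ IsNode P m u a (v - 1)

/-- `u = v.R`. -/
def IsRightChild (P : ℕ → ℕ) (m v u : ℕ) : Prop :=
  ∃ a b, IsNode P m v a b ∧ IsNode P m u (v + 1) b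

/-- `[ℓ, r] ⊆ [n]` is a fixed-interval with the pivot `(v, i)`; `I` is the trace. -/
def IsFixedInterval (P : ℕ → ℕ) (m : ℕ) (T : ℕ → ℕ) (n v i ℓ r : ℕ) : Prop :=
  1 ≤ ℓ ∧ ℓ ≤ r ∧ r ≤ n ∧
    ∃ a b, IsNode P m v a b ∧
      ∃ I : List ℕ, I.Pairwise (· < ·) ∧ (∀ x ∈ I, 1 ≤ x ∧ x ≤ n) ∧
        I.length = (substring P a b).length ∧
        i ∈ I ∧
        (∀ x ∈ I, ℓ ≤ x ∧ x ≤ r) ∧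
        cartesianTree (I.map T) = cartesianTree (substring P a b) ∧
        (∀ x ∈ I, T i ≤ T x)

/-- A fixed-interval that properly contains no other one with the same pivot. -/
def IsMinimalFixedInterval (P : ℕ → ℕ) (m : ℕ) (T : ℕ → ℕ) (n v i ℓ r : ℕ) : Prop :=
  IsFixedInterval P m T n v i ℓ r ∧
    ∀ ℓ' r', IsFixedInterval P m T n v i ℓ' r' → ℓ ≤ ℓ' → r' ≤ r → ℓ' = ℓ ∧ r' = r

open Classical in
/-- The minimal fixed-interval `mfi(v, i)`; `none` stands for `[-∞, ∞]`. -/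
noncomputable def mfi (P : ℕ → ℕ) (m : ℕ) (T : ℕ → ℕ) (n v i : ℕ) : Option (ℕ × ℕ) :=
  if h : ∃ p : ℕ × ℕ, IsMinimalFixedInterval P m T n v i p.1 p.2 then some h.choose else none

/-- `L(v, i)`, the left end of `mfi(v, i)`, where `0` stands for `-∞`. -/
noncomputable def leftEnd (P : ℕ → ℕ) (m : ℕ) (T : ℕ → ℕ) (n v i : ℕ) : ℕ :=
  ((mfi P m T n v i).map Prod.fst).getD 0

/-! ## Tables

In a table `0` stands for `-∞` and `n + 1` for `∞`. -/

/-- The tables `A = L[u]` and `B = R[u]` record the minimal fixed-intervals with the pivots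
`(u, j)`: `mfi(u, j) = [A j, B j]` if `A j` and `B j` are both finite, and `mfi(u, j) = [-∞, ∞]`
if at least one of them is infinite. -/
def TablesFor (P : ℕ → ℕ) (m : ℕ) (T : ℕ → ℕ) (n u : ℕ) (A B : ℕ → ℕ) : Prop :=
  ∀ j ∈ Set.Icc 1 n, A j ≤ j ∧ j ≤ B j ∧ B j ≤ n + 1 ∧
    ∀ ℓ r, mfi P m T n u j = some (ℓ, r) ↔ A j = ℓ ∧ B j = r ∧ 1 ≤ ℓ ∧ r ≤ n

/-- `max ({A j | 1 ≤ j ≤ i - 1, T i < T j, B j < i} ∪ {-∞})`. -/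
def leftMax (T A B : ℕ → ℕ) (i : ℕ) : ℕ :=
  ((Finset.Icc 1 (i - 1)).filter (fun j => T i < T j ∧ B j < i)).fold max 0 A

/-- `min ({B j | i + 1 ≤ j ≤ n, T i < T j, i < A j} ∪ {∞})`. -/
def rightMin (n : ℕ) (T A B : ℕ → ℕ) (i : ℕ) : ℕ :=
  ((Finset.Icc (i + 1) n).filter (fun j => T i < T j ∧ i < A j)).fold min (n + 1) B

/-- `Rv` is a table that UPDATE-RIGHT-MIN produces for `v` from tables for its right child. -/
def IsRightMinTable (P : ℕ → ℕ) (m : ℕ) (T : ℕ → ℕ) (n v : ℕ) (Rv : ℕ → ℕ) : Prop :=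
  ((¬ ∃ x, IsRightChild P m v x) ∧ ∀ i ∈ Set.Icc 1 n, Rv i = i) ∨
    ∃ x A B, IsRightChild P m v x ∧ TablesFor P m T n x A B ∧
      ∀ i ∈ Set.Icc 1 n, Rv i = rightMin n T A B i

/-! ## The word RAM

A computation on words of `w` bits and a memory of words. Every primitive operation costs one unit
of time and fails if its result does not fit in a word.

Recursive procedures and while-loops carry a first argument `fuel` that only serves to make the
recursion well-founded: it takes no part in the computation, and a run that exhausts it fails. -/

structure RamState where
  mem : ℕ → ℕ
  /-- number of operations executed so far -/
  time : ℕ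
  /-- least bound of the addresses accessed so far -/
  cells : ℕ
  /-- current number of recursive procedure calls in progress -/
  depth : ℕ
  /-- largest `depth` so far -/
  peak : ℕ

/-- Memory cells used, plus the frames on the stack of recursive calls (each of constant size). -/
def RamState.space (s : RamState) : ℕ := s.cells + s.peak

abbrev RAM (α : Type) : Type := ReaderT ℕ (StateT RamState Option) α

/-- Run a program with word size `w` on the initial memory `mem`. -/
def run {α : Type} (p : RAM α) (w : ℕ) (mem : ℕ → ℕ) : Option RamState :=
  (p w ⟨mem, 0, 0, 0, 0⟩).map Prod.snd

def fail {α : Type} : RAM α := fun _ _ => none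

def tick : RAM Unit := fun _ s => some ((), { s with time := s.time + 1 })

/-- The result `v` of an operation of unit cost. -/
def word (v : ℕ) : RAM ℕ := fun w s =>
  if v < 2 ^ w then some (v, { s with time := s.time + 1 }) else none

def add (x y : ℕ) : RAM ℕ := word (x + y)
def sub (x y : ℕ) : RAM ℕ := word (x - y)
def mul (x y : ℕ) : RAM ℕ := word (x * y)
def div (x y : ℕ) : RAM ℕ := word (x / y)
def mod (x y : ℕ) : RAM ℕ := word (x % y)
def shl (x k : ℕ) : RAM ℕ := word (x * 2 ^ k)
def shr (x k : ℕ) : RAM ℕ := word (x / 2 ^ k)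

def eq (x y : ℕ) : RAM Bool := do tick; return decide (x = y)
def lt (x y : ℕ) : RAM Bool := do tick; return decide (x < y)

def read (a : ℕ) : RAM ℕ := fun w s =>
  if a < 2 ^ w then
    some (s.mem a, { s with time := s.time + 1, cells := max s.cells (a + 1) })
  else none

def write (a v : ℕ) : RAM Unit := fun w s =>
  if a < 2 ^ w ∧ v < 2 ^ w then
    some ((), { s with
      mem := Function.update s.mem a v, time := s.time + 1, cells := max s.cells (a + 1) })
  else none

/-- Start of a recursive call: push a frame. -/
def enter : RAM Unit := fun _ s =>
  some ((), { s with time := s.time + 1, depth := s.depth + 1, peak := max s.peak (s.depth + 1) })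

/-- Return from a recursive call: pop a frame. -/
def leave : RAM Unit := fun _ s =>
  some ((), { s with time := s.time + 1, depth := s.depth - 1 })

/-- Array access: the array starts at address `base`. -/
def readAt (base i : ℕ) : RAM ℕ := do
  let a ← add base i
  read a

def writeAt (base i v : ℕ) : RAM Unit := do
  let a ← add base i
  write a v

/-- `for i = a, a + 1, …, a + k - 1 do f i`; two operations per round for the loop itself. -/
def forUp (a : ℕ) : ℕ → (ℕ → RAM Unit) → RAM Unit
  | 0, _ => tick
  | k + 1, f => do
    forUp a k f
    tick
    tick
    f (a + k)

/-! ## Van Emde Boas trees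

A tree for a set of keys below `2 ^ j` (`1 ≤ j`) is a block of `3 * 2 ^ j - 4` cells. The first two
cells hold the minimum and the maximum of the set, each incremented by one; `0` means that the set
is empty. If `1 < j`, put `lo = ⌊j / 2⌋` and `hi = ⌈j / 2⌉`. A key `x` has the upper half
`h = ⌊x / 2 ^ lo⌋` and the lower half `x mod 2 ^ lo`. Then follow the summary, a tree for the upper
halves `h` with a nonempty cluster, and for each `h < 2 ^ hi` the cluster of `h`, a tree for the
lower halves that occur with `h`. The minimum is stored in no cluster. -/

/-- The set stored in the tree at address `base`. -/
def vebSet (mem : ℕ → ℕ) (base j : ℕ) : Set ℕ :=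
  if j ≤ 1 then {x | x + 1 = mem base ∨ x + 1 = mem (base + 1)}
  else {x | x + 1 = mem base ∨
    x / 2 ^ (j / 2) < 2 ^ (j - j / 2) ∧
    x % 2 ^ (j / 2) ∈ vebSet mem
      (base + 2 + (3 * 2 ^ (j - j / 2) - 4) + x / 2 ^ (j / 2) * (3 * 2 ^ (j / 2) - 4)) (j / 2)}
termination_by j
decreasing_by omega

/-- Number of cells of a tree for keys of `k` bits. -/
def vebSize (k : ℕ) : RAM ℕ := do
  let a ← shl 3 k
  sub a 4

/-- Address of the cluster of `h`. -/
def clusterAddr (base hi lo h : ℕ) : RAM ℕ := do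
  let a ← add base 2
  let s ← vebSize hi
  let b ← add a s
  let t ← vebSize lo
  let d ← mul h t
  add b d

/-- Lower half of `x`, whose upper half is `h`. -/
def lowPart (x h lo : ℕ) : RAM ℕ := do
  let t ← shl h lo
  sub x t

/-- Insert the key `x`, which is not in the set. -/
def vebInsert : ℕ → ℕ → ℕ → ℕ → RAM Unit
  | 0, _, _, _ => fail
  | fuel + 1, base, j, x => do
    enter
    let x1 ← add x 1
    let mn ← read base
    if ← eq mn 0 then
      write base x1
      writeAt base 1 x1
    else
      let mut y := x
      let mut y1 := x1
      if ← lt x1 mn then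
        write base x1
        y1 := mn
        y ← sub mn 1
      let mx ← readAt base 1
      if ← lt mx y1 then
        writeAt base 1 y1
      if ← lt 1 j then
        let lo ← shr j 1
        let hi ← sub j lo
        let h ← shr y lo
        let l ← lowPart y h lo
        let c ← clusterAddr base hi lo h
        let cm ← read c
        if ← eq cm 0 then
          let l1 ← add l 1
          write c l1
          writeAt c 1 l1
          let sm ← add base 2
          vebInsert fuel sm hi h
        else
          vebInsert fuel c lo l
    leave

/-- Delete the key `x`, which is in the set. -/
def vebDelete : ℕ → ℕ → ℕ → ℕ → RAM Unit
  | 0, _, _, _ => fail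
  | fuel + 1, base, j, x => do
    enter
    let mn ← read base
    let mx ← readAt base 1
    if ← eq mn mx then
      write base 0
      writeAt base 1 0
    else if ← lt 1 j then
      let lo ← shr j 1
      let hi ← sub j lo
      let sm ← add base 2
      let mut y := x
      let mut y1 ← add x 1
      if ← eq y1 mn then
        let f1 ← read sm
        let f ← sub f1 1
        let c ← clusterAddr base hi lo f
        let cm ← read c
        let t ← shl f lo
        y1 ← add t cm
        y ← sub y1 1
        write base y1
      let h ← shr y lo
      let l ← lowPart y h lo
      let c ← clusterAddr base hi lo h
      vebDelete fuel c lo l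
      let cm ← read c
      if ← eq cm 0 then
        vebDelete fuel sm hi h
        if ← eq y1 mx then
          let s1 ← readAt sm 1
          if ← eq s1 0 then
            let mn' ← read base
            writeAt base 1 mn'
          else
            let s ← sub s1 1
            let c' ← clusterAddr base hi lo s
            let cx ← readAt c' 1
            let t ← shl s lo
            let z ← add t cx
            writeAt base 1 z
      else
        if ← eq y1 mx then
          let cx ← readAt c 1
          let t ← shl h lo
          let z ← add t cx
          writeAt base 1 z
    else
      if ← eq x 0 then
        write base 2
      else
        writeAt base 1 1
    leave

/-- `y + 1` for the largest key `y < x`, and `0` if there is none. -/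
def vebPred : ℕ → ℕ → ℕ → ℕ → RAM ℕ
  | 0, _, _, _ => fail
  | fuel + 1, base, j, x => do
    enter
    let mut res := 0
    let x1 ← add x 1
    let mx ← readAt base 1
    if ← eq mx 0 then
      res := 0
    else if ← lt mx x1 then
      res := mx
    else
      let mn ← read base
      if ← lt 1 j then
        let lo ← shr j 1
        let hi ← sub j lo
        let h ← shr x lo
        let l ← lowPart x h lo
        let l1 ← add l 1
        let c ← clusterAddr base hi lo h
        let cm ← read c
        let mut inside := false
        if ← lt 0 cm then
          inside ← lt cm l1
        if inside then
          let q ← vebPred fuel c lo l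
          let t ← shl h lo
          res ← add t q
        else
          let sm ← add base 2
          let q ← vebPred fuel sm hi h
          if ← eq q 0 then
            if ← lt mn x1 then
              res := mn
          else
            let s ← sub q 1
            let c' ← clusterAddr base hi lo s
            let cx ← readAt c' 1
            let t ← shl s lo
            res ← add t cx
      else
        if ← lt mn x1 then
          res := mn
    leave
    return res

/-- `y + 1` for the smallest key `y > x`, and `0` if there is none. -/
def vebSucc : ℕ → ℕ → ℕ → ℕ → RAM ℕ
  | 0, _, _, _ => fail
  | fuel + 1, base, j, x => do
    enter
    let mut res := 0
    let x1 ← add x 1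
    let mn ← read base
    if ← eq mn 0 then
      res := 0
    else if ← lt x1 mn then
      res := mn
    else
      if ← lt 1 j then
        let lo ← shr j 1
        let hi ← sub j lo
        let h ← shr x lo
        let l ← lowPart x h lo
        let l1 ← add l 1
        let c ← clusterAddr base hi lo h
        let cx ← readAt c 1
        if ← lt l1 cx then
          let q ← vebSucc fuel c lo l
          let t ← shl h lo
          res ← add t q
        else
          let sm ← add base 2
          let q ← vebSucc fuel sm hi h
          if ← lt 0 q then
            let s ← sub q 1
            let c' ← clusterAddr base hi lo s
            let cm ← read c'
            let t ← shl s lo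
            res ← add t cm
      else
        let mx ← readAt base 1
        if ← lt x1 mx then
          res := mx
    leave
    return res

/-! ## The predecessor-dictionary version of UPDATE-LEFT-MAX

Memory of a call for the node `v`: cell `0` holds `n`; cell `1` holds `v.L`, or `0` if
`v.L = nil`; cells `2` and `3` are scratch. Then follow arrays of `n + 2` cells each, numbered from
`0`:
* `0`: the text `T`; `1`: the positions of `T`, in the order in which the loop takes them;
* `2` and `3`: the tables `L[v.L]` and `R[v.L]`; `4`: the table `L[v]`, the output;
* `5`: the left ends of the intervals in the dictionary, indexed by their right ends;
* `6`, `7`, `8`: working space for sorting.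
Behind them stands the van Emde Boas tree of the right ends of the intervals in the dictionary. -/

/-- Address of entry `i` of array number `k`. -/
def arr (n k i : ℕ) : ℕ := 4 + k * (n + 2) + i

/-- The registers that stay constant during a call. -/
structure Regs where
  n : ℕ
  ord : ℕ
  lu : ℕ
  ru : ℕ
  lv : ℕ
  asc : ℕ
  veb : ℕ
  bits : ℕ

/-- Least `k' ≥ k` with `n + 3 ≤ 2 ^ k'`. -/
def findBits : ℕ → ℕ → ℕ → RAM ℕ
  | 0, _, _ => fail
  | fuel + 1, n3, k => do
    let p ← shl 1 k
    if ← lt p n3 then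
      let k' ← add k 1
      findBits fuel n3 k'
    else
      return k

def setup : RAM Regs := do
  let n ← read 0
  let N ← add n 2
  let ord ← add 4 N
  let lu ← add ord N
  let ru ← add lu N
  let lv ← add ru N
  let asc ← add lv N
  let hd ← add asc N
  let nx ← add hd N
  let qt ← add nx N
  let veb ← add qt N
  let n3 ← add n 3
  let bits ← findBits n3 n3 1
  return ⟨n, ord, lu, ru, lv, asc, veb, bits⟩

/-- `S ← ∅`. -/
def clearDict (e : Regs) : RAM Unit := do
  let size ← vebSize e.bits
  forUp 0 size (fun i => writeAt e.veb i 0)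

/-- The inner loop: delete all intervals that contain `[ℓ, r]`. -/
def deleteLoop (e : Regs) : ℕ → ℕ → ℕ → RAM Unit
  | 0, _, _ => fail
  | fuel + 1, ℓ, r => do
    tick
    let r' ← sub r 1
    let s ← vebSucc e.bits e.veb e.bits r'
    if ← lt 0 s then
      let rs ← sub s 1
      let ℓs ← readAt e.asc rs
      if ← lt ℓ ℓs then
        return ()
      else if ← lt rs r then
        return ()
      else
        vebDelete e.bits e.veb e.bits rs
        deleteLoop e fuel ℓ r
    else
      return ()

/-- Insert `[ℓ, r]` into the dictionary unless it contains an interval of the dictionary. -/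
def insertIfMinimal (e : Regs) (ℓ r : ℕ) : RAM Unit := do
  let r1 ← add r 1
  let p ← vebPred e.bits e.veb e.bits r1
  let mut contains := false
  if ← lt 0 p then
    let rp ← sub p 1
    let ℓp ← readAt e.asc rp
    let left ← lt ℓp ℓ
    let right ← lt r rp
    contains := !left && !right
  if contains then
    return ()
  else
    vebInsert e.bits e.veb e.bits r
    writeAt e.asc r ℓ

/-- The round of the main loop for the `k`-th position in the order. -/
def processPosition (e : Regs) (k : ℕ) : RAM Unit := do
  let i ← readAt e.ord k
  let p ← vebPred e.bits e.veb e.bits i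
  if ← eq p 0 then
    writeAt e.lv i 0
  else
    let r ← sub p 1
    let ℓ ← readAt e.asc r
    writeAt e.lv i ℓ
  let ℓnew ← readAt e.lu i
  let rnew ← readAt e.ru i
  deleteLoop e (e.n + 1) ℓnew rnew
  insertIfMinimal e ℓnew rnew

/-- UPDATE-LEFT-MAX, its loop cut off after `t` rounds. -/
def updateLeftMaxRounds (t : ℕ) : RAM Unit := do
  let e ← setup
  let u ← read 1
  if ← eq u 0 then
    forUp 1 t (fun i => writeAt e.lv i i)
  else
    clearDict e
    forUp 1 t (processPosition e)

/-- UPDATE-LEFT-MAX; the positions are expected in array `1`. -/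
def updateLeftMax : RAM Unit := do
  let n ← read 0
  updateLeftMaxRounds n

/-! ## Sorting the positions (radix sort in base `n + 2`, least significant digit first) -/

/-- Append the linked list that starts at `i` to the order; cell `3` holds the next free index. -/
def collect : ℕ → ℕ → ℕ → ℕ → RAM Unit
  | 0, _, _, _ => fail
  | fuel + 1, ord, nx, i => do
    if ← eq i 0 then
      return ()
    else
      let pos ← read 3
      writeAt ord pos i
      let pos' ← add pos 1
      write 3 pos'
      let i' ← readAt nx i
      collect fuel ord nx i'

/-- Repeat stable distribution passes until no digit is left; cell `2` tells if there is one. -/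
def radixLoop : ℕ → ℕ → ℕ → ℕ → ℕ → ℕ → ℕ → RAM Unit
  | 0, _, _, _, _, _, _ => fail
  | fuel + 1, n, N, ord, hd, nx, qt => do
    tick
    write 2 0
    write 3 1
    forUp 0 N (fun d => writeAt hd d 0)
    forUp 0 n (fun k => do
      let k' ← sub n k
      let i ← readAt ord k'
      let q ← readAt qt i
      let d ← mod q N
      let q' ← div q N
      writeAt qt i q'
      if ← lt 0 q' then
        write 2 1
      let h ← readAt hd d
      writeAt nx i h
      writeAt hd d i)
    forUp 1 N (fun k => do
      let d ← sub N k
      let i ← readAt hd d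
      collect (n + 1) ord nx i)
    let more ← read 2
    if ← eq more 0 then
      return ()
    else
      radixLoop fuel n N ord hd nx qt

/-- Write the positions into array `1`, in decreasing order of their values. -/
def sortPositions : RAM Unit := do
  let n ← read 0
  let N ← add n 2
  let ord ← add 4 N
  let t5 ← mul 5 N
  let hd ← add ord t5
  let nx ← add hd N
  let qt ← add nx N
  forUp 1 n (fun i => do
    writeAt ord i i
    let x ← readAt 4 i
    writeAt qt i x)
  let w ← readThe ℕ
  radixLoop w n N ord hd nx qt

/-- UPDATE-LEFT-MAX, preceded by sorting the positions. -/
def sortAndUpdateLeftMax : RAM Unit := do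
  sortPositions
  updateLeftMax

/-! ## What is computed -/

/-- The memory holds the arguments of a call for the node `v`. -/
structure IsInput (P : ℕ → ℕ) (m : ℕ) (T : ℕ → ℕ) (n v w : ℕ) (mem : ℕ → ℕ) : Prop where
  length : mem 0 = n
  text : ∀ i ∈ Set.Icc 1 n, mem (arr n 0 i) = T i
  fits : ∀ i ∈ Set.Icc 1 n, T i < 2 ^ w
  child : (mem 1 = 0 ∧ ¬ ∃ u, IsLeftChild P m v u) ∨
    (IsLeftChild P m v (mem 1) ∧
      TablesFor P m T n (mem 1) (fun j => mem (arr n 2 j)) (fun j => mem (arr n 3 j)))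

/-- Array `1` lists all positions in decreasing order of their values. -/
def IsSortedInput (T : ℕ → ℕ) (n : ℕ) (mem : ℕ → ℕ) : Prop :=
  (∀ k ∈ Set.Icc 1 n, mem (arr n 1 k) ∈ Set.Icc 1 n) ∧
    ∀ k ∈ Set.Icc 1 n, ∀ k' ∈ Set.Icc 1 n, k < k' → T (mem (arr n 1 k')) < T (mem (arr n 1 k))

/-- The table `Lv` is the correct output of a call for `v` on the memory `mem`. -/
structure IsOutput (P : ℕ → ℕ) (m : ℕ) (T : ℕ → ℕ) (n v : ℕ) (mem Lv : ℕ → ℕ) : Prop where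
  /-- It is the table that UPDATE-LEFT-MAX is to compute. -/
  of_nil : mem 1 = 0 → ∀ i ∈ Set.Icc 1 n, Lv i = i
  of_child : mem 1 ≠ 0 → ∀ i ∈ Set.Icc 1 n,
    Lv i = leftMax T (fun j => mem (arr n 2 j)) (fun j => mem (arr n 3 j)) i
  /-- It gives `L(v, i)` wherever `mfi(v, i) ≠ [-∞, ∞]`. -/
  eq_leftEnd : ∀ i ∈ Set.Icc 1 n, mfi P m T n v i ≠ none → Lv i = leftEnd P m T n v i
  /-- Along with the table from UPDATE-RIGHT-MIN it records `mfi(v, i)` for all `i`. -/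
  tables : ∀ Rv, IsRightMinTable P m T n v Rv → TablesFor P m T n v Lv Rv

/-- The intervals in the dictionary, as pairs of a left and a right end. -/
def dictionary (n : ℕ) (mem : ℕ → ℕ) : Set (ℕ × ℕ) :=
  {p | p.2 ∈ vebSet mem (arr n 9 0) (Nat.clog 2 (n + 3)) ∧ p.1 = mem (arr n 5 p.2)}

/-- The candidate intervals `[L[v.L][i], R[v.L][i]]` of the first `t` positions in the order. -/
def candidates (n : ℕ) (mem : ℕ → ℕ) (t : ℕ) : Set (ℕ × ℕ) :=
  {p | ∃ k ∈ Set.Icc 1 t, p = (mem (arr n 2 (mem (arr n 1 k))), mem (arr n 3 (mem (arr n 1 k))))}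

/-- The members of a set of intervals that properly contain no other member. -/
def minimalIntervals (S : Set (ℕ × ℕ)) : Set (ℕ × ℕ) :=
  {p ∈ S | ∀ q ∈ S, p.1 ≤ q.1 → q.2 ≤ p.2 → q = p}

end CTMSeq

namespace CTMSeq

/-! ## Cartesian trees and minimal fixed-intervals: the recursion -/

/-! Correctness of the recursion. A subsequence of `T` that has the tree of `P_v` and its minimum at
`i` splits at `i` into two parts. They realise the left and the right subtree, and each can be
chosen without regard to the other (`fits_node_iff`). So the left and right ends of the
fixed-intervals with the pivot `(v, i)` range independently, and a least interval exists as soon as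
there is any (`exists_least_fits`). Its left end is governed by the minimal fixed-intervals of the
left child that end before `i` and whose pivot has a larger value than `T i`
(`IsNode.sideFits_left_iff`). Hence a table that satisfies the recursion has all the properties
claimed of the output (`IsInput.isOutput`).

Correctness of the loop. Positions come in decreasing order of value, so the condition `T i < T j`
means that `j` was processed before `i`, and `j < i` follows from `j ≤ B j < i`. What is wanted is
thus the largest left end of a candidate whose right end is below `i` (`LoopInput.le_leftMax_iff`).
Candidates that contain another candidate are irrelevant to this maximum. Among the
inclusion-minimal ones left ends increase with right ends, so the maximum sits at the predecessor of
`i` (`LoopInput.leftMax_eq`). When a candidate `x` arrives, the minimal intervals that contain `x`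
disappear, and `x` enters unless a survivor lies inside it (`mem_minimalIntervals_insert`). By the
same monotonicity the intervals to be deleted are consecutive, starting at the successor of `r - 1`,
and one predecessor query settles whether a survivor lies inside `x`.

Cost. A van Emde Boas operation on keys of `j` bits follows a single expensive recursion into a tree
with at most `⌈j / 2⌉` bits, which gives `O(log j)` time. With `O(log n)` bits this is `O(log log
n)`, and the tree occupies `O(n)` cells. The inner loop is amortised: each deletion is paid for by
the insertion of the same key, and each round inserts at most one. The potential appears in
`deleteLoop_spec` and `LoopInv`. Radix sort in base `n + 2` needs at most `d + 1` passes of linear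
time if the characters are at most `n ^ d`.

All statements on programs go through `Wp`, which follows memory and time together, bounds the
addresses and the recursion depth, and guarantees that no operation overflows a word. -/

theorem cartesianTree_nil : cartesianTree [] = .nil := by
  unfold cartesianTree; simp

/-- The root is the leftmost minimum, so strictness is needed only on the left of `x`. -/
theorem cartesianTree_append_cons {A B : List ℕ} {x : ℕ} (hA : ∀ y ∈ A, x < y)
    (hB : ∀ y ∈ B, x ≤ y) :
    cartesianTree (A ++ x :: B) = .node () (cartesianTree A) (cartesianTree B) := by
  have hmin : (A ++ x :: B).min? = some x := by
    rw [List.min?_eq_some_iff]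
    refine ⟨by simp, fun b hb => ?_⟩
    rcases List.mem_append.1 hb with h | h
    · exact (hA b h).le
    · rcases List.mem_cons.1 h with h | h
      · exact h.ge
      · exact hB b h
  have hidx : minidx (A ++ x :: B) = A.length := by
    unfold minidx
    rw [hmin, Option.getD_some, List.idxOf_append_of_notMem (fun h => (hA x h).ne rfl)]
    simp
  rw [cartesianTree, dif_neg (by simp)]
  dsimp only
  rw [hidx]
  simp

/-- Since every character is a node, equal trees force equal lengths; the length condition in
`IsFixedInterval` is therefore redundant. -/
theorem numNodes_cartesianTree (S : List ℕ) : (cartesianTree S).numNodes = S.length := by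
  induction hk : S.length using Nat.strong_induction_on generalizing S with
  | _ k ih =>
    by_cases h : S = []
    · subst h; subst hk; simp [cartesianTree_nil, BinaryTree.numNodes]
    · have hlt := minidx_lt h
      rw [cartesianTree, dif_neg h]
      simp only [BinaryTree.numNodes]
      rw [ih _ (by simp only [List.length_take]; omega) _ rfl,
        ih _ (by simp only [List.length_drop]; omega) _ rfl]
      simp only [List.length_take, List.length_drop]
      omega

theorem cartesianTree_eq_nil_iff {S : List ℕ} : cartesianTree S = .nil ↔ S = [] := by
  constructor
  · intro h
    have := numNodes_cartesianTree S
    rw [h] at this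
    exact List.length_eq_zero_iff.1 this.symm
  · rintro rfl; exact cartesianTree_nil

theorem length_substring (S : ℕ → ℕ) (a b : ℕ) : (substring S a b).length = b + 1 - a := by
  simp [substring]

theorem substring_eq_append {S : ℕ → ℕ} {a v b : ℕ} (h1 : 1 ≤ v) (hav : a ≤ v) (hvb : v ≤ b) :
    substring S a b = substring S a (v - 1) ++ S v :: substring S (v + 1) b := by
  unfold substring
  have e : List.range' a (b + 1 - a) =
      List.range' a (v - 1 + 1 - a) ++ v :: List.range' (v + 1) (b + 1 - (v + 1)) := by
    have e1 : b + 1 - a = (v - 1 + 1 - a) + ((b + 1 - (v + 1)) + 1) := by omega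
    rw [e1, ← List.range'_append_1, List.range'_succ]
    have e2 : a + (v - 1 + 1 - a) = v := by omega
    rw [e2]
  rw [e]; simp

theorem mem_substring {S : ℕ → ℕ} {a b y : ℕ} :
    y ∈ substring S a b ↔ ∃ k, a ≤ k ∧ k ≤ b ∧ S k = y := by
  simp only [substring, List.mem_map, List.mem_range'_1]
  constructor
  · rintro ⟨k, hk, rfl⟩; exact ⟨k, hk.1, by omega, rfl⟩
  · rintro ⟨k, h1, h2, rfl⟩; exact ⟨k, ⟨h1, by omega⟩, rfl⟩

/-! ### Nodes -/

theorem IsNode.bounds {P : ℕ → ℕ} {m v a b : ℕ} (h : IsNode P m v a b) :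
    1 ≤ a ∧ a ≤ v ∧ v ≤ b ∧ b ≤ m := by
  induction h with
  | root hv _ => exact ⟨le_rfl, hv.1, hv.2, le_rfl⟩
  | left _ hu _ ih => omega
  | right _ hu _ ih => omega

theorem IsNode.le {P : ℕ → ℕ} {m v a b : ℕ} (h : IsNode P m v a b) :
    ∀ k, a ≤ k → k ≤ b → P v ≤ P k := by
  cases h with
  | root hv hmin => exact fun k h1 h2 => hmin k ⟨h1, h2⟩
  | left h hu hmin =>
    have := h.bounds
    exact fun k h1 h2 => hmin k h1 (by omega)
  | right h hu hmin => exact fun k h1 h2 => hmin k (by omega) h2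

theorem IsNode.lt_of_ne {P : ℕ → ℕ} {m v a b : ℕ} (hP : Set.InjOn P (Set.Icc 1 m))
    (h : IsNode P m v a b) {k : ℕ} (h1 : a ≤ k) (h2 : k ≤ b) (hk : k ≠ v) : P v < P k := by
  have hb := h.bounds
  refine lt_of_le_of_ne (h.le k h1 h2) fun e => hk ?_
  exact (hP ⟨by omega, by omega⟩ ⟨by omega, by omega⟩ e).symm

/-- Each step down the tree cuts the span at an ancestor, whose character is smaller. The span of
`v` is thus a maximal interval on which `P v` is the minimum, which is why `v` determines it. -/
theorem IsNode.outside_lt {P : ℕ → ℕ} {m v a b : ℕ} (hP : Set.InjOn P (Set.Icc 1 m))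
    (h : IsNode P m v a b) : (a = 1 ∨ P (a - 1) < P v) ∧ (b = m ∨ P (b + 1) < P v) := by
  induction h with
  | root hv _ => exact ⟨.inl rfl, .inl rfl⟩
  | @left v a b u h hu hmin ih =>
    have hb := h.bounds
    have hlt := h.lt_of_ne hP hu.1 (by omega) (by omega : u ≠ v)
    refine ⟨ih.1.imp_right (·.trans hlt), .inr ?_⟩
    rwa [Nat.sub_add_cancel (by omega)]
  | @right v a b u h hu hmin ih =>
    have hb := h.bounds
    have hlt := h.lt_of_ne hP (by omega) hu.2 (by omega : u ≠ v)
    exact ⟨.inr (by simpa using hlt), ih.2.imp_right (·.trans hlt)⟩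

theorem IsNode.span_unique {P : ℕ → ℕ} {m v a b a' b' : ℕ} (hP : Set.InjOn P (Set.Icc 1 m))
    (h : IsNode P m v a b) (h' : IsNode P m v a' b') : a' = a ∧ b' = b := by
  have aux : ∀ {a b a' b'}, IsNode P m v a b → IsNode P m v a' b' → a' ≤ a ∧ b ≤ b' := by
    intro a b a' b' h h'
    have hb := h.bounds
    have hb' := h'.bounds
    obtain ⟨h1, h2⟩ := h'.outside_lt hP
    constructor
    · by_contra! hlt
      have := h1.resolve_left (by omega)
      exact absurd (h.le (a' - 1) (by omega) (by omega)) (by omega)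
    · by_contra! hlt
      have := h2.resolve_left (by omega)
      exact absurd (h.le (b' + 1) (by omega) (by omega)) (by omega)
  have h1 := aux h h'
  have h2 := aux h' h
  omega

theorem exists_argmin (P : ℕ → ℕ) {a b : ℕ} (h : a ≤ b) :
    ∃ u, a ≤ u ∧ u ≤ b ∧ ∀ k, a ≤ k → k ≤ b → P u ≤ P k := by
  obtain ⟨u, hu, hmin⟩ := Finset.exists_min_image (Finset.Icc a b) P ⟨a, by simp [h]⟩
  rw [Finset.mem_Icc] at hu
  exact ⟨u, hu.1, hu.2, fun k h1 h2 => hmin k (Finset.mem_Icc.2 ⟨h1, h2⟩)⟩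

/-- Descend from the root towards `v`; the span always contains `v` and shrinks, so the descent ends
at `v`. -/
theorem exists_isNode {P : ℕ → ℕ} {m v : ℕ} (hv : v ∈ Set.Icc 1 m) : ∃ a b, IsNode P m v a b := by
  have key : ∀ k u a b, b - a = k → IsNode P m u a b → a ≤ v → v ≤ b →
      ∃ a b, IsNode P m v a b := by
    intro k
    induction k using Nat.strong_induction_on with
    | _ k ih =>
      intro u a b hk h h1 h2
      have hb := h.bounds
      rcases lt_trichotomy v u with hlt | rfl | hlt
      · obtain ⟨x, hx1, hx2, hx⟩ := exists_argmin P (show a ≤ u - 1 by omega)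
        exact ih _ (by omega) x a (u - 1) rfl
          (h.left ⟨hx1, by omega⟩ fun k h1 h2 => hx k h1 (by omega)) h1 (by omega)
      · exact ⟨a, b, h⟩
      · obtain ⟨x, hx1, hx2, hx⟩ := exists_argmin P (show u + 1 ≤ b by omega)
        exact ih _ (by omega) x (u + 1) b rfl
          (h.right ⟨by omega, hx2⟩ fun k h1 h2 => hx k h1 h2) (by omega) h2
  obtain ⟨x, hx1, hx2, hx⟩ := exists_argmin P (show 1 ≤ m from hv.1.trans hv.2)
  exact key _ x 1 m rfl (.root ⟨hx1, hx2⟩ fun k hk => hx k hk.1 hk.2) hv.1 hv.2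

theorem IsNode.isLeftChild_iff {P : ℕ → ℕ} {m v a b u : ℕ} (hP : Set.InjOn P (Set.Icc 1 m))
    (h : IsNode P m v a b) : IsLeftChild P m v u ↔ IsNode P m u a (v - 1) := by
  constructor
  · rintro ⟨a', b', h1, h2⟩
    obtain ⟨rfl, rfl⟩ := h.span_unique hP h1
    exact h2
  · exact fun h' => ⟨a, b, h, h'⟩

theorem IsNode.isRightChild_iff {P : ℕ → ℕ} {m v a b u : ℕ} (hP : Set.InjOn P (Set.Icc 1 m))
    (h : IsNode P m v a b) : IsRightChild P m v u ↔ IsNode P m u (v + 1) b := by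
  constructor
  · rintro ⟨a', b', h1, h2⟩
    obtain ⟨rfl, rfl⟩ := h.span_unique hP h1
    exact h2
  · exact fun h' => ⟨a, b, h, h'⟩

theorem IsNode.eq_of_not_exists_left {P : ℕ → ℕ} {m v a b : ℕ} (h : IsNode P m v a b)
    (hn : ¬ ∃ u, IsLeftChild P m v u) : a = v := by
  have hb := h.bounds
  by_contra hne
  obtain ⟨x, hx1, hx2, hx⟩ := exists_argmin P (show a ≤ v - 1 by omega)
  exact hn ⟨x, a, b, h, h.left ⟨hx1, by omega⟩ fun k h1 h2 => hx k h1 (by omega)⟩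

theorem IsNode.eq_of_not_exists_right {P : ℕ → ℕ} {m v a b : ℕ} (h : IsNode P m v a b)
    (hn : ¬ ∃ u, IsRightChild P m v u) : b = v := by
  have hb := h.bounds
  by_contra hne
  obtain ⟨x, hx1, hx2, hx⟩ := exists_argmin P (show v + 1 ≤ b by omega)
  exact hn ⟨x, a, b, h, h.right ⟨by omega, hx2⟩ fun k h1 h2 => hx k (by omega) h2⟩

theorem IsNode.cartesianTree_substring {P : ℕ → ℕ} {m v a b : ℕ}
    (hP : Set.InjOn P (Set.Icc 1 m)) (h : IsNode P m v a b) :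
    cartesianTree (substring P a b) = .node () (cartesianTree (substring P a (v - 1)))
      (cartesianTree (substring P (v + 1) b)) := by
  have hb := h.bounds
  rw [substring_eq_append (by omega) hb.2.1 hb.2.2.1]
  refine cartesianTree_append_cons (fun y hy => ?_) fun y hy => ?_
  · obtain ⟨k, h1, h2, rfl⟩ := mem_substring.1 hy
    exact h.lt_of_ne hP h1 (by omega) (by omega)
  · obtain ⟨k, h1, h2, rfl⟩ := mem_substring.1 hy
    exact h.le k (by omega) h2

/-! ### Fixed-intervals of a tree -/

/-- `[ℓ, r]` contains the positions of a subsequence of `T[1..n]` with the Cartesian tree `τ` and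
the minimum at `i`. -/
def Fits (T : ℕ → ℕ) (n : ℕ) (τ : BinaryTree Unit) (i ℓ r : ℕ) : Prop :=
  1 ≤ ℓ ∧ r ≤ n ∧ ∃ I : List ℕ, I.Pairwise (· < ·) ∧ i ∈ I ∧ (∀ x ∈ I, ℓ ≤ x ∧ x ≤ r) ∧
    cartesianTree (I.map T) = τ ∧ ∀ x ∈ I, T i ≤ T x

theorem IsNode.isFixedInterval_iff {P T : ℕ → ℕ} {m n v a b i ℓ r : ℕ}
    (hP : Set.InjOn P (Set.Icc 1 m)) (h : IsNode P m v a b) :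
    IsFixedInterval P m T n v i ℓ r ↔ Fits T n (cartesianTree (substring P a b)) i ℓ r := by
  constructor
  · rintro ⟨h1, _, h3, a', b', h', I, hI, _, _, hi, hlr, hct, hmin⟩
    obtain ⟨rfl, rfl⟩ := h.span_unique hP h'
    exact ⟨h1, h3, I, hI, hi, hlr, hct, hmin⟩
  · rintro ⟨h1, h3, I, hI, hi, hlr, hct, hmin⟩
    refine ⟨h1, (hlr i hi).1.trans (hlr i hi).2, h3, a, b, h, I, hI,
      fun x hx => ⟨h1.trans (hlr x hx).1, (hlr x hx).2.trans h3⟩, ?_, hi, hlr, hct, hmin⟩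
    have := congrArg BinaryTree.numNodes hct
    rwa [numNodes_cartesianTree, numNodes_cartesianTree, List.length_map] at this

theorem Fits.mono {T : ℕ → ℕ} {n : ℕ} {τ : BinaryTree Unit} {i ℓ r ℓ' r' : ℕ}
    (h : Fits T n τ i ℓ r) (h1 : 1 ≤ ℓ') (hl : ℓ' ≤ ℓ) (hr : r ≤ r') (hn : r' ≤ n) :
    Fits T n τ i ℓ' r' := by
  obtain ⟨_, _, I, hI, hi, hlr, hct, hmin⟩ := h
  exact ⟨h1, hn, I, hI, hi, fun x hx => ⟨hl.trans (hlr x hx).1, (hlr x hx).2.trans hr⟩, hct, hmin⟩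

theorem Fits.pivot_mem {T : ℕ → ℕ} {n : ℕ} {τ : BinaryTree Unit} {i ℓ r : ℕ}
    (h : Fits T n τ i ℓ r) : 1 ≤ ℓ ∧ ℓ ≤ i ∧ i ≤ r ∧ r ≤ n := by
  obtain ⟨h1, h2, I, _, hi, hlr, _⟩ := h
  exact ⟨h1, (hlr i hi).1, (hlr i hi).2, h2⟩

/-- `[ℓ, r]` contains the part of a subsequence that makes up the subtree `τ` of the node whose
minimum is `T i`. -/
def SideFits (T : ℕ → ℕ) (n : ℕ) (τ : BinaryTree Unit) (i ℓ r : ℕ) : Prop :=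
  τ = .nil ∨ ∃ j, T i < T j ∧ Fits T n τ j ℓ r

/-- The pivot `j` of a nonempty part is the position of its minimum, so comparing `T i` with `T j`
alone compares it with the whole part. The empty list accounts for a missing subtree. -/
theorem sideFits_iff_exists_list {T : ℕ → ℕ} {n : ℕ} {τ : BinaryTree Unit} {i ℓ r : ℕ}
    (hl : 1 ≤ ℓ) (hr : r ≤ n) :
    SideFits T n τ i ℓ r ↔ ∃ I : List ℕ, I.Pairwise (· < ·) ∧ (∀ x ∈ I, ℓ ≤ x ∧ x ≤ r) ∧
      cartesianTree (I.map T) = τ ∧ ∀ x ∈ I, T i < T x := by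
  constructor
  · rintro (rfl | ⟨j, hj, _, _, I, hI, hi, hlr, hct, hmin⟩)
    · exact ⟨[], by simp, by simp, by simp [cartesianTree_nil], by simp⟩
    · exact ⟨I, hI, hlr, hct, fun x hx => hj.trans_le (hmin x hx)⟩
  · rintro ⟨I, hI, hlr, hct, hmin⟩
    by_cases h : I = []
    · subst h; left; rw [← hct]; exact cartesianTree_nil
    · obtain ⟨j, hj, hjm⟩ := Finset.exists_min_image I.toFinset T
        (List.toFinset_nonempty_iff I |>.2 h)
      rw [List.mem_toFinset] at hj
      exact .inr ⟨j, hmin j hj, hl, hr, I, hI, hj, hlr, hct,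
        fun x hx => hjm x (List.mem_toFinset.2 hx)⟩

/-- Cutting the positions at `i` turns one subsequence into two, and gluing inverts this. Nothing
ties the two parts together, because each is compared only with `T i`. Distinct characters make
these comparisons strict. -/
theorem fits_node_iff {T : ℕ → ℕ} {n : ℕ} {τL τR : BinaryTree Unit} {i ℓ r : ℕ}
    (hT : Set.InjOn T (Set.Icc 1 n)) :
    Fits T n (.node () τL τR) i ℓ r ↔ (1 ≤ ℓ ∧ ℓ ≤ i ∧ i ≤ r ∧ r ≤ n) ∧
      SideFits T n τL i ℓ (i - 1) ∧ SideFits T n τR i (i + 1) r := by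
  constructor
  · intro h
    have hp := h.pivot_mem
    refine ⟨hp, ?_⟩
    rw [sideFits_iff_exists_list hp.1 (by omega), sideFits_iff_exists_list (by omega) hp.2.2.2]
    obtain ⟨h1, h2, I, hI, hi, hlr, hct, hmin⟩ := h
    obtain ⟨A, B, rfl⟩ := List.append_of_mem hi
    rw [List.pairwise_append, List.pairwise_cons] at hI
    obtain ⟨hA, ⟨hiB, hB⟩, hAB⟩ := hI
    have hlt : ∀ x ∈ A ++ i :: B, x ≠ i → T i < T x := fun x hx hne =>
      lt_of_le_of_ne (hmin x hx) fun e => hne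
        (hT ⟨by omega, by omega⟩ ⟨h1.trans (hlr x hx).1, (hlr x hx).2.trans h2⟩ e).symm
    have hmA : ∀ x ∈ A, T i < T x := fun x hx =>
      hlt x (by simp [hx]) (hAB x hx i (by simp)).ne
    have hmB : ∀ x ∈ B, T i < T x := fun x hx => hlt x (by simp [hx]) (hiB x hx).ne'
    rw [List.map_append, List.map_cons, cartesianTree_append_cons
      (by simpa using hmA) (by simpa using fun x hx => (hmB x hx).le)] at hct
    injection hct with _ hct1 hct2
    refine ⟨⟨A, hA, fun x hx => ⟨(hlr x (by simp [hx])).1, ?_⟩, hct1, hmA⟩,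
      ⟨B, hB, fun x hx => ⟨hiB x hx, (hlr x (by simp [hx])).2⟩, hct2, hmB⟩⟩
    have := hAB x hx i (by simp)
    omega
  · rintro ⟨hp, hL, hR⟩
    rw [sideFits_iff_exists_list hp.1 (by omega)] at hL
    rw [sideFits_iff_exists_list (by omega) hp.2.2.2] at hR
    obtain ⟨A, hA, hlA, hctA, hmA⟩ := hL
    obtain ⟨B, hB, hlB, hctB, hmB⟩ := hR
    refine ⟨hp.1, hp.2.2.2, A ++ i :: B, ?_, by simp, ?_, ?_, ?_⟩
    · rw [List.pairwise_append, List.pairwise_cons]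
      refine ⟨hA, ⟨fun x hx => (hlB x hx).1, hB⟩, fun x hx y hy => ?_⟩
      have := hlA x hx
      rcases List.mem_cons.1 hy with rfl | hy
      · omega
      · have := hlB y hy; omega
    · intro x hx
      rcases List.mem_append.1 hx with hx | hx
      · have := hlA x hx; omega
      · rcases List.mem_cons.1 hx with rfl | hx
        · omega
        · have := hlB x hx; omega
    · rw [List.map_append, List.map_cons, cartesianTree_append_cons
        (by simpa using hmA) (by simpa using fun x hx => (hmB x hx).le), hctA, hctB]
    · intro x hx
      rcases List.mem_append.1 hx with hx | hx
      · exact (hmA x hx).le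
      · rcases List.mem_cons.1 hx with rfl | hx
        · exact le_rfl
        · exact (hmB x hx).le

/-- By `fits_node_iff` the two ends range independently, so the greatest left end and the least
right end occur in one and the same interval. -/
theorem exists_least_fits {T : ℕ → ℕ} {n : ℕ} (hT : Set.InjOn T (Set.Icc 1 n))
    {τ : BinaryTree Unit} {i ℓ r : ℕ} (h : Fits T n τ i ℓ r) :
    ∃ ℓ₀ r₀, Fits T n τ i ℓ₀ r₀ ∧ ∀ ℓ r, Fits T n τ i ℓ r → ℓ ≤ ℓ₀ ∧ r₀ ≤ r := by
  match τ, h with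
  | .nil, ⟨_, _, I, _, hi, _, hct, _⟩ =>
    rw [cartesianTree_eq_nil_iff, List.map_eq_nil_iff] at hct
    simp [hct] at hi
  | .node () τL τR, h =>
    rw [fits_node_iff hT] at h
    obtain ⟨hp, hL, hR⟩ := h
    have exL : ∃ ℓ₀, (1 ≤ ℓ₀ ∧ ℓ₀ ≤ i ∧ SideFits T n τL i ℓ₀ (i - 1)) ∧
        ∀ ℓ, 1 ≤ ℓ ∧ ℓ ≤ i ∧ SideFits T n τL i ℓ (i - 1) → ℓ ≤ ℓ₀ := by
      classical
      refine ⟨Nat.findGreatest (fun ℓ => 1 ≤ ℓ ∧ ℓ ≤ i ∧ SideFits T n τL i ℓ (i - 1)) i,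
        Nat.findGreatest_spec (P := fun ℓ => 1 ≤ ℓ ∧ ℓ ≤ i ∧ SideFits T n τL i ℓ (i - 1))
          hp.2.1 ⟨hp.1, hp.2.1, hL⟩, fun ℓ hℓ => Nat.le_findGreatest hℓ.2.1 hℓ⟩
    have exR : ∃ r₀, (i ≤ r₀ ∧ r₀ ≤ n ∧ SideFits T n τR i (i + 1) r₀) ∧
        ∀ r, i ≤ r ∧ r ≤ n ∧ SideFits T n τR i (i + 1) r → r₀ ≤ r := by
      classical
      have ex : ∃ r, i ≤ r ∧ r ≤ n ∧ SideFits T n τR i (i + 1) r := ⟨r, hp.2.2.1, hp.2.2.2, hR⟩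
      exact ⟨Nat.find ex, Nat.find_spec ex, fun r hr => Nat.find_min' ex hr⟩
    obtain ⟨ℓ₀, ⟨a1, a2, a3⟩, a4⟩ := exL
    obtain ⟨r₀, ⟨b1, b2, b3⟩, b4⟩ := exR
    refine ⟨ℓ₀, r₀, (fits_node_iff hT).2 ⟨⟨a1, a2, b1, b2⟩, a3, b3⟩, fun ℓ r h => ?_⟩
    obtain ⟨c, cL, cR⟩ := (fits_node_iff hT).1 h
    exact ⟨a4 ℓ ⟨c.1, c.2.1, cL⟩, b4 r ⟨c.2.2.1, c.2.2.2, cR⟩⟩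

/-- A least interval exists, so being minimal and being least agree. This also shows that the choice
made in `mfi` is the only possible one. -/
theorem IsNode.mfi_eq_some_iff {P T : ℕ → ℕ} {m n v a b i ℓ r : ℕ}
    (hP : Set.InjOn P (Set.Icc 1 m)) (hT : Set.InjOn T (Set.Icc 1 n)) (h : IsNode P m v a b) :
    mfi P m T n v i = some (ℓ, r) ↔ Fits T n (cartesianTree (substring P a b)) i ℓ r ∧
      ∀ ℓ' r', Fits T n (cartesianTree (substring P a b)) i ℓ' r' → ℓ' ≤ ℓ ∧ r ≤ r' := by
  set τ := cartesianTree (substring P a b) with hτ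
  have hmin : ∀ ℓ r, IsMinimalFixedInterval P m T n v i ℓ r ↔
      Fits T n τ i ℓ r ∧ ∀ ℓ' r', Fits T n τ i ℓ' r' → ℓ' ≤ ℓ ∧ r ≤ r' := by
    intro ℓ r
    simp only [IsMinimalFixedInterval, h.isFixedInterval_iff hP, ← hτ]
    constructor
    · rintro ⟨h1, h2⟩
      obtain ⟨ℓ₀, r₀, hf, hle⟩ := exists_least_fits hT h1
      obtain ⟨rfl, rfl⟩ := h2 ℓ₀ r₀ hf (hle _ _ h1).1 (hle _ _ h1).2
      exact ⟨h1, hle⟩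
    · rintro ⟨h1, h2⟩
      refine ⟨h1, fun ℓ' r' hf h3 h4 => ?_⟩
      have := h2 ℓ' r' hf
      omega
  unfold mfi
  split_ifs with hex
  · have hc := (hmin _ _).1 hex.choose_spec
    rw [Option.some.injEq]
    constructor
    · intro e; rw [e] at hc; exact hc
    · rintro ⟨h1, h2⟩
      have e1 := hc.2 _ _ h1
      have e2 := h2 _ _ hc.1
      exact Prod.ext (le_antisymm e2.1 e1.1) (le_antisymm e1.2 e2.2)
  · constructor
    · intro e; simp at e
    · intro hf; exact absurd ⟨(ℓ, r), (hmin _ _).2 hf⟩ hex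

theorem IsNode.exists_mfi_of_fits {P T : ℕ → ℕ} {m n v a b i ℓ r : ℕ}
    (hP : Set.InjOn P (Set.Icc 1 m)) (hT : Set.InjOn T (Set.Icc 1 n)) (h : IsNode P m v a b)
    (hf : Fits T n (cartesianTree (substring P a b)) i ℓ r) :
    ∃ ℓ₀ r₀, mfi P m T n v i = some (ℓ₀, r₀) ∧ ℓ ≤ ℓ₀ ∧ r₀ ≤ r := by
  obtain ⟨ℓ₀, r₀, h0, hle⟩ := exists_least_fits hT hf
  exact ⟨ℓ₀, r₀, (h.mfi_eq_some_iff hP hT).2 ⟨h0, hle⟩, hle _ _ hf⟩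

/-! ### The recursion for the tables -/

/-- The maximum is handled through its positive lower bounds, so that the default `0` for `-∞` never
has to be treated as a candidate value. -/
theorem le_leftMax_iff {T A B : ℕ → ℕ} {i ℓ : ℕ} (hℓ : 1 ≤ ℓ) :
    ℓ ≤ leftMax T A B i ↔ ∃ j, (1 ≤ j ∧ j ≤ i - 1) ∧ (T i < T j ∧ B j < i) ∧ ℓ ≤ A j := by
  rw [leftMax, Finset.le_fold_max]
  simp only [Finset.mem_filter, Finset.mem_Icc]
  constructor
  · rintro (h | ⟨j, ⟨h1, h2⟩, h3⟩)
    · omega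
    · exact ⟨j, h1, h2, h3⟩
  · rintro ⟨j, h1, h2, h3⟩; exact .inr ⟨j, ⟨h1, h2⟩, h3⟩

theorem rightMin_le_iff {T A B : ℕ → ℕ} {n i r : ℕ} (hr : r ≤ n) :
    rightMin n T A B i ≤ r ↔ ∃ j, (i + 1 ≤ j ∧ j ≤ n) ∧ (T i < T j ∧ i < A j) ∧ B j ≤ r := by
  rw [rightMin, Finset.fold_min_le]
  simp only [Finset.mem_filter, Finset.mem_Icc]
  constructor
  · rintro (h | ⟨j, ⟨h1, h2⟩, h3⟩)
    · omega
    · exact ⟨j, h1, h2, h3⟩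
  · rintro ⟨j, h1, h2, h3⟩; exact .inr ⟨j, ⟨h1, h2⟩, h3⟩

theorem substring_ne_nil {S : ℕ → ℕ} {a b : ℕ} (h : a ≤ b) :
    cartesianTree (substring S a b) ≠ .nil := by
  rw [Ne, cartesianTree_eq_nil_iff, ← List.length_eq_zero_iff, length_substring]; omega

/-- A part that fits contains the minimal fixed-interval of its pivot, which the tables record.
Conversely, an entry with `1 ≤ ℓ ≤ A j` and `B j < i` has both ends finite and is itself a
fixed-interval inside `[ℓ, i - 1]`. -/
theorem IsNode.sideFits_left_iff {P T A B : ℕ → ℕ} {m n u a b i ℓ : ℕ}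
    (hP : Set.InjOn P (Set.Icc 1 m)) (hT : Set.InjOn T (Set.Icc 1 n)) (h : IsNode P m u a b)
    (hAB : TablesFor P m T n u A B) (hi : i ∈ Set.Icc 1 n) (hℓ : 1 ≤ ℓ) :
    SideFits T n (cartesianTree (substring P a b)) i ℓ (i - 1) ↔ ℓ ≤ leftMax T A B i := by
  have hb := h.bounds
  have hi1 := hi.1
  have hi2 := hi.2
  rw [le_leftMax_iff hℓ, SideFits, or_iff_right (substring_ne_nil (by omega))]
  constructor
  · rintro ⟨j, hj, hf⟩
    have hp := hf.pivot_mem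
    obtain ⟨ℓ₀, r₀, hm, h1, h2⟩ := h.exists_mfi_of_fits hP hT hf
    obtain ⟨rfl, rfl, h3, h4⟩ := ((hAB j ⟨by omega, by omega⟩).2.2.2 ℓ₀ r₀).1 hm
    exact ⟨j, ⟨by omega, by omega⟩, ⟨hj, by omega⟩, h1⟩
  · rintro ⟨j, h1, ⟨h2, h3⟩, h4⟩
    have hm := ((hAB j ⟨by omega, by omega⟩).2.2.2 (A j) (B j)).2
      ⟨rfl, rfl, by omega, by omega⟩
    exact ⟨j, h2, ((h.mfi_eq_some_iff hP hT).1 hm).1.mono hℓ h4 (by omega) (by omega)⟩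

theorem IsNode.sideFits_right_iff {P T A B : ℕ → ℕ} {m n u a b i r : ℕ}
    (hP : Set.InjOn P (Set.Icc 1 m)) (hT : Set.InjOn T (Set.Icc 1 n)) (h : IsNode P m u a b)
    (hAB : TablesFor P m T n u A B) (hi : i ∈ Set.Icc 1 n) (hr : r ≤ n) :
    SideFits T n (cartesianTree (substring P a b)) i (i + 1) r ↔ rightMin n T A B i ≤ r := by
  have hb := h.bounds
  have hi1 := hi.1
  have hi2 := hi.2
  rw [rightMin_le_iff hr, SideFits, or_iff_right (substring_ne_nil (by omega))]
  constructor
  · rintro ⟨j, hj, hf⟩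
    have hp := hf.pivot_mem
    obtain ⟨ℓ₀, r₀, hm, h1, h2⟩ := h.exists_mfi_of_fits hP hT hf
    obtain ⟨rfl, rfl, h3, h4⟩ := ((hAB j ⟨by omega, by omega⟩).2.2.2 ℓ₀ r₀).1 hm
    exact ⟨j, ⟨by omega, by omega⟩, ⟨hj, by omega⟩, h2⟩
  · rintro ⟨j, h1, ⟨h2, h3⟩, h4⟩
    have hm := ((hAB j ⟨by omega, by omega⟩).2.2.2 (A j) (B j)).2
      ⟨rfl, rfl, by omega, by omega⟩
    exact ⟨j, h2, ((h.mfi_eq_some_iff hP hT).1 hm).1.mono (by omega) (by omega) h4 hr⟩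

/-- The table `Lv` decides the left half of the fixed-intervals with the pivots `(v, i)`. -/
def DecidesLeft (T : ℕ → ℕ) (n : ℕ) (τL : BinaryTree Unit) (Lv : ℕ → ℕ) : Prop :=
  ∀ i ∈ Set.Icc 1 n, Lv i ≤ i ∧ ∀ ℓ, 1 ≤ ℓ → (ℓ ≤ i ∧ SideFits T n τL i ℓ (i - 1) ↔ ℓ ≤ Lv i)

theorem leftMax_le {T A B : ℕ → ℕ} {n i : ℕ} (hi : i ∈ Set.Icc 1 n)
    (hA : ∀ j ∈ Set.Icc 1 n, A j ≤ j) : leftMax T A B i ≤ i := by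
  by_contra! h
  obtain ⟨j, h1, _, h3⟩ := (le_leftMax_iff (ℓ := i + 1) (by omega)).1 h
  have := hA j ⟨h1.1, by have := hi.2; omega⟩
  omega

theorem le_rightMin {T A B : ℕ → ℕ} {n i : ℕ} (hi : i ∈ Set.Icc 1 n)
    (hB : ∀ j ∈ Set.Icc 1 n, j ≤ B j) :
    i ≤ rightMin n T A B i ∧ rightMin n T A B i ≤ n + 1 := by
  constructor
  · by_contra! h
    have hi1 := hi.1
    have hi2 := hi.2
    obtain ⟨j, h1, _, h3⟩ := (rightMin_le_iff (r := i - 1) (by omega)).1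
      (show rightMin n T A B i ≤ i - 1 by omega)
    have := hB j ⟨by omega, h1.2⟩
    omega
  · rw [rightMin, Finset.fold_min_le]; exact .inl le_rfl

theorem decidesLeft_of_not_exists {P T Lv : ℕ → ℕ} {m n v a b : ℕ} (h : IsNode P m v a b)
    (hn : ¬ ∃ u, IsLeftChild P m v u) (hLv : ∀ i ∈ Set.Icc 1 n, Lv i = i) :
    DecidesLeft T n (cartesianTree (substring P a (v - 1))) Lv := by
  intro i hi
  have hnil : cartesianTree (substring P a (v - 1)) = .nil := by
    have hb := h.bounds
    have := h.eq_of_not_exists_left hn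
    rw [cartesianTree_eq_nil_iff, ← List.length_eq_zero_iff, length_substring]; omega
  rw [hLv i hi]
  exact ⟨le_rfl, fun ℓ _ => ⟨fun h => h.1, fun h => ⟨h, .inl hnil⟩⟩⟩

theorem decidesLeft_of_isLeftChild {P T Lv A B : ℕ → ℕ} {m n v a b u : ℕ}
    (hP : Set.InjOn P (Set.Icc 1 m)) (hT : Set.InjOn T (Set.Icc 1 n)) (h : IsNode P m v a b)
    (hu : IsLeftChild P m v u) (hAB : TablesFor P m T n u A B)
    (hLv : ∀ i ∈ Set.Icc 1 n, Lv i = leftMax T A B i) :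
    DecidesLeft T n (cartesianTree (substring P a (v - 1))) Lv := by
  intro i hi
  have hle := leftMax_le (T := T) (B := B) hi (fun j hj => (hAB j hj).1)
  rw [hLv i hi]
  refine ⟨hle, fun ℓ hℓ => ?_⟩
  rw [((h.isLeftChild_iff hP).1 hu).sideFits_left_iff hP hT hAB hi hℓ]
  exact ⟨fun h => h.2, fun h => ⟨h.trans hle, h⟩⟩

/-- The left end `ℓ` of the least interval passes the test, so `ℓ ≤ Lv i`. Replacing `ℓ` by `Lv i`
leaves the right part untouched and gives a fitting interval again, so `Lv i ≤ ℓ`. -/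
theorem DecidesLeft.eq_leftEnd {P T Lv : ℕ → ℕ} {m n v a b : ℕ}
    (hP : Set.InjOn P (Set.Icc 1 m)) (hT : Set.InjOn T (Set.Icc 1 n)) (h : IsNode P m v a b)
    (hLv : DecidesLeft T n (cartesianTree (substring P a (v - 1))) Lv) {i : ℕ}
    (hi : i ∈ Set.Icc 1 n) (hm : mfi P m T n v i ≠ none) : Lv i = leftEnd P m T n v i := by
  obtain ⟨⟨ℓ, r⟩, hs⟩ := Option.ne_none_iff_exists'.1 hm
  obtain ⟨hle, hdec⟩ := hLv i hi
  have hs' := (h.mfi_eq_some_iff hP hT).1 hs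
  rw [h.cartesianTree_substring hP] at hs'
  obtain ⟨hf, hbest⟩ := hs'
  obtain ⟨hp, hL, hR⟩ := (fits_node_iff hT).1 hf
  have h1 := (hdec ℓ hp.1).1 ⟨hp.2.1, hL⟩
  have h2 := (hdec (Lv i) (hp.1.trans h1)).2 le_rfl
  have h3 := hbest (Lv i) r ((fits_node_iff hT).2 ⟨⟨by omega, h2.1, hp.2.2⟩, h2.2, hR⟩)
  simp only [leftEnd, hs, Option.map_some, Option.getD_some]
  omega

theorem DecidesLeft.tablesFor {P T Lv Rv : ℕ → ℕ} {m n v a b : ℕ}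
    (hP : Set.InjOn P (Set.Icc 1 m)) (hT : Set.InjOn T (Set.Icc 1 n)) (h : IsNode P m v a b)
    (hLv : DecidesLeft T n (cartesianTree (substring P a (v - 1))) Lv)
    (hRv : IsRightMinTable P m T n v Rv) : TablesFor P m T n v Lv Rv := by
  intro i hi
  have hb := h.bounds
  have hi1 := hi.1
  have hi2 := hi.2
  obtain ⟨hle, hdec⟩ := hLv i hi
  have hright : (i ≤ Rv i ∧ Rv i ≤ n + 1) ∧ ∀ r, r ≤ n →
      (i ≤ r ∧ SideFits T n (cartesianTree (substring P (v + 1) b)) i (i + 1) r ↔ Rv i ≤ r) := by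
    rcases hRv with ⟨hn, hR⟩ | ⟨x, A, B, hx, hAB, hR⟩
    · have hnil : cartesianTree (substring P (v + 1) b) = .nil := by
        have := h.eq_of_not_exists_right hn
        rw [cartesianTree_eq_nil_iff, ← List.length_eq_zero_iff, length_substring]; omega
      rw [hR i hi]
      exact ⟨⟨le_rfl, by omega⟩, fun r _ => ⟨fun h => h.1, fun h => ⟨h, .inl hnil⟩⟩⟩
    · have hge := le_rightMin (T := T) (A := A) hi (fun j hj => (hAB j hj).2.1)
      rw [hR i hi]
      refine ⟨hge, fun r hr => ?_⟩
      rw [((h.isRightChild_iff hP).1 hx).sideFits_right_iff hP hT hAB hi hr]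
      exact ⟨fun h => h.2, fun h => ⟨hge.1.trans h, h⟩⟩
  obtain ⟨hge, hdecR⟩ := hright
  -- The fitting intervals are those inside `[1, n]` that contain `[Lv i, Rv i]`. There are none if
  -- one of the two ends is infinite; otherwise `[Lv i, Rv i]` is the least.
  have hfits : ∀ ℓ r, Fits T n (cartesianTree (substring P a b)) i ℓ r ↔
      1 ≤ ℓ ∧ r ≤ n ∧ ℓ ≤ Lv i ∧ Rv i ≤ r := by
    intro ℓ r
    rw [h.cartesianTree_substring hP, fits_node_iff hT]
    constructor
    · rintro ⟨hp, hL, hR⟩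
      exact ⟨hp.1, hp.2.2.2, (hdec ℓ hp.1).1 ⟨hp.2.1, hL⟩, (hdecR r hp.2.2.2).1 ⟨hp.2.2.1, hR⟩⟩
    · rintro ⟨h1, h2, h3, h4⟩
      have hL := (hdec ℓ h1).2 h3
      have hR := (hdecR r h2).2 h4
      exact ⟨⟨h1, hL.1, hR.1, h2⟩, hL.2, hR.2⟩
  refine ⟨hle, hge.1, hge.2, fun ℓ r => ?_⟩
  rw [h.mfi_eq_some_iff hP hT]
  simp only [hfits]
  constructor
  · rintro ⟨⟨h1, h2, h3, h4⟩, h5⟩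
    have := h5 (Lv i) (Rv i) ⟨by omega, by omega, le_rfl, le_rfl⟩
    omega
  · rintro ⟨rfl, rfl, h1, h2⟩
    exact ⟨⟨h1, h2, le_rfl, le_rfl⟩, fun ℓ' r' h => ⟨h.2.2.1, h.2.2.2⟩⟩

theorem IsLeftChild.ne_zero {P : ℕ → ℕ} {m v u : ℕ} (h : IsLeftChild P m v u) : u ≠ 0 := by
  obtain ⟨a, b, _, h⟩ := h
  have := h.bounds
  omega

/-- A table that satisfies the recursion is the correct output. -/
theorem IsInput.isOutput {P T mem Lv : ℕ → ℕ} {m n v w : ℕ} (hv : v ∈ Set.Icc 1 m)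
    (hP : Set.InjOn P (Set.Icc 1 m)) (hT : Set.InjOn T (Set.Icc 1 n))
    (hin : IsInput P m T n v w mem)
    (h0 : mem 1 = 0 → ∀ i ∈ Set.Icc 1 n, Lv i = i)
    (h1 : mem 1 ≠ 0 → ∀ i ∈ Set.Icc 1 n,
      Lv i = leftMax T (fun j => mem (arr n 2 j)) (fun j => mem (arr n 3 j)) i) :
    IsOutput P m T n v mem Lv := by
  obtain ⟨a, b, h⟩ := exists_isNode (P := P) hv
  have hdec : DecidesLeft T n (cartesianTree (substring P a (v - 1))) Lv := by
    rcases hin.child with ⟨e, hn⟩ | ⟨hu, hAB⟩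
    · exact decidesLeft_of_not_exists h hn (h0 e)
    · exact decidesLeft_of_isLeftChild hP hT h hu hAB (h1 hu.ne_zero)
  exact ⟨h0, h1, fun i hi hm => hdec.eq_leftEnd hP hT h hi hm,
    fun Rv hR => hdec.tablesFor hP hT h hR⟩

/-! ## Program logic of the word RAM -/

/-- Total correctness with exact time: started in a state with memory `m`, time `t` and recursion
depth `d`, the program `p` halts with a result, memory, time and depth that satisfy `Q`, accesses
only addresses below `B`, and has at most `K` recursive calls in progress. -/
def Wp (w B K : ℕ) {α : Type} (p : RAM α) (m : ℕ → ℕ) (t d : ℕ)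
    (Q : α → (ℕ → ℕ) → ℕ → ℕ → Prop) : Prop :=
  ∀ c k, c ≤ B → k ≤ K → ∃ a m' t' d' c' k',
    p w ⟨m, t, c, d, k⟩ = some (a, ⟨m', t', c', d', k'⟩) ∧ c' ≤ B ∧ k' ≤ K ∧ Q a m' t' d'

section Rules

variable {w B K : ℕ} {α β : Type} {m : ℕ → ℕ} {t d x y a v : ℕ}
  {Q : α → (ℕ → ℕ) → ℕ → ℕ → Prop}

theorem Wp.mono {p : RAM α} {Q' : α → (ℕ → ℕ) → ℕ → ℕ → Prop} (h : Wp w B K p m t d Q)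
    (hQ : ∀ a m' t' d', Q a m' t' d' → Q' a m' t' d') : Wp w B K p m t d Q' := by
  intro c k hc hk
  obtain ⟨a, m', t', d', c', k', h1, h2, h3, h4⟩ := h c k hc hk
  exact ⟨a, m', t', d', c', k', h1, h2, h3, hQ _ _ _ _ h4⟩

theorem Wp.ret {a : α} (h : Q a m t d) : Wp w B K (Pure.pure a : RAM α) m t d Q :=
  fun c k hc hk => ⟨a, m, t, d, c, k, rfl, hc, hk, h⟩

theorem Wp.bind {p : RAM β} {f : β → RAM α}
    (h : Wp w B K p m t d fun b m' t' d' => Wp w B K (f b) m' t' d' Q) :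
    Wp w B K (p >>= f) m t d Q := by
  intro c k hc hk
  obtain ⟨b, m', t', d', c', k', h1, h2, h3, h4⟩ := h c k hc hk
  obtain ⟨a, m'', t'', d'', c'', k'', g1, g⟩ := h4 c' k' h2 h3
  refine ⟨a, m'', t'', d'', c'', k'', ?_, g⟩
  have e : (p >>= f) w ⟨m, t, c, d, k⟩ =
      (p w ⟨m, t, c, d, k⟩).bind fun z => f z.1 w z.2 := rfl
  rw [e, h1]
  exact g1

/-- The rules below treat an operation followed by a continuation; this one supplies a continuation
for the last operation of a block. -/
theorem Wp.tail {p : RAM α} (h : Wp w B K (p >>= Pure.pure) m t d Q) : Wp w B K p m t d Q := by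
  rwa [bind_pure] at h

theorem Wp.ite {c : Prop} [Decidable c] {p q : RAM α} (h1 : c → Wp w B K p m t d Q)
    (h2 : ¬ c → Wp w B K q m t d Q) :
    Wp w B K (if decide c = true then p else q) m t d Q := by
  by_cases h : c
  · rw [if_pos (decide_eq_true h)]; exact h1 h
  · rw [if_neg (by simpa using h)]; exact h2 h

theorem Wp.ite_pos {c : Prop} [Decidable c] {p q : RAM α} (h : c) (h1 : Wp w B K p m t d Q) :
    Wp w B K (if decide c = true then p else q) m t d Q := by
  rw [if_pos (decide_eq_true h)]; exact h1

theorem Wp.ite_neg {c : Prop} [Decidable c] {p q : RAM α} (h : ¬ c) (h1 : Wp w B K q m t d Q) :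
    Wp w B K (if decide c = true then p else q) m t d Q := by
  rw [if_neg (by simpa using h)]; exact h1

theorem Wp.word {f : ℕ → RAM α} (h : v < 2 ^ w) (hk : Wp w B K (f v) m (t + 1) d Q) :
    Wp w B K (CTMSeq.word v >>= f) m t d Q := by
  refine Wp.bind fun c k hc hk' => ⟨v, m, t + 1, d, c, k, ?_, hc, hk', hk⟩
  simp [CTMSeq.word, h]

theorem Wp.add {f : ℕ → RAM α} (h : x + y < 2 ^ w) (hk : Wp w B K (f (x + y)) m (t + 1) d Q) :
    Wp w B K (CTMSeq.add x y >>= f) m t d Q := Wp.word h hk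

theorem Wp.sub {f : ℕ → RAM α} (h : x - y < 2 ^ w) (hk : Wp w B K (f (x - y)) m (t + 1) d Q) :
    Wp w B K (CTMSeq.sub x y >>= f) m t d Q := Wp.word h hk

theorem Wp.mul {f : ℕ → RAM α} (h : x * y < 2 ^ w) (hk : Wp w B K (f (x * y)) m (t + 1) d Q) :
    Wp w B K (CTMSeq.mul x y >>= f) m t d Q := Wp.word h hk

theorem Wp.div {f : ℕ → RAM α} (h : x / y < 2 ^ w) (hk : Wp w B K (f (x / y)) m (t + 1) d Q) :
    Wp w B K (CTMSeq.div x y >>= f) m t d Q := Wp.word h hk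

theorem Wp.mod {f : ℕ → RAM α} (h : x % y < 2 ^ w) (hk : Wp w B K (f (x % y)) m (t + 1) d Q) :
    Wp w B K (CTMSeq.mod x y >>= f) m t d Q := Wp.word h hk

theorem Wp.shl {f : ℕ → RAM α} (h : x * 2 ^ y < 2 ^ w)
    (hk : Wp w B K (f (x * 2 ^ y)) m (t + 1) d Q) :
    Wp w B K (CTMSeq.shl x y >>= f) m t d Q := Wp.word h hk

theorem Wp.shr {f : ℕ → RAM α} (h : x / 2 ^ y < 2 ^ w)
    (hk : Wp w B K (f (x / 2 ^ y)) m (t + 1) d Q) :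
    Wp w B K (CTMSeq.shr x y >>= f) m t d Q := Wp.word h hk

theorem Wp.shr_one {f : ℕ → RAM α} (h : x / 2 < 2 ^ w)
    (hk : Wp w B K (f (x / 2)) m (t + 1) d Q) :
    Wp w B K (CTMSeq.shr x 1 >>= f) m t d Q := by
  have e : x / 2 ^ 1 = x / 2 := by rw [pow_one]
  exact Wp.shr (by rwa [e]) (by rwa [e])

theorem Wp.tick {f : Unit → RAM α} (hk : Wp w B K (f ()) m (t + 1) d Q) :
    Wp w B K (CTMSeq.tick >>= f) m t d Q :=
  Wp.bind fun c k hc hk' => ⟨(), m, t + 1, d, c, k, rfl, hc, hk', hk⟩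

theorem Wp.eq {f : Bool → RAM α} (hk : Wp w B K (f (decide (x = y))) m (t + 1) d Q) :
    Wp w B K (CTMSeq.eq x y >>= f) m t d Q :=
  Wp.bind (Wp.tick (Wp.ret hk))

theorem Wp.lt {f : Bool → RAM α} (hk : Wp w B K (f (decide (x < y))) m (t + 1) d Q) :
    Wp w B K (CTMSeq.lt x y >>= f) m t d Q :=
  Wp.bind (Wp.tick (Wp.ret hk))

theorem Wp.read {f : ℕ → RAM α} (hB : B ≤ 2 ^ w) (h : a < B)
    (hk : Wp w B K (f (m a)) m (t + 1) d Q) :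
    Wp w B K (CTMSeq.read a >>= f) m t d Q := by
  refine Wp.bind fun c k hc hk' => ⟨m a, m, t + 1, d, max c (a + 1), k, ?_, ?_, hk', hk⟩
  · simp [CTMSeq.read, h.trans_le hB]
  · omega

theorem Wp.write {f : Unit → RAM α} (hB : B ≤ 2 ^ w) (h : a < B) (hv : v < 2 ^ w)
    (hk : Wp w B K (f ()) (Function.update m a v) (t + 1) d Q) :
    Wp w B K (CTMSeq.write a v >>= f) m t d Q := by
  refine Wp.bind fun c k hc hk' =>
    ⟨(), Function.update m a v, t + 1, d, max c (a + 1), k, ?_, ?_, hk', hk⟩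
  · simp [CTMSeq.write, h.trans_le hB, hv]
  · omega

theorem Wp.readAt {f : ℕ → RAM α} (hB : B ≤ 2 ^ w) (h : x + y < B)
    (hk : Wp w B K (f (m (x + y))) m (t + 2) d Q) :
    Wp w B K (CTMSeq.readAt x y >>= f) m t d Q :=
  Wp.bind (Wp.add (h.trans_le hB) (Wp.tail (Wp.read hB h (Wp.ret hk))))

theorem Wp.writeAt {f : Unit → RAM α} (hB : B ≤ 2 ^ w) (h : x + y < B) (hv : v < 2 ^ w)
    (hk : Wp w B K (f ()) (Function.update m (x + y) v) (t + 2) d Q) :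
    Wp w B K (CTMSeq.writeAt x y v >>= f) m t d Q :=
  Wp.bind (Wp.add (h.trans_le hB) (Wp.tail (Wp.write hB h hv (Wp.ret hk))))

theorem Wp.enter {f : Unit → RAM α} (h : d + 1 ≤ K) (hk : Wp w B K (f ()) m (t + 1) (d + 1) Q) :
    Wp w B K (CTMSeq.enter >>= f) m t d Q := by
  refine Wp.bind fun c k hc hk' =>
    ⟨(), m, t + 1, d + 1, c, max k (d + 1), rfl, hc, ?_, hk⟩
  omega

theorem Wp.leave {f : Unit → RAM α} (hk : Wp w B K (f ()) m (t + 1) d Q) :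
    Wp w B K (CTMSeq.leave >>= f) m t (d + 1) Q :=
  Wp.bind fun c k hc hk' => ⟨(), m, t + 1, d, c, k, rfl, hc, hk', hk⟩

theorem Wp.wordSize {f : ℕ → RAM α} (hk : Wp w B K (f w) m t d Q) :
    Wp w B K (readThe ℕ >>= f) m t d Q :=
  Wp.bind fun c k hc hk' => ⟨w, m, t, d, c, k, rfl, hc, hk', hk⟩

/-- The invariant also speaks of the time, so amortised bounds can be carried through a loop. The
single step at the start is the final test of the loop, which the recursion of `forUp` executes
first. -/
theorem Wp.forUp {f : ℕ → RAM Unit} {n : ℕ} (Inv : ℕ → (ℕ → ℕ) → ℕ → Prop)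
    (h0 : Inv 0 m (t + 1))
    (hs : ∀ k < n, ∀ m t, Inv k m t →
      Wp w B K (f (a + k)) m (t + 2) d fun _ m' t' d' => d' = d ∧ Inv (k + 1) m' t') :
    Wp w B K (CTMSeq.forUp a n f) m t d fun _ m' t' d' => d' = d ∧ Inv n m' t' := by
  induction n with
  | zero => exact Wp.tail (Wp.tick (Wp.ret ⟨rfl, h0⟩))
  | succ n ih =>
    rw [CTMSeq.forUp]
    refine Wp.bind ((ih fun k hk => hs k (by omega)).mono ?_)
    rintro _ m' t' _ ⟨rfl, h⟩
    exact Wp.tick (Wp.tick (hs n (by omega) m' t' h))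

end Rules

/-- What a run of a program from the initial state gives. -/
theorem Wp.run {w B K : ℕ} {α : Type} {p : RAM α} {m : ℕ → ℕ}
    {Q : α → (ℕ → ℕ) → ℕ → ℕ → Prop} (h : Wp w B K p m 0 0 Q) :
    ∃ s a, CTMSeq.run p w m = some s ∧ s.space ≤ B + K ∧ Q a s.mem s.time s.depth := by
  obtain ⟨a, m', t', d', c', k', h1, h2, h3, h4⟩ := h 0 0 (Nat.zero_le _) (Nat.zero_le _)
  refine ⟨⟨m', t', c', d', k'⟩, a, ?_, Nat.add_le_add h2 h3, h4⟩
  simp [CTMSeq.run, h1]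

/-! ## Van Emde Boas trees: the data structure -/

/-- Number of cells of a tree for keys of `j` bits. -/
def sz (j : ℕ) : ℕ := 3 * 2 ^ j - 4

/-- Address of the cluster of `h` in the tree at address `b`. -/
def clAddr (b j h : ℕ) : ℕ := b + 2 + sz (j - j / 2) + h * sz (j / 2)

/-- The depth of a recursion that halves the number of bits. -/
def lev (j : ℕ) : ℕ := Nat.clog 2 j + 1

theorem lev_mono {i j : ℕ} (h : i ≤ j) : lev i ≤ lev j :=
  Nat.add_le_add_right (Nat.clog_mono_right 2 h) 1

/-- `lev` is defined with the logarithm rounded up because the larger half, that of the summary, has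
`⌈j / 2⌉` bits. Each level of recursion then uses up one unit. -/
theorem lev_half {j : ℕ} (h : 2 ≤ j) : lev (j - j / 2) + 1 = lev j := by
  have e : (j + 2 - 1) / 2 = j - j / 2 := by omega
  rw [lev, lev, Nat.clog_of_two_le (b := 2) (by omega) h, e]

theorem lev_half' {j : ℕ} (h : 2 ≤ j) : lev (j / 2) + 1 ≤ lev j := by
  rw [← lev_half h]
  exact Nat.add_le_add_right (lev_mono (by omega)) 1

theorem lev_pos (j : ℕ) : 1 ≤ lev j := Nat.le_add_left _ _

theorem two_le_two_pow {j : ℕ} (h : 1 ≤ j) : 2 ≤ 2 ^ j :=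
  (Nat.pow_le_pow_right (n := 2) (by omega) h)

theorem two_pow_le_sz {j : ℕ} (h : 1 ≤ j) : 2 ^ j ≤ sz j := by
  have := two_le_two_pow h; unfold sz; omega

theorem sz_add_four {j : ℕ} (h : 1 ≤ j) : sz j + 4 = 3 * 2 ^ j := by
  have := two_le_two_pow h; unfold sz; omega

theorem two_pow_halves (j : ℕ) : 2 ^ (j - j / 2) * 2 ^ (j / 2) = 2 ^ j := by
  rw [← pow_add]; congr 1; omega

/-- The clusters end where the tree ends, at the latest. -/
theorem clAddr_end {b j h : ℕ} (hj : 2 ≤ j) (hh : h < 2 ^ (j - j / 2)) :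
    clAddr b j h + sz (j / 2) ≤ b + sz j := by
  have e1 := sz_add_four (show 1 ≤ j by omega)
  have e2 := sz_add_four (show 1 ≤ j - j / 2 by omega)
  have e3 := sz_add_four (show 1 ≤ j / 2 by omega)
  have e4 := two_pow_halves j
  have e5 := two_le_two_pow (show 1 ≤ j - j / 2 by omega)
  have e6 : (h + 1) * sz (j / 2) ≤ 2 ^ (j - j / 2) * sz (j / 2) := Nat.mul_le_mul_right _ hh
  -- With `H = 2 ^ (j - j / 2)`, the clusters take `3 * 2 ^ j - 4 * H` cells. The two end points and
  -- the summary need `3 * H - 2` more, and `H ≥ 2` makes the sum at most `3 * 2 ^ j - 4`.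
  have e7 : 2 ^ (j - j / 2) * (sz (j / 2) + 4) = 3 * 2 ^ j := by rw [e3, ← e4]; ring
  unfold clAddr
  rw [add_mul, one_mul] at e6
  rw [mul_add] at e7
  omega

theorem clAddr_start (b j h : ℕ) : b + 2 + sz (j - j / 2) ≤ clAddr b j h :=
  Nat.le_add_right _ _

theorem clAddr_disjoint {b j h h' : ℕ} (hlt : h < h') :
    clAddr b j h + sz (j / 2) ≤ clAddr b j h' := by
  have : (h + 1) * sz (j / 2) ≤ h' * sz (j / 2) := Nat.mul_le_mul_right _ hlt
  rw [add_mul, one_mul] at this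
  unfold clAddr
  omega

theorem summary_end {b j : ℕ} (hj : 2 ≤ j) : b + 2 + sz (j - j / 2) ≤ b + sz j := by
  have h1 := clAddr_end (b := b) (h := 0) hj (Nat.two_pow_pos _)
  have h2 := clAddr_start b j 0
  omega

theorem div_lt_halves {j x : ℕ} (h : x < 2 ^ j) : x / 2 ^ (j / 2) < 2 ^ (j - j / 2) := by
  apply Nat.div_lt_of_lt_mul
  rw [mul_comm, two_pow_halves]; exact h

theorem key_lt {L h l h' : ℕ} (hl : l < L) (hh : h < h') (l' : ℕ) : h * L + l < h' * L + l' := by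
  have : (h + 1) * L ≤ h' * L := Nat.mul_le_mul_right _ hh
  rw [add_mul, one_mul] at this
  omega

theorem key_inj {L h l h' l' : ℕ} (hl : l < L) (hl' : l' < L) (e : h * L + l = h' * L + l') :
    h = h' ∧ l = l' := by
  rcases lt_trichotomy h h' with hh | rfl | hh
  · have := key_lt hl hh l'; omega
  · exact ⟨rfl, by omega⟩
  · have := key_lt hl' hh l; omega

/-- The first two cells hold the least and the greatest element. -/
def EndPts (m : ℕ → ℕ) (b : ℕ) (S : Set ℕ) : Prop :=
  (S = ∅ ∧ m b = 0 ∧ m (b + 1) = 0) ∨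
    ∃ x y, x ∈ S ∧ y ∈ S ∧ (∀ z ∈ S, x ≤ z ∧ z ≤ y) ∧ m b = x + 1 ∧ m (b + 1) = y + 1

/-- The lower halves that occur in `R` with the upper half `h`. -/
def lows (R : Set ℕ) (L h : ℕ) : Set ℕ := {l | l < L ∧ h * L + l ∈ R}

/-- The upper halves that occur in `R`. -/
def highs (R : Set ℕ) (L : ℕ) : Set ℕ := {h | ∃ l < L, h * L + l ∈ R}

/-- The memory holds at address `b` a van Emde Boas tree for keys of `j` bits with the key
set `S`. -/
inductive Veb (m : ℕ → ℕ) : ℕ → ℕ → Set ℕ → Prop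
  | leaf {b : ℕ} {S : Set ℕ} (he : EndPts m b S) (hS : ∀ x ∈ S, x < 2) : Veb m b 1 S
  | node {b j : ℕ} {S : Set ℕ} (hj : 2 ≤ j) (he : EndPts m b S) (hS : ∀ x ∈ S, x < 2 ^ j)
      (hc : ∀ h < 2 ^ (j - j / 2),
        Veb m (clAddr b j h) (j / 2) (lows {x ∈ S | x + 1 ≠ m b} (2 ^ (j / 2)) h))
      (hs : Veb m (b + 2) (j - j / 2) (highs {x ∈ S | x + 1 ≠ m b} (2 ^ (j / 2)))) :
      Veb m b j S

/-- The clusters and the summary represent the set `R`. -/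
def Rest (m : ℕ → ℕ) (b j : ℕ) (R : Set ℕ) : Prop :=
  (∀ h < 2 ^ (j - j / 2), Veb m (clAddr b j h) (j / 2) (lows R (2 ^ (j / 2)) h)) ∧
    Veb m (b + 2) (j - j / 2) (highs R (2 ^ (j / 2)))

section Trees

variable {m m' : ℕ → ℕ} {b j : ℕ} {S R : Set ℕ}

theorem Veb.endPts (h : Veb m b j S) : EndPts m b S := by
  cases h <;> assumption

theorem Veb.lt (h : Veb m b j S) {x : ℕ} (hx : x ∈ S) : x < 2 ^ j := by
  cases h with
  | leaf _ hS => simpa using hS x hx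
  | node _ _ hS _ _ => exact hS x hx

theorem Veb.pos (h : Veb m b j S) : 1 ≤ j := by
  cases h <;> omega

theorem veb_one_iff : Veb m b 1 S ↔ EndPts m b S ∧ ∀ x ∈ S, x < 2 := by
  constructor
  · intro h; exact ⟨h.endPts, fun x hx => by simpa using h.lt hx⟩
  · exact fun h => .leaf h.1 h.2

theorem veb_iff (hj : 2 ≤ j) : Veb m b j S ↔
    EndPts m b S ∧ (∀ x ∈ S, x < 2 ^ j) ∧ Rest m b j {x ∈ S | x + 1 ≠ m b} := by
  constructor
  · intro h
    cases h with
    | leaf _ _ => omega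
    | node _ h1 h2 h3 h4 => exact ⟨h1, h2, h3, h4⟩
  · exact fun h => .node hj h.1 h.2.1 h.2.2.1 h.2.2.2

theorem EndPts.congr (h : EndPts m b S) (h0 : m' b = m b) (h1 : m' (b + 1) = m (b + 1)) :
    EndPts m' b S := by
  unfold EndPts at *; rwa [h0, h1]

/-- Everything a tree refers to lies in its own block, by `clAddr_end` and `summary_end`. Writes
elsewhere can therefore be ignored. -/
theorem Veb.congr (h : Veb m b j S) (hm : ∀ a, b ≤ a → a < b + sz j → m' a = m a) :
    Veb m' b j S := by
  induction h with
  | leaf he hS =>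
    have : sz 1 = 2 := rfl
    exact .leaf (he.congr (hm _ le_rfl (by omega)) (hm _ (by omega) (by omega))) hS
  | @node b j S hj he hS hc hs ihc ihs =>
    have hsz := two_pow_le_sz (show 1 ≤ j by omega)
    have := two_le_two_pow (show 1 ≤ j by omega)
    have h0 := hm b le_rfl (by omega)
    refine .node hj (he.congr h0 (hm _ (by omega) (by omega))) hS ?_ ?_
    · intro h hh
      rw [h0]
      refine ihc h hh fun a ha1 ha2 => hm a ?_ ?_
      · have := clAddr_start b j h; omega
      · have := clAddr_end (b := b) hj hh; omega
    · rw [h0]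
      refine ihs fun a ha1 ha2 => hm a (by omega) ?_
      have := summary_end (b := b) hj; omega

theorem Rest.congr (hj : 2 ≤ j) (h : Rest m b j R)
    (hm : ∀ a, b + 2 ≤ a → a < b + sz j → m' a = m a) : Rest m' b j R := by
  refine ⟨fun k hk => (h.1 k hk).congr fun a ha1 ha2 => hm a ?_ ?_,
    h.2.congr fun a ha1 ha2 => hm a ha1 ?_⟩
  · have := clAddr_start b j k; omega
  · have := clAddr_end (b := b) hj hk; omega
  · have := summary_end (b := b) hj; omega

theorem lows_empty (L h : ℕ) : lows ∅ L h = ∅ := by simp [lows]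

theorem highs_empty (L : ℕ) : highs ∅ L = ∅ := by simp [highs]

theorem veb_empty_of_zero (hj : 1 ≤ j) (hm : ∀ a, b ≤ a → a < b + sz j → m a = 0) :
    Veb m b j ∅ := by
  induction j using Nat.strong_induction_on generalizing b with
  | _ j ih =>
    have hsz := two_pow_le_sz hj
    have := two_le_two_pow hj
    have he : EndPts m b ∅ := .inl ⟨rfl, hm _ le_rfl (by omega), hm _ (by omega) (by omega)⟩
    rcases hj.eq_or_lt with rfl | hj
    · exact .leaf he (by simp)
    · refine (veb_iff hj).2 ⟨he, by simp, ?_⟩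
      rw [Set.sep_empty]
      refine ⟨fun h hh => ?_, ?_⟩
      · rw [lows_empty]
        refine ih _ (by omega) (by omega) fun a ha1 ha2 => hm a ?_ ?_
        · have := clAddr_start b j h; omega
        · have := clAddr_end (b := b) hj hh; omega
      · rw [highs_empty]
        refine ih _ (by omega) (by omega) fun a ha1 ha2 => hm a (by omega) ?_
        have := summary_end (b := b) hj; omega

theorem veb_empty_iff : Veb m b j ∅ ↔ 1 ≤ j ∧ (m b = 0 ∧ m (b + 1) = 0) ∧ (2 ≤ j → Rest m b j ∅) := by
  constructor
  · intro h
    refine ⟨h.pos, ?_, fun hj => ?_⟩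
    · rcases h.endPts with h | ⟨x, _, hx, _⟩
      · exact h.2
      · exact absurd hx (by simp)
    · simpa using ((veb_iff hj).1 h).2.2
  · rintro ⟨h1, h2, h3⟩
    have he : EndPts m b ∅ := .inl ⟨rfl, h2⟩
    rcases h1.eq_or_lt with rfl | hj
    · exact .leaf he (by simp)
    · exact (veb_iff hj).2 ⟨he, by simp, by simpa using h3 hj⟩

/-- The minimum is stored in no cluster, so below its first two cells a tree with one key looks
exactly like an empty one. Hence adding the first key or removing the last takes constant time, on
which the logarithmic bounds for insertion and deletion rest. -/
theorem veb_singleton_iff {x : ℕ} : Veb m b j {x} ↔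
    1 ≤ j ∧ x < 2 ^ j ∧ (m b = x + 1 ∧ m (b + 1) = x + 1) ∧ (2 ≤ j → Rest m b j ∅) := by
  have hR : m b = x + 1 → {y ∈ ({x} : Set ℕ) | y + 1 ≠ m b} = ∅ := by
    intro h; ext y
    simp only [Set.mem_ofPred_eq, Set.mem_singleton_iff, Set.mem_empty_iff_false, iff_false, h]
    omega
  constructor
  · intro h
    have h2 : m b = x + 1 ∧ m (b + 1) = x + 1 := by
      rcases h.endPts with h | ⟨y, z, hy, hz, _, h1, h2⟩
      · exact absurd h.1 (by simp)
      · rw [Set.mem_singleton_iff] at hy hz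
        subst hy; subst hz; exact ⟨h1, h2⟩
    refine ⟨h.pos, h.lt rfl, h2, fun hj => ?_⟩
    have := ((veb_iff hj).1 h).2.2
    rwa [hR h2.1] at this
  · rintro ⟨h1, hx, h2, h3⟩
    have he : EndPts m b {x} := .inr ⟨x, x, rfl, rfl, by simp, h2⟩
    rcases h1.eq_or_lt with rfl | hj
    · exact .leaf he (by simpa using hx)
    · exact (veb_iff hj).2 ⟨he, by simpa using hx, by rw [hR h2.1]; exact h3 hj⟩

theorem EndPts.eq_empty_iff (h : EndPts m b S) : S = ∅ ↔ m b = 0 := by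
  rcases h with h | ⟨x, y, hx, _, _, h1, _⟩
  · exact ⟨fun _ => h.2.1, fun _ => h.1⟩
  · constructor
    · rintro rfl; exact absurd hx (by simp)
    · omega

theorem EndPts.mem_of_eq (h : EndPts m b S) {x : ℕ} (hx : x + 1 = m b) : x ∈ S := by
  rcases h with h | ⟨y, z, hy, _, _, h1, _⟩
  · omega
  · obtain rfl : x = y := by omega
    exact hy

/-- The tree represents the set that the definition of `vebSet` reads off from it. -/
theorem Veb.vebSet_eq (h : Veb m b j S) : vebSet m b j = S := by
  induction h with
  | @leaf b S he hS =>
    ext x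
    rw [vebSet, if_pos le_rfl, Set.mem_ofPred_eq]
    -- In a leaf the keys are below `2`, so every key is one of the two end points.
    rcases he with ⟨rfl, h1, h2⟩ | ⟨y, z, hy, hz, hle, h1, h2⟩
    · simp only [Set.mem_empty_iff_false, iff_false]; omega
    · rw [h1, h2]
      constructor
      · rintro (h | h)
        · obtain rfl : x = y := by omega
          exact hy
        · obtain rfl : x = z := by omega
          exact hz
      · intro hx
        have := hle x hx
        have := hS y hy
        have := hS z hz
        omega
  | @node b j S hj he hS hc hs ihc ihs =>
    ext x
    rw [vebSet, if_neg (by omega), Set.mem_ofPred_eq]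
    have key : (x / 2 ^ (j / 2) < 2 ^ (j - j / 2) ∧ x % 2 ^ (j / 2) ∈ vebSet m
        (b + 2 + (3 * 2 ^ (j - j / 2) - 4) + x / 2 ^ (j / 2) * (3 * 2 ^ (j / 2) - 4)) (j / 2)) ↔
        x ∈ S ∧ x + 1 ≠ m b := by
      constructor
      · rintro ⟨h1, h2⟩
        have h2 : x % 2 ^ (j / 2) ∈ vebSet m (clAddr b j (x / 2 ^ (j / 2))) (j / 2) := h2
        rw [ihc _ h1] at h2
        have h3 := h2.2
        rw [mul_comm, Nat.div_add_mod] at h3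
        exact h3
      · intro h
        have h1 := div_lt_halves (hS x h.1)
        refine ⟨h1, ?_⟩
        show x % 2 ^ (j / 2) ∈ vebSet m (clAddr b j (x / 2 ^ (j / 2))) (j / 2)
        rw [ihc _ h1]
        refine ⟨Nat.mod_lt _ (Nat.two_pow_pos _), ?_⟩
        rw [mul_comm, Nat.div_add_mod]
        exact h
    rw [key]
    constructor
    · rintro (h | h)
      · exact he.mem_of_eq h
      · exact h.1
    · intro h
      by_cases hx : x + 1 = m b
      · exact .inl hx
      · exact .inr ⟨h, hx⟩

/-! ### Changing the rest -/

theorem Rest.addr_cases (hj : 2 ≤ j) {h : ℕ} (hh : h < 2 ^ (j - j / 2)) :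
    b + 2 ≤ clAddr b j h ∧ clAddr b j h + sz (j / 2) ≤ b + sz j ∧
      b + 2 + sz (j - j / 2) ≤ clAddr b j h :=
  ⟨by have := clAddr_start b j h; omega, clAddr_end hj hh, clAddr_start b j h⟩

/-- Exchanging one cluster and the summary. -/
theorem Rest.exchange (hj : 2 ≤ j) (hR : Rest m b j R) {R' : Set ℕ} {h : ℕ}
    (hh : h < 2 ^ (j - j / 2))
    (hlows : ∀ k, k ≠ h → lows R' (2 ^ (j / 2)) k = lows R (2 ^ (j / 2)) k)
    (hm : ∀ a, b + 2 + sz (j - j / 2) ≤ a → a < b + sz j →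
      (a < clAddr b j h ∨ clAddr b j h + sz (j / 2) ≤ a) → m' a = m a)
    (hc : Veb m' (clAddr b j h) (j / 2) (lows R' (2 ^ (j / 2)) h))
    (hs : Veb m' (b + 2) (j - j / 2) (highs R' (2 ^ (j / 2)))) : Rest m' b j R' := by
  refine ⟨fun k hk => ?_, hs⟩
  rcases eq_or_ne k h with rfl | hne
  · exact hc
  · rw [hlows k hne]
    have hA := Rest.addr_cases (b := b) hj hk
    refine (hR.1 k hk).congr fun a ha1 ha2 => hm a (by omega) (by omega) ?_
    rcases hne.lt_or_gt with hlt | hlt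
    · have := clAddr_disjoint (b := b) (j := j) hlt; omega
    · have := clAddr_disjoint (b := b) (j := j) hlt; omega

/-! ### Upper and lower halves under insertion and deletion of a key. -/

section Keys

variable {L h l : ℕ}

theorem lows_insert_self (hl : l < L) : lows (insert (h * L + l) R) L h = insert l (lows R L h) := by
  ext x
  simp only [lows, Set.mem_ofPred_eq, Set.mem_insert_iff]
  constructor
  · rintro ⟨h1, h2 | h2⟩
    · exact .inl (by omega)
    · exact .inr ⟨h1, h2⟩
  · rintro (rfl | ⟨h1, h2⟩)
    · exact ⟨hl, .inl rfl⟩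
    · exact ⟨h1, .inr h2⟩

theorem lows_insert_of_ne (hl : l < L) {k : ℕ} (hk : k ≠ h) :
    lows (insert (h * L + l) R) L k = lows R L k := by
  ext x
  simp only [lows, Set.mem_ofPred_eq, Set.mem_insert_iff]
  refine and_congr_right fun hx => or_iff_right fun e => hk (key_inj hx hl e).1

theorem highs_insert (hl : l < L) : highs (insert (h * L + l) R) L = insert h (highs R L) := by
  ext x
  simp only [highs, Set.mem_ofPred_eq, Set.mem_insert_iff]
  constructor
  · rintro ⟨y, hy, e | e⟩
    · exact .inl (key_inj hy hl e).1
    · exact .inr ⟨y, hy, e⟩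
  · rintro (rfl | ⟨y, hy, e⟩)
    · exact ⟨l, hl, .inl rfl⟩
    · exact ⟨y, hy, .inr e⟩

theorem lows_diff_self : lows (R \ {h * L + l}) L h = lows R L h \ {l} := by
  ext x
  simp only [lows, Set.mem_ofPred_eq, Set.mem_sdiff, Set.mem_singleton_iff, Nat.add_left_cancel_iff]
  tauto

theorem lows_diff_of_ne (hl : l < L) {k : ℕ} (hk : k ≠ h) :
    lows (R \ {h * L + l}) L k = lows R L k := by
  ext x
  simp only [lows, Set.mem_ofPred_eq, Set.mem_sdiff, Set.mem_singleton_iff]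
  refine and_congr_right fun hx => and_iff_left fun e => hk (key_inj hx hl e).1

theorem mem_highs_iff : h ∈ highs R L ↔ (lows R L h).Nonempty := Iff.rfl

theorem highs_diff_of_nonempty (hl : l < L) (hn : (lows R L h \ {l}).Nonempty) :
    highs (R \ {h * L + l}) L = highs R L := by
  ext x
  rw [mem_highs_iff, mem_highs_iff]
  by_cases hx : x = h
  · subst hx
    rw [lows_diff_self]
    exact ⟨fun h => h.mono Set.sdiff_subset, fun _ => hn⟩
  · rw [lows_diff_of_ne hl hx]

/-- An upper half leaves the summary exactly when its cluster has lost its last key. -/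
theorem highs_diff_of_empty (hl : l < L) (hn : lows R L h \ {l} = ∅) :
    highs (R \ {h * L + l}) L = highs R L \ {h} := by
  ext x
  rw [Set.mem_sdiff, Set.mem_singleton_iff, mem_highs_iff, mem_highs_iff]
  by_cases hx : x = h
  · subst hx
    rw [lows_diff_self, hn]
    simp
  · rw [lows_diff_of_ne hl hx]
    tauto

end Keys

end Trees

/-! ## Van Emde Boas trees: the operations -/

/-! ### Address and key arithmetic inside a tree. -/

section Ops

variable {w B K : ℕ} {α : Type} {m : ℕ → ℕ} {t d : ℕ} {Q : α → (ℕ → ℕ) → ℕ → ℕ → Prop}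

theorem Wp.vebSize {j : ℕ} {f : ℕ → RAM α} (hj : 3 * 2 ^ j < 2 ^ w)
    (hk : Wp w B K (f (sz j)) m (t + 2) d Q) : Wp w B K (CTMSeq.vebSize j >>= f) m t d Q :=
  Wp.bind (Wp.shl hj (Wp.tail (Wp.sub (by omega) (Wp.ret hk))))

theorem Wp.lowPart {x lo : ℕ} {f : ℕ → RAM α} (hx : x < 2 ^ w)
    (hk : Wp w B K (f (x % 2 ^ lo)) m (t + 2) d Q) :
    Wp w B K (CTMSeq.lowPart x (x / 2 ^ lo) lo >>= f) m t d Q := by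
  have e : x - x / 2 ^ lo * 2 ^ lo = x % 2 ^ lo := by
    have := Nat.div_add_mod x (2 ^ lo); rw [mul_comm] at this; omega
  refine Wp.bind (Wp.shl ((Nat.div_mul_le_self _ _).trans_lt hx) (Wp.tail (Wp.sub ?_ (Wp.ret ?_))))
  · omega
  · rwa [e]

theorem Wp.clusterAddr {b j h : ℕ} {f : ℕ → RAM α} (hB : B + 8 ≤ 2 ^ w) (hj : 2 ≤ j)
    (hb : b + sz j ≤ B) (hh : h < 2 ^ (j - j / 2))
    (hk : Wp w B K (f (clAddr b j h)) m (t + 8) d Q) :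
    Wp w B K (CTMSeq.clusterAddr b (j - j / 2) (j / 2) h >>= f) m t d Q := by
  have e1 := clAddr_end (b := b) hj hh
  have e2 : b + 2 + sz (j - j / 2) + h * sz (j / 2) = clAddr b j h := rfl
  have e3 := sz_add_four (show 1 ≤ j - j / 2 by omega)
  have e4 := sz_add_four (show 1 ≤ j / 2 by omega)
  refine Wp.bind (Wp.add (by omega) (Wp.vebSize (by omega) (Wp.add (by omega)
    (Wp.vebSize (by omega) (Wp.mul (by omega) (Wp.tail (Wp.add (by omega) (Wp.ret hk))))))))

/-- The slack of `8` between the address bound and the word limit leaves room for intermediate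
values such as `3 * 2 ^ j`, which exceeds the size of the tree by `4`, and for keys incremented by
one. -/
theorem pow_lt_word {j b : ℕ} (hB : B + 8 ≤ 2 ^ w) (hj : 1 ≤ j) (hb : b + sz j ≤ B) :
    b + 2 ^ j + 8 ≤ 2 ^ w ∧ b + 1 < B ∧ j + 8 ≤ 2 ^ w := by
  have h1 := two_pow_le_sz hj
  have h2 := two_le_two_pow hj
  have h3 := Nat.lt_two_pow_self (n := j)
  omega

end Ops

/-- `q` is `y + 1` for the largest element `y < x` of `S`, and `0` if there is none. -/
def IsPred (S : Set ℕ) (x q : ℕ) : Prop :=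
  (q = 0 ∧ ∀ y ∈ S, x ≤ y) ∨ ∃ y ∈ S, y < x ∧ q = y + 1 ∧ ∀ z ∈ S, z < x → z ≤ y

/-- `q` is `y + 1` for the smallest element `y > x` of `S`, and `0` if there is none. -/
def IsSucc (S : Set ℕ) (x q : ℕ) : Prop :=
  (q = 0 ∧ ∀ y ∈ S, y ≤ x) ∨ ∃ y ∈ S, x < y ∧ q = y + 1 ∧ ∀ z ∈ S, x < z → y ≤ z

theorem exists_key {L : ℕ} (hL : 0 < L) (x : ℕ) : ∃ h l, l < L ∧ x = h * L + l ∧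
    x / L = h ∧ x % L = l :=
  ⟨x / L, x % L, Nat.mod_lt _ hL, by rw [mul_comm, Nat.div_add_mod], rfl, rfl⟩

/-- If the minimum of the cluster of `x` is below the lower half of `x`, the predecessor lies in
that cluster. Otherwise it is the maximum of the last nonempty cluster before it, or the minimum of
the whole tree. Either way there is one recursive call, with at most half of the bits rounded up, so
`50` operations per level suffice. -/
theorem vebPred_spec {w B K : ℕ} (hB : B + 8 ≤ 2 ^ w) {m : ℕ → ℕ} (j : ℕ) :
    ∀ {b x fuel t d : ℕ} {S : Set ℕ}, Veb m b j S → x < 2 ^ j → b + sz j ≤ B → lev j ≤ fuel →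
      d + lev j ≤ K →
      Wp w B K (vebPred fuel b j x) m t d fun q m' t' d' =>
        m' = m ∧ d' = d ∧ IsPred S x q ∧ t' ≤ t + 50 * lev j := by
  induction j using Nat.strong_induction_on with
  | _ j ih =>
  intro b x fuel t d S hV hx hb hfuel hK
  have hj1 := hV.pos
  have hB' : B ≤ 2 ^ w := by omega
  have hp := pow_lt_word hB hj1 hb
  have hlev := lev_pos j
  obtain ⟨fuel, rfl⟩ : ∃ f, fuel = f + 1 := ⟨fuel - 1, by omega⟩
  rw [vebPred]
  dsimp only
  refine Wp.enter (by omega) (Wp.add (by omega) (Wp.readAt hB' (by omega) (Wp.eq ?_)))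
  have he := hV.endPts
  refine Wp.ite (fun h0 => ?_) (fun h0 => ?_)
  · refine Wp.leave (Wp.ret ⟨rfl, rfl, .inl ⟨rfl, ?_⟩, by omega⟩)
    rcases he with ⟨rfl, _⟩ | ⟨y, z, _, _, _, _, h2⟩
    · simp
    · omega
  obtain ⟨y, z, hy, hz, hle, h1, h2⟩ := he.resolve_left (by omega)
  refine Wp.lt (Wp.ite (fun h3 => ?_) (fun h3 => ?_))
  · refine Wp.leave (Wp.ret ⟨rfl, rfl, .inr ⟨z, hz, by omega, h2, fun u hu _ => (hle u hu).2⟩,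
      by omega⟩)
  refine Wp.read hB' (by omega) (Wp.lt (Wp.ite (fun hj => ?_) (fun hj => ?_)))
  swap
  · obtain rfl : j = 1 := by omega
    have hz2 : z < 2 := by simpa using hV.lt hz
    refine Wp.lt (Wp.ite (fun h4 => ?_) (fun h4 => ?_))
    · refine Wp.leave (Wp.ret ⟨rfl, rfl, .inr ⟨y, hy, by omega, h1, fun u hu _ => ?_⟩, by omega⟩)
      have := hle u hu
      omega
    · refine Wp.leave (Wp.ret ⟨rfl, rfl, .inl ⟨rfl, fun u hu => ?_⟩, by omega⟩)
      have := hle u hu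
      omega
  have hj : 2 ≤ j := hj
  obtain ⟨-, hS, hR⟩ := (veb_iff hj).1 hV
  have hxw : x < 2 ^ w := by omega
  set L := 2 ^ (j / 2) with hL
  have hL0 : 0 < L := Nat.two_pow_pos _
  have hh := div_lt_halves hx
  have hlev' := lev_half hj
  have hlev'' := lev_half' hj
  obtain ⟨h, l, hl, hxe, hdh, hml⟩ := exists_key hL0 x
  have hLb : L ≤ 2 ^ j := by rw [hL]; exact Nat.pow_le_pow_right (by omega) (by omega)
  refine Wp.shr_one (by omega) (Wp.sub (by omega) (Wp.shr ((Nat.div_le_self _ _).trans_lt hxw)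
    (Wp.lowPart hxw ?_)))
  rw [← hL] at hh ⊢
  rw [hdh] at hh ⊢
  rw [hml]
  have hA := Rest.addr_cases (b := b) hj hh
  have hps := pow_lt_word hB (show 1 ≤ j / 2 by omega) (hA.2.1.trans hb)
  refine Wp.add (by omega) (Wp.clusterAddr hB hj hb hh (Wp.read hB' (by omega) (Wp.lt ?_)))
  have hcl := hR.1 h hh
  set R := {x ∈ S | x + 1 ≠ m b} with hRdef
  have hmemR : ∀ u ∈ S, u = y ∨ u ∈ R := fun u hu => by
    rcases eq_or_ne u y with e | e
    · exact .inl e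
    · exact .inr ⟨hu, by omega⟩
  have hce := hcl.endPts
  -- the recursive call in the cluster
  have inside : ∀ t₁, t₁ ≤ t + 30 → m (clAddr b j h) ≠ 0 → m (clAddr b j h) < l + 1 →
      Wp w B K (do
        let q ← vebPred fuel (clAddr b j h) (j / 2) l
        let t ← shl h (j / 2)
        let res ← add t q
        leave
        pure res) m t₁ (d + 1) fun q m' t' d' =>
          m' = m ∧ d' = d ∧ IsPred S x q ∧ t' ≤ t + 50 * lev j := by
    intro t₁ ht₁ hne hlt
    refine Wp.bind ((ih (j / 2) (by omega) hcl hl (by omega) (by omega) (by omega)).mono ?_)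
    rintro q m' t' d' ⟨rfl, rfl, hq, ht'⟩
    obtain ⟨u, v, hu, hv, hle', e1, e2⟩ := hce.resolve_left (by omega)
    obtain ⟨y', hy', hlt', rfl, hmax⟩ := hq.resolve_left (fun hq => by
      have := hq.2 u hu; omega)
    have hyx : h * L + y' < x := by omega
    have hxj : h * L + y' < 2 ^ j := by omega
    refine Wp.shl (by rw [← hL]; omega) (Wp.add (by rw [← hL]; omega) (Wp.leave (Wp.ret ?_)))
    rw [← hL]
    refine ⟨rfl, rfl, .inr ⟨h * L + y', hy'.2.1, hyx, rfl, fun u' hu' hux => ?_⟩, by omega⟩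
    rcases hmemR u' hu' with rfl | huR
    · exact (hle _ hy'.2.1).1
    · obtain ⟨h', l', hl', rfl, -, -⟩ := exists_key hL0 u'
      rcases lt_trichotomy h' h with hlt | rfl | hgt
      · exact (key_lt hl' hlt y').le
      · have := hmax l' ⟨hl', huR⟩ (by omega)
        omega
      · have := key_lt (L := L) hl hgt l'
        omega
  -- the recursive call in the summary
  have outside : ∀ t₁, t₁ ≤ t + 30 → (m (clAddr b j h) = 0 ∨ l + 1 ≤ m (clAddr b j h)) →
      Wp w B K (do
        let sm ← add b 2
        let q ← vebPred fuel sm (j - j / 2) h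
        let e ← eq q 0
        if e = true then do
          let c ← lt (m b) (x + 1)
          if c = true then do
            leave
            pure (m b)
          else do
            leave
            pure 0
        else do
          let s ← sub q 1
          let c' ← clusterAddr b (j - j / 2) (j / 2) s
          let cx ← readAt c' 1
          let t ← shl s (j / 2)
          let res ← add t cx
          leave
          pure res) m t₁ (d + 1) fun q m' t' d' =>
          m' = m ∧ d' = d ∧ IsPred S x q ∧ t' ≤ t + 50 * lev j := by
    intro t₁ ht₁ hor
    have hout : ∀ l' < L, h * L + l' ∈ R → l ≤ l' := by
      intro l' hl' hmem
      rcases hce with ⟨e, _⟩ | ⟨u, v, hu, hv, hle', e1, e2⟩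
      · have : l' ∈ lows R L h := ⟨hl', hmem⟩
        rw [e] at this
        exact absurd this (by simp)
      · have := hle' l' ⟨hl', hmem⟩; omega
    refine Wp.add (by omega) (Wp.bind ((ih (j - j / 2) (by omega) hR.2 hh (by omega)
      (by omega) (by omega)).mono ?_))
    rintro q m' t' d' ⟨rfl, rfl, hq, ht'⟩
    refine Wp.eq (Wp.ite (fun hq0 => ?_) fun hq0 => ?_)
    · have hq' : ∀ y ∈ highs R L, h ≤ y := by
        rcases hq with hq | ⟨_, _, _, _, _⟩
        · exact hq.2
        · omega
      have hall : ∀ u ∈ R, x ≤ u := by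
        intro u hu
        obtain ⟨h', l', hl', rfl, -, -⟩ := exists_key hL0 u
        rcases (hq' h' ⟨l', hl', hu⟩).eq_or_lt with rfl | hlt
        · have := hout l' hl' hu; omega
        · have := key_lt (L := L) hl hlt l'; omega
      -- No key of a cluster is below `x`. What remains is the minimum of the tree, which belongs to
      -- no cluster.
      refine Wp.lt (Wp.ite (fun h4 => ?_) (fun h4 => ?_))
      · refine Wp.leave (Wp.ret ⟨rfl, rfl, .inr ⟨y, hy, by omega, h1, fun u hu hux => ?_⟩,
          by omega⟩)
        rcases hmemR u hu with rfl | huR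
        · exact le_rfl
        · have := hall u huR; omega
      · refine Wp.leave (Wp.ret ⟨rfl, rfl, .inl ⟨rfl, fun u hu => ?_⟩, by omega⟩)
        have := hle u hu; omega
    · obtain ⟨s, hs, hsh, rfl, hmax⟩ := hq.resolve_left (by omega)
      have hs2 := hsh.trans hh
      have hA' := Rest.addr_cases (b := b) hj hs2
      have hps' := pow_lt_word hB (show 1 ≤ j / 2 by omega) (hA'.2.1.trans hb)
      have hp2 := pow_lt_word hB (show 1 ≤ j - j / 2 by omega)
        ((summary_end (b := b) hj).trans hb)
      obtain ⟨u, v, hu, hv, hle', e1, e2⟩ := ((hR.1 s hs2).endPts).resolve_left (fun e => by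
        have := mem_highs_iff.1 hs
        rw [e.1] at this
        exact Set.not_nonempty_empty this)
      have hvx : s * L + v < x := by have := key_lt (L := L) hv.1 hsh l; omega
      refine Wp.sub (by omega) ?_
      rw [Nat.add_sub_cancel]
      refine Wp.clusterAddr hB hj hb hs2 (Wp.readAt hB' (by omega)
        (Wp.shl (by rw [← hL]; omega) (Wp.add (by rw [← hL]; omega) (Wp.leave (Wp.ret ?_)))))
      rw [← hL, e2]
      refine ⟨rfl, rfl, .inr ⟨s * L + v, hv.2.1, hvx, rfl, fun u' hu' hux => ?_⟩, by omega⟩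
      rcases hmemR u' hu' with rfl | huR
      · exact (hle _ hv.2.1).1
      · obtain ⟨h', l', hl', rfl, -, -⟩ := exists_key hL0 u'
        rcases lt_trichotomy h' h with hlt | rfl | hgt
        · rcases (hmax h' ⟨l', hl', huR⟩ hlt).eq_or_lt with rfl | hlt'
          · have := (hle' l' ⟨hl', huR⟩).2; omega
          · exact (key_lt hl' hlt' v).le
        · have := hout l' hl' huR; omega
        · have := key_lt (L := L) hl hgt l'; omega
  refine Wp.ite (fun h4 => Wp.lt ?_) (fun h4 => ?_)
  · refine Wp.ite (fun h5 => ?_) (fun h5 => ?_)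
    · exact inside _ (by omega) (by omega) h5
    · exact outside _ (by omega) (by omega)
  · exact outside _ (by omega) (by omega)

/-- As for predecessors, the maximum of the cluster of `x` decides between a call in the cluster and
one in the summary. Once the minimum is known not to exceed `x`, every larger key is in a cluster,
so no extra case arises for the key kept outside. -/
theorem vebSucc_spec {w B K : ℕ} (hB : B + 8 ≤ 2 ^ w) {m : ℕ → ℕ} (j : ℕ) :
    ∀ {b x fuel t d : ℕ} {S : Set ℕ}, Veb m b j S → x < 2 ^ j → b + sz j ≤ B → lev j ≤ fuel →
      d + lev j ≤ K →
      Wp w B K (vebSucc fuel b j x) m t d fun q m' t' d' =>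
        m' = m ∧ d' = d ∧ IsSucc S x q ∧ t' ≤ t + 50 * lev j := by
  induction j using Nat.strong_induction_on with
  | _ j ih =>
  intro b x fuel t d S hV hx hb hfuel hK
  have hj1 := hV.pos
  have hB' : B ≤ 2 ^ w := by omega
  have hp := pow_lt_word hB hj1 hb
  have hlev := lev_pos j
  obtain ⟨fuel, rfl⟩ : ∃ f, fuel = f + 1 := ⟨fuel - 1, by omega⟩
  rw [vebSucc]
  dsimp only
  refine Wp.enter (by omega) (Wp.add (by omega) (Wp.read hB' (by omega) (Wp.eq ?_)))
  have he := hV.endPts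
  refine Wp.ite (fun h0 => ?_) (fun h0 => ?_)
  · refine Wp.leave (Wp.ret ⟨rfl, rfl, .inl ⟨rfl, ?_⟩, by omega⟩)
    rw [he.eq_empty_iff.2 h0]
    simp
  obtain ⟨y, z, hy, hz, hle, h1, h2⟩ := he.resolve_left (by omega)
  refine Wp.lt (Wp.ite (fun h3 => ?_) (fun h3 => ?_))
  · refine Wp.leave (Wp.ret ⟨rfl, rfl, .inr ⟨y, hy, by omega, h1, fun u hu _ => (hle u hu).1⟩,
      by omega⟩)
  refine Wp.lt (Wp.ite (fun hj => ?_) (fun hj => ?_))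
  swap
  · obtain rfl : j = 1 := by omega
    have hz2 : z < 2 := by simpa using hV.lt hz
    refine Wp.readAt hB' (by omega) (Wp.lt (Wp.ite (fun h4 => ?_) (fun h4 => ?_)))
    · refine Wp.leave (Wp.ret ⟨rfl, rfl, .inr ⟨z, hz, by omega, h2, fun u hu _ => ?_⟩, by omega⟩)
      have := hle u hu
      omega
    · refine Wp.leave (Wp.ret ⟨rfl, rfl, .inl ⟨rfl, fun u hu => ?_⟩, by omega⟩)
      have := hle u hu
      omega
  have hj : 2 ≤ j := hj
  obtain ⟨-, hS, hR⟩ := (veb_iff hj).1 hV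
  have hxw : x < 2 ^ w := by omega
  set L := 2 ^ (j / 2) with hL
  have hL0 : 0 < L := Nat.two_pow_pos _
  have hh := div_lt_halves hx
  have hlev' := lev_half hj
  have hlev'' := lev_half' hj
  obtain ⟨h, l, hl, hxe, hdh, hml⟩ := exists_key hL0 x
  have hLb : L ≤ 2 ^ j := by rw [hL]; exact Nat.pow_le_pow_right (by omega) (by omega)
  refine Wp.shr_one (by omega) (Wp.sub (by omega) (Wp.shr ((Nat.div_le_self _ _).trans_lt hxw)
    (Wp.lowPart hxw ?_)))
  rw [← hL] at hh ⊢
  rw [hdh] at hh ⊢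
  rw [hml]
  have hA := Rest.addr_cases (b := b) hj hh
  have hps := pow_lt_word hB (show 1 ≤ j / 2 by omega) (hA.2.1.trans hb)
  refine Wp.add (by omega) (Wp.clusterAddr hB hj hb hh (Wp.readAt hB' (by omega) (Wp.lt ?_)))
  have hcl := hR.1 h hh
  set R := {x ∈ S | x + 1 ≠ m b} with hRdef
  have hmemR : ∀ u ∈ S, x < u → u ∈ R := fun u hu hux => ⟨hu, by omega⟩
  have hce := hcl.endPts
  refine Wp.ite (fun hlt => ?_) (fun hlt => ?_)
  · refine Wp.bind ((ih (j / 2) (by omega) hcl hl (by omega) (by omega) (by omega)).mono ?_)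
    rintro q m' t' d' ⟨rfl, rfl, hq, ht'⟩
    obtain ⟨u, v, hu, hv, hle', e1, e2⟩ := hce.resolve_left (by omega)
    obtain ⟨y', hy', hlt', rfl, hmin⟩ := hq.resolve_left (fun hq => by
      have := hq.2 v hv; omega)
    have hyj : h * L + y' < 2 ^ j := hS _ hy'.2.1
    refine Wp.shl (by rw [← hL]; omega) (Wp.add (by rw [← hL]; omega) (Wp.leave (Wp.ret ?_)))
    rw [← hL]
    refine ⟨rfl, rfl, .inr ⟨h * L + y', hy'.2.1, by omega, rfl, fun u' hu' hux => ?_⟩, by omega⟩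
    have huR := hmemR u' hu' hux
    obtain ⟨h', l', hl', rfl, -, -⟩ := exists_key hL0 u'
    rcases lt_trichotomy h' h with hlt | rfl | hgt
    · have := key_lt (L := L) hl' hlt l; omega
    · have := hmin l' ⟨hl', huR⟩ (by omega)
      omega
    · exact (key_lt hy'.1 hgt l').le
  · have hout : ∀ l' < L, h * L + l' ∈ R → l' ≤ l := by
      intro l' hl' hmem
      rcases hce with ⟨e, _⟩ | ⟨u, v, hu, hv, hle', e1, e2⟩
      · have : l' ∈ lows R L h := ⟨hl', hmem⟩
        rw [e] at this
        exact absurd this (by simp)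
      · have := hle' l' ⟨hl', hmem⟩; omega
    refine Wp.add (by omega) (Wp.bind ((ih (j - j / 2) (by omega) hR.2 hh (by omega)
      (by omega) (by omega)).mono ?_))
    rintro q m' t' d' ⟨rfl, rfl, hq, ht'⟩
    refine Wp.lt (Wp.ite (fun hq0 => ?_) fun hq0 => ?_)
    · obtain ⟨s, hs, hsh, rfl, hmin⟩ := hq.resolve_left (by omega)
      have hs2 : s < 2 ^ (j - j / 2) := hR.2.lt hs
      have hA' := Rest.addr_cases (b := b) hj hs2
      have hps' := pow_lt_word hB (show 1 ≤ j / 2 by omega) (hA'.2.1.trans hb)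
      have hp2 := pow_lt_word hB (show 1 ≤ j - j / 2 by omega)
        ((summary_end (b := b) hj).trans hb)
      obtain ⟨u, v, hu, hv, hle', e1, e2⟩ := ((hR.1 s hs2).endPts).resolve_left (fun e => by
        have := mem_highs_iff.1 hs
        rw [e.1] at this
        exact Set.not_nonempty_empty this)
      have huj : s * L + u < 2 ^ j := hS _ hu.2.1
      refine Wp.sub (by omega) ?_
      rw [Nat.add_sub_cancel]
      refine Wp.clusterAddr hB hj hb hs2 (Wp.read hB' (by omega)
        (Wp.shl (by rw [← hL]; omega) (Wp.add (by rw [← hL]; omega) (Wp.leave (Wp.ret ?_)))))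
      rw [← hL, e1]
      refine ⟨rfl, rfl, .inr ⟨s * L + u, hu.2.1, ?_, rfl, fun u' hu' hux => ?_⟩, by omega⟩
      · have := key_lt (L := L) hl hsh u; omega
      have huR := hmemR u' hu' hux
      obtain ⟨h', l', hl', rfl, -, -⟩ := exists_key hL0 u'
      rcases lt_trichotomy h' h with hlt | rfl | hgt
      · have := key_lt (L := L) hl' hlt l; omega
      · have := hout l' hl' huR; omega
      · rcases (hmin h' ⟨l', hl', huR⟩ hgt).eq_or_lt with rfl | hlt'
        · have := (hle' l' ⟨hl', huR⟩).1; omega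
        · exact (key_lt hu.1 hlt' l').le
    · have hq' : ∀ y ∈ highs R L, y ≤ h := by
        rcases hq with hq | ⟨_, _, _, _, _⟩
        · exact hq.2
        · omega
      refine Wp.leave (Wp.ret ⟨rfl, rfl, .inl ⟨rfl, fun u hu => ?_⟩, by omega⟩)
      by_contra! hux
      have huR := hmemR u hu hux
      obtain ⟨h', l', hl', rfl, -, -⟩ := exists_key hL0 u
      rcases (hq' h' ⟨l', hl', huR⟩).eq_or_lt with rfl | hlt
      · have := hout l' hl' huR; omega
      · have := key_lt (L := L) hl' hlt l; omega

/-- `m'` differs from `m` at most in the cells `b, …, e - 1`. -/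
def Frame (m m' : ℕ → ℕ) (b e : ℕ) : Prop := ∀ a, a < b ∨ e ≤ a → m' a = m a

theorem Frame.refl (m : ℕ → ℕ) (b e : ℕ) : Frame m m b e := fun _ _ => rfl

theorem Frame.trans {m m' m'' : ℕ → ℕ} {b e b' e' : ℕ} (h : Frame m m' b e)
    (h' : Frame m' m'' b' e') (hb : b ≤ b') (he : e' ≤ e) : Frame m m'' b e := fun a ha => by
  rw [h' a (by omega), h a ha]

theorem Frame.update {m m' : ℕ → ℕ} {b e a v : ℕ} (h : Frame m m' b e) (hb : b ≤ a)
    (he : a < e) : Frame m (Function.update m' a v) b e := fun x hx => by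
  rw [Function.update_of_ne (by omega), h x hx]

/-- The summary changes only if the cluster was empty, and then the cluster is filled by two writes
without recursion. So again a single recursive call is made. -/
theorem vebInsert_spec {w B K : ℕ} (hB : B + 8 ≤ 2 ^ w) (j : ℕ) :
    ∀ {b x fuel t d : ℕ} {m : ℕ → ℕ} {S : Set ℕ}, Veb m b j S → x < 2 ^ j → x ∉ S →
      b + sz j ≤ B → lev j ≤ fuel → d + lev j ≤ K →
      Wp w B K (vebInsert fuel b j x) m t d fun _ m' t' d' =>
        Veb m' b j (insert x S) ∧ Frame m m' b (b + sz j) ∧ d' = d ∧ t' ≤ t + 50 * lev j := by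
  induction j using Nat.strong_induction_on with
  | _ j ih =>
  intro b x fuel t d m S hV hx hxS hb hfuel hK
  have hj1 := hV.pos
  have hB' : B ≤ 2 ^ w := by omega
  have hp := pow_lt_word hB hj1 hb
  have hsz := two_pow_le_sz hj1
  have htwo := two_le_two_pow hj1
  have hlev := lev_pos j
  obtain ⟨fuel, rfl⟩ : ∃ f, fuel = f + 1 := ⟨fuel - 1, by omega⟩
  rw [vebInsert]
  dsimp only
  refine Wp.enter (by omega) (Wp.add (by omega) (Wp.read hB' (by omega) (Wp.eq ?_)))
  have he := hV.endPts
  refine Wp.ite (fun h0 => ?_) (fun h0 => ?_)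
  · obtain rfl := he.eq_empty_iff.2 h0
    have hV' := veb_empty_iff.1 hV
    refine Wp.write hB' (by omega) (by omega) (Wp.writeAt hB' (by omega) (by omega)
      (Wp.tail (Wp.leave (Wp.ret ⟨?_, ?_, rfl, by omega⟩))))
    · have e : insert x (∅ : Set ℕ) = {x} := by simp
      rw [e, veb_singleton_iff]
      refine ⟨hj1, hx, ⟨?_, ?_⟩, fun hj => (hV'.2.2 hj).congr hj fun a ha1 ha2 => ?_⟩
      · rw [Function.update_of_ne (by omega), Function.update_self]
      · rw [Function.update_self]
      · rw [Function.update_of_ne (by omega), Function.update_of_ne (by omega)]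
    · exact ((Frame.refl m _ _).update le_rfl (by omega)).update (by omega) (by omega)
  obtain ⟨y₀, z₀, hy₀, hz₀, hle, h1, h2⟩ := he.resolve_left (by omega)
  -- inserting `y` into the clusters and the summary
  have rest : ∀ m₁ t₁ y R, EndPts m₁ b (insert x S) → (2 ≤ j → Rest m₁ b j R) →
      {u ∈ insert x S | u + 1 ≠ m₁ b} = insert y R → y ∉ R → Frame m m₁ b (b + sz j) →
      t₁ ≤ t + 20 → Wp w B K (do
        let c ← lt 1 j
        if c = true then do
          let lo ← shr j 1
          let hi ← sub j lo
          let h ← shr y lo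
          let l ← lowPart y h lo
          let c ← clusterAddr b hi lo h
          let cm ← read c
          let e ← eq cm 0
          if e = true then do
            let l1 ← add l 1
            write c l1
            writeAt c 1 l1
            let sm ← add b 2
            vebInsert fuel sm hi h
            leave
          else do
            vebInsert fuel c lo l
            leave
        else leave) m₁ t₁ (d + 1) fun _ m' t' d' =>
          Veb m' b j (insert x S) ∧ Frame m m' b (b + sz j) ∧ d' = d ∧ t' ≤ t + 50 * lev j := by
    intro m₁ t₁ y R he₁ hR hsep hyR hF ht₁
    have hlt : ∀ u ∈ insert x S, u < 2 ^ j := by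
      rintro u (rfl | hu)
      · exact hx
      · exact hV.lt hu
    have hymem : y ∈ insert x S := by
      have : y ∈ insert y R := Set.mem_insert _ _
      rw [← hsep] at this
      exact this.1
    have hyj := hlt y hymem
    refine Wp.lt (Wp.ite (fun hj => ?_) (fun hj => ?_))
    swap
    · obtain rfl : j = 1 := by omega
      exact Wp.tail (Wp.leave (Wp.ret ⟨veb_one_iff.2 ⟨he₁, by simpa using hlt⟩, hF, rfl, by omega⟩))
    have hj : 2 ≤ j := hj
    have hR := hR hj
    have hyw : y < 2 ^ w := by omega
    set L := 2 ^ (j / 2) with hL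
    have hL0 : 0 < L := Nat.two_pow_pos _
    have hh := div_lt_halves hyj
    have hlev' := lev_half hj
    have hlev'' := lev_half' hj
    obtain ⟨h, l, hl, hye, hdh, hml⟩ := exists_key hL0 y
    have hLb : L ≤ 2 ^ j := by rw [hL]; exact Nat.pow_le_pow_right (by omega) (by omega)
    refine Wp.shr_one (by omega) (Wp.sub (by omega) (Wp.shr ((Nat.div_le_self _ _).trans_lt hyw)
      (Wp.lowPart hyw ?_)))
    rw [← hL] at hh ⊢
    rw [hdh] at hh ⊢
    rw [hml]
    have hA := Rest.addr_cases (b := b) hj hh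
    have hse := summary_end (b := b) hj
    have hps := pow_lt_word hB (show 1 ≤ j / 2 by omega) (hA.2.1.trans hb)
    have hszc := two_pow_le_sz (show 1 ≤ j / 2 by omega)
    have hszc' := two_le_two_pow (show 1 ≤ j / 2 by omega)
    refine Wp.clusterAddr hB hj hb hh (Wp.read hB' (by omega) (Wp.eq ?_))
    have hcl := hR.1 h hh
    have finish : ∀ m', Frame m₁ m' (b + 2) (b + sz j) → Rest m' b j (insert y R) →
        Veb m' b j (insert x S) := by
      intro m' hF' hR'
      have e0 : m' b = m₁ b := hF' _ (by omega)
      refine (veb_iff hj).2 ⟨he₁.congr e0 (hF' _ (by omega)), hlt, ?_⟩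
      rw [e0, hsep]
      exact hR'
    have hlows : ∀ k, k ≠ h → lows (insert y R) L k = lows R L k := by
      intro k hk
      rw [hye]
      exact lows_insert_of_ne hl hk
    have hlowsh : lows (insert y R) L h = insert l (lows R L h) := by
      rw [hye]
      exact lows_insert_self hl
    have hhighs : highs (insert y R) L = insert h (highs R L) := by
      rw [hye]
      exact highs_insert hl
    refine Wp.ite (fun h0 => ?_) (fun h0 => ?_)
    · have hemp := hcl.endPts.eq_empty_iff.2 h0
      have hcl' := hcl
      rw [hemp] at hcl'
      have hcl' := veb_empty_iff.1 hcl'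
      refine Wp.add (by omega) (Wp.write hB' (by omega) (by omega) (Wp.writeAt hB' (by omega)
        (by omega) (Wp.add (by omega) ?_)))
      set m₂ := Function.update (Function.update m₁ (clAddr b j h) (l + 1)) (clAddr b j h + 1)
        (l + 1) with hm₂
      have hF₂ : Frame m₁ m₂ (clAddr b j h) (clAddr b j h + sz (j / 2)) :=
        ((Frame.refl m₁ _ _).update le_rfl (by omega)).update (by omega) (by omega)
      have hV₂ : Veb m₂ (clAddr b j h) (j / 2) {l} := by
        rw [veb_singleton_iff]
        refine ⟨by omega, hl, ⟨?_, ?_⟩, fun hj => (hcl'.2.2 hj).congr hj fun a ha1 ha2 => ?_⟩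
        · rw [hm₂, Function.update_of_ne (by omega), Function.update_self]
        · rw [hm₂, Function.update_self]
        · rw [hm₂, Function.update_of_ne (by omega), Function.update_of_ne (by omega)]
      have hsm : Veb m₂ (b + 2) (j - j / 2) (highs R L) :=
        hR.2.congr fun a ha1 ha2 => hF₂ a (by omega)
      have hnh : h ∉ highs R L := by
        rw [mem_highs_iff, hemp]
        exact Set.not_nonempty_empty
      refine Wp.bind ((ih (j - j / 2) (by omega) hsm hh hnh (by omega) (by omega)
        (by omega)).mono ?_)
      rintro _ m₃ t₃ _ ⟨hV₃, hF₃, rfl, ht₃⟩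
      have hF' : Frame m₁ m₃ (b + 2) (b + sz j) := fun a ha => by
        rw [hF₃ a (by omega), hF₂ a (by omega)]
      refine Wp.tail (Wp.leave (Wp.ret ⟨finish m₃ hF' ?_, hF.trans hF' (by omega) le_rfl,
        rfl, by omega⟩))
      refine hR.exchange hj hh hlows (fun a ha1 ha2 ha3 => ?_) ?_ ?_
      · rw [hF₃ a (by omega), hF₂ a (by omega)]
      · rw [← hL, hlowsh, hemp]
        have e : insert l (∅ : Set ℕ) = {l} := by simp
        rw [e]
        exact hV₂.congr fun a ha1 ha2 => hF₃ a (by omega)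
      · rw [← hL, hhighs]
        exact hV₃
    · have hnl : l ∉ lows R L h := fun hmem => hyR (by rw [hye]; exact hmem.2)
      refine Wp.bind ((ih (j / 2) (by omega) hcl hl hnl (by omega) (by omega)
        (by omega)).mono ?_)
      rintro _ m₃ t₃ _ ⟨hV₃, hF₃, rfl, ht₃⟩
      have hF' : Frame m₁ m₃ (b + 2) (b + sz j) := fun a ha => hF₃ a (by omega)
      refine Wp.tail (Wp.leave (Wp.ret ⟨finish m₃ hF' ?_, hF.trans hF' (by omega) le_rfl,
        rfl, by omega⟩))
      refine hR.exchange hj hh hlows (fun a ha1 ha2 ha3 => hF₃ a (by omega)) ?_ ?_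
      · rw [← hL, hlowsh]
        exact hV₃
      · have hmem : h ∈ highs R L := by
          rw [mem_highs_iff, Set.nonempty_iff_ne_empty, Ne, hcl.endPts.eq_empty_iff]
          exact h0
        rw [← hL, hhighs, Set.insert_eq_of_mem hmem]
        exact hR.2.congr fun a ha1 ha2 => hF₃ a (by omega)
  have hR : 2 ≤ j → Rest m b j {u ∈ S | u + 1 ≠ m b} := fun hj => ((veb_iff hj).1 hV).2.2
  have hz₀j := hV.lt hz₀
  have hy₀j := hV.lt hy₀
  have hxy : x ≠ y₀ := fun e => hxS (e ▸ hy₀)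
  -- A new key below the minimum takes its place, and it is the old minimum `y₀` that moves into a
  -- cluster.
  refine Wp.lt (Wp.ite (fun h3 => ?_) (fun h3 => ?_))
  · refine Wp.write hB' (by omega) (by omega) (Wp.sub (by omega) (Wp.readAt hB' (by omega) ?_))
    have hle₀ := (hle y₀ hy₀).2
    rw [Function.update_of_ne (by omega)]
    -- The key passed on is the old minimum, so it cannot exceed the stored maximum.
    refine Wp.lt (Wp.ite_neg (by omega) (rest _ _ _ {u ∈ S | u + 1 ≠ m b} ?_ ?_ ?_ ?_ ?_ (by omega)))
    · refine .inr ⟨x, z₀, Set.mem_insert _ _, Set.mem_insert_of_mem _ hz₀, ?_, ?_, ?_⟩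
      · rintro u (rfl | hu)
        · omega
        · have := hle u hu; omega
      · rw [Function.update_self]
      · rw [Function.update_of_ne (by omega), h2]
    · exact fun hj => (hR hj).congr hj fun a ha1 ha2 => Function.update_of_ne (by omega) _ _
    · rw [Function.update_self]
      ext u
      simp only [Set.mem_ofPred_eq, Set.mem_insert_iff]
      constructor
      · rintro ⟨rfl | hu, hne⟩
        · omega
        · by_cases e : u + 1 = m b
          · exact .inl (by omega)
          · exact .inr ⟨hu, e⟩
      · rintro (rfl | ⟨hu, hne⟩)
        · rw [h1, Nat.add_sub_cancel]
          exact ⟨.inr hy₀, by omega⟩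
        · have := hle u hu
          exact ⟨.inr hu, by omega⟩
    · rintro ⟨_, h⟩
      omega
    · exact (Frame.refl m _ _).update le_rfl (by omega)
  · have hsep : {u ∈ insert x S | u + 1 ≠ m b} = insert x {u ∈ S | u + 1 ≠ m b} := by
      ext u
      simp only [Set.mem_ofPred_eq, Set.mem_insert_iff]
      constructor
      · rintro ⟨rfl | hu, hne⟩
        · exact .inl rfl
        · exact .inr ⟨hu, hne⟩
      · rintro (rfl | ⟨hu, hne⟩)
        · exact ⟨.inl rfl, by omega⟩
        · exact ⟨.inr hu, hne⟩
    refine Wp.readAt hB' (by omega) (Wp.lt (Wp.ite (fun h4 => ?_) (fun h4 => ?_)))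
    · refine Wp.writeAt hB' (by omega) (by omega)
        (rest _ _ _ {u ∈ S | u + 1 ≠ m b} ?_ ?_ ?_ (fun h => hxS h.1) ?_ (by omega))
      · refine .inr ⟨y₀, x, Set.mem_insert_of_mem _ hy₀, Set.mem_insert _ _, ?_, ?_, ?_⟩
        · rintro u (rfl | hu)
          · omega
          · have := hle u hu; omega
        · rw [Function.update_of_ne (by omega), h1]
        · rw [Function.update_self]
      · exact fun hj => (hR hj).congr hj fun a ha1 ha2 => Function.update_of_ne (by omega) _ _
      · rw [Function.update_of_ne (by omega)]
        exact hsep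
      · exact (Frame.refl m _ _).update (by omega) (by omega)
    · refine rest _ _ _ {u ∈ S | u + 1 ≠ m b} ?_ hR hsep (fun h => hxS h.1) (Frame.refl _ _ _)
        (by omega)
      refine .inr ⟨y₀, z₀, Set.mem_insert_of_mem _ hy₀, Set.mem_insert_of_mem _ hz₀, ?_, h1, h2⟩
      rintro u (rfl | hu)
      · omega
      · exact hle u hu

/-- There may be two recursive calls, but the one in the summary happens only if the cluster has
become empty. Then the call in the cluster removed an only key and was constant-time. The last
conclusion, `t' ≤ t + 10` for a singleton, is carried through the induction for this purpose. -/
theorem vebDelete_spec {w B K : ℕ} (hB : B + 8 ≤ 2 ^ w) (j : ℕ) :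
    ∀ {b x fuel t d : ℕ} {m : ℕ → ℕ} {S : Set ℕ}, Veb m b j S → x ∈ S →
      b + sz j ≤ B → lev j ≤ fuel → d + lev j ≤ K →
      Wp w B K (vebDelete fuel b j x) m t d fun _ m' t' d' =>
        Veb m' b j (S \ {x}) ∧ Frame m m' b (b + sz j) ∧ d' = d ∧ t' ≤ t + 80 * lev j ∧
          (S = {x} → t' ≤ t + 10) := by
  induction j using Nat.strong_induction_on with
  | _ j ih =>
  intro b x fuel t d m S hV hxS hb hfuel hK
  have hj1 := hV.pos
  have hB' : B ≤ 2 ^ w := by omega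
  have hp := pow_lt_word hB hj1 hb
  have hsz := two_pow_le_sz hj1
  have htwo := two_le_two_pow hj1
  have hlev := lev_pos j
  have hx := hV.lt hxS
  obtain ⟨fuel, rfl⟩ : ∃ f, fuel = f + 1 := ⟨fuel - 1, by omega⟩
  rw [vebDelete]
  dsimp only
  refine Wp.enter (by omega) (Wp.read hB' (by omega) (Wp.readAt hB' (by omega) (Wp.eq ?_)))
  have he := hV.endPts
  obtain ⟨y₀, z₀, hy₀, hz₀, hle, h1, h2⟩ := he.resolve_left (fun e => by
    rw [e.1] at hxS; exact absurd hxS (by simp))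
  refine Wp.ite (fun h0 => ?_) (fun h0 => ?_)
  · have hS : S = {x} := by
      ext u
      rw [Set.mem_singleton_iff]
      constructor
      · intro hu
        have := hle u hu
        have := hle x hxS
        omega
      · rintro rfl; exact hxS
    rw [hS] at hV
    have hV' := (veb_singleton_iff.1 hV).2.2.2
    refine Wp.write hB' (by omega) (by omega) (Wp.writeAt hB' (by omega) (by omega)
      (Wp.tail (Wp.leave (Wp.ret ⟨?_, ?_, rfl, by omega, fun _ => by omega⟩))))
    · rw [hS, Set.sdiff_self]
      refine veb_empty_iff.2 ⟨hj1, ⟨?_, ?_⟩, fun hj => (hV' hj).congr hj fun a ha1 ha2 => ?_⟩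
      · rw [Function.update_of_ne (by omega), Function.update_self]
      · rw [Function.update_self]
      · rw [Function.update_of_ne (by omega), Function.update_of_ne (by omega)]
    · exact ((Frame.refl m _ _).update le_rfl (by omega)).update (by omega) (by omega)
  have hns : S ≠ {x} := by
    rintro rfl
    rw [Set.mem_singleton_iff] at hy₀ hz₀
    omega
  have hyz₀ : y₀ < z₀ := by have := hle y₀ hy₀; omega
  refine Wp.lt (Wp.ite (fun hj => ?_) (fun hj => ?_))
  swap
  · obtain rfl : j = 1 := by omega
    have hS2 : ∀ u ∈ S, u < 2 := fun u hu => by simpa using hV.lt hu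
    have hy2 := hS2 y₀ hy₀
    have hz2 := hS2 z₀ hz₀
    refine Wp.eq (Wp.ite (fun h3 => ?_) (fun h3 => ?_))
    · refine Wp.write hB' (by omega) (by omega) (Wp.tail (Wp.leave (Wp.ret
        ⟨veb_one_iff.2 ⟨.inr ⟨z₀, z₀, ⟨hz₀, ?_⟩, ⟨hz₀, ?_⟩, ?_, ?_, ?_⟩, fun u hu => hS2 u hu.1⟩,
          (Frame.refl m _ _).update le_rfl (by omega), rfl, by omega, fun e => absurd e hns⟩)))
      · rw [Set.mem_singleton_iff]; omega
      · rw [Set.mem_singleton_iff]; omega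
      · rintro u ⟨hu, hne⟩
        rw [Set.mem_singleton_iff] at hne
        have := hS2 u hu
        omega
      · rw [Function.update_self]; omega
      · rw [Function.update_of_ne (by omega), h2]
    · have := hS2 x hxS
      refine Wp.writeAt hB' (by omega) (by omega) (Wp.tail (Wp.leave (Wp.ret
        ⟨veb_one_iff.2 ⟨.inr ⟨y₀, y₀, ⟨hy₀, ?_⟩, ⟨hy₀, ?_⟩, ?_, ?_, ?_⟩, fun u hu => hS2 u hu.1⟩,
          (Frame.refl m _ _).update (by omega) (by omega), rfl, by omega, fun e => absurd e hns⟩)))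
      · rw [Set.mem_singleton_iff]; omega
      · rw [Set.mem_singleton_iff]; omega
      · rintro u ⟨hu, hne⟩
        rw [Set.mem_singleton_iff] at hne
        have := hS2 u hu
        omega
      · rw [Function.update_of_ne (by omega), h1]
      · rw [Function.update_self]; omega
  have hj : 2 ≤ j := hj
  obtain ⟨-, hSlt, hR⟩ := (veb_iff hj).1 hV
  set L := 2 ^ (j / 2) with hL
  have hL0 : 0 < L := Nat.two_pow_pos _
  have hlev' := lev_half hj
  have hlev'' := lev_half' hj
  have hLb : L ≤ 2 ^ j := by rw [hL]; exact Nat.pow_le_pow_right (by omega) (by omega)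
  have hse := summary_end (b := b) hj
  set R := {u ∈ S | u + 1 ≠ m b} with hRdef
  have hz₀R : z₀ ∈ R := ⟨hz₀, by omega⟩
  -- deleting `y` from the clusters and the summary
  have rest : ∀ m₁ t₁ y x', y ∈ R → x' ∈ S \ {x} → (∀ u ∈ S \ {x}, x' ≤ u) → m₁ b = x' + 1 →
      m₁ (b + 1) = z₀ + 1 → Rest m₁ b j R → {u ∈ S \ {x} | u + 1 ≠ m₁ b} = R \ {y} →
      Frame m m₁ b (b + sz j) → t₁ ≤ t + 30 → Wp w B K (do
        let h ← shr y (j / 2)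
        let l ← lowPart y h (j / 2)
        let c ← clusterAddr b (j - j / 2) (j / 2) h
        vebDelete fuel c (j / 2) l
        let cm ← read c
        let e ← eq cm 0
        if e = true then do
          vebDelete fuel (b + 2) (j - j / 2) h
          let e ← eq (y + 1) (m (b + 1))
          if e = true then do
            let s1 ← readAt (b + 2) 1
            let e ← eq s1 0
            if e = true then do
              let mn' ← read b
              writeAt b 1 mn'
              leave
            else do
              let s ← sub s1 1
              let c' ← clusterAddr b (j - j / 2) (j / 2) s
              let cx ← readAt c' 1
              let t ← shl s (j / 2)
              let z ← add t cx
              writeAt b 1 z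
              leave
          else leave
        else do
          let e ← eq (y + 1) (m (b + 1))
          if e = true then do
            let cx ← readAt c 1
            let t ← shl h (j / 2)
            let z ← add t cx
            writeAt b 1 z
            leave
          else leave) m₁ t₁ (d + 1) fun _ m' t' d' =>
        Veb m' b j (S \ {x}) ∧ Frame m m' b (b + sz j) ∧ d' = d ∧ t' ≤ t + 80 * lev j ∧
          (S = {x} → t' ≤ t + 10) := by
    intro m₁ t₁ y x' hyR hx' hx'le e0 e1 hR hsep hF ht₁
    have hyj := hSlt y hyR.1
    have hyw : y < 2 ^ w := by omega
    have hh := div_lt_halves hyj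
    obtain ⟨h, l, hl, hye, hdh, hml⟩ := exists_key hL0 y
    refine Wp.shr ((Nat.div_le_self _ _).trans_lt hyw) (Wp.lowPart hyw ?_)
    rw [← hL] at hh ⊢
    rw [hdh] at hh ⊢
    rw [hml]
    have hA := Rest.addr_cases (b := b) hj hh
    have hps := pow_lt_word hB (show 1 ≤ j / 2 by omega) (hA.2.1.trans hb)
    refine Wp.clusterAddr hB hj hb hh ?_
    have hcl := hR.1 h hh
    rw [← hL] at hcl
    have hlmem : l ∈ lows R L h := ⟨hl, by rw [← hye]; exact hyR⟩
    have hmem' : ∀ u ∈ S \ {x}, u = x' ∨ u ∈ R \ {y} := by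
      intro u hu
      by_cases e : u = x'
      · exact .inl e
      · right
        rw [← hsep]
        exact ⟨hu, by omega⟩
    have hmem : ∀ u ∈ R \ {y}, u ∈ S \ {x} ∧ x' ≤ u := by
      intro u hu
      rw [← hsep] at hu
      exact ⟨hu.1, hx'le u hu.1⟩
    have finish : ∀ m' z', Rest m' b j (R \ {y}) → m' b = x' + 1 → m' (b + 1) = z' + 1 →
        z' ∈ S \ {x} → (∀ u ∈ S \ {x}, u ≤ z') → Veb m' b j (S \ {x}) := by
      intro m' z' hR' g0 g1 hz' hle'
      refine (veb_iff hj).2 ⟨.inr ⟨x', z', hx', hz', fun u hu => ⟨hx'le u hu, hle' u hu⟩, g0, g1⟩,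
        fun u hu => hSlt u hu.1, ?_⟩
      rw [g0, ← e0, hsep]
      exact hR'
    have keep : ∀ m', y ≠ z₀ → Frame m₁ m' (b + 2) (b + sz j) → Rest m' b j (R \ {y}) →
        Veb m' b j (S \ {x}) := by
      intro m' hne hF' hR'
      refine finish m' z₀ hR' ?_ ?_ (hmem z₀ ⟨hz₀R, fun e => hne e.symm⟩).1
        fun u hu => (hle u hu.1).2
      · rw [hF' _ (by omega), e0]
      · rw [hF' _ (by omega), e1]
    have change : ∀ m' z', Frame m₁ m' (b + 2) (b + sz j) → Rest m' b j (R \ {y}) →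
        z' ∈ S \ {x} → (∀ u ∈ S \ {x}, u ≤ z') →
        Veb (Function.update m' (b + 1) (z' + 1)) b j (S \ {x}) := by
      intro m' z' hF' hR' hz' hle'
      refine finish _ z' (hR'.congr hj fun a ha1 ha2 => Function.update_of_ne (by omega) _ _) ?_
        (Function.update_self _ _ _) hz' hle'
      rw [Function.update_of_ne (by omega), hF' _ (by omega), e0]
    have hlows : ∀ k, k ≠ h → lows (R \ {y}) L k = lows R L k := by
      intro k hk
      rw [hye]
      exact lows_diff_of_ne hl hk
    have hlowsh : lows (R \ {y}) L h = lows R L h \ {l} := by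
      rw [hye]
      exact lows_diff_self
    refine Wp.bind ((ih (j / 2) (by omega) hcl hlmem (by omega) (by omega) (by omega)).mono ?_)
    rintro _ m₂ t₂ _ ⟨hV₂, hF₂, rfl, ht₂, ht₂'⟩
    refine Wp.read hB' (by omega) (Wp.eq (Wp.ite (fun h0 => ?_) (fun h0 => ?_)))
    · have hemp := hV₂.endPts.eq_empty_iff.2 h0
      have hsing : lows R L h = {l} := by
        ext u
        rw [Set.mem_singleton_iff]
        constructor
        · intro hu
          by_contra hne
          have : u ∈ lows R L h \ {l} := ⟨hu, hne⟩
          rw [hemp] at this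
          exact this
        · rintro rfl; exact hlmem
      -- The cluster had `l` as its only key, so the first call cost at most `10` operations and
      -- only the call in the summary is charged to the next level.
      have ht₂ := ht₂' hsing
      have hhighs : highs (R \ {y}) L = highs R L \ {h} := by
        rw [hye]
        exact highs_diff_of_empty hl hemp
      have hsm : Veb m₂ (b + 2) (j - j / 2) (highs R L) :=
        hR.2.congr fun a ha1 ha2 => hF₂ a (by omega)
      have hhmem : h ∈ highs R L := ⟨l, hlmem⟩
      refine Wp.bind ((ih (j - j / 2) (by omega) hsm hhmem (by omega) (by omega)
        (by omega)).mono ?_)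
      rintro _ m₃ t₃ _ ⟨hV₃, hF₃, rfl, ht₃, -⟩
      have hF' : Frame m₁ m₃ (b + 2) (b + sz j) := fun a ha => by
        rw [hF₃ a (by omega), hF₂ a (by omega)]
      have hFm := hF.trans hF' (by omega) le_rfl
      have hR' : Rest m₃ b j (R \ {y}) := by
        refine hR.exchange hj hh hlows (fun a ha1 ha2 ha3 => ?_) ?_ ?_
        · rw [hF₃ a (by omega), hF₂ a (by omega)]
        · rw [← hL, hlowsh]
          exact hV₂.congr fun a ha1 ha2 => hF₃ a (by omega)
        · rw [← hL, hhighs]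
          exact hV₃
      refine Wp.eq (Wp.ite (fun h3 => ?_) (fun h3 => ?_))
      · have hhe := hR'.2.endPts
        rw [← hL] at hhe
        refine Wp.readAt hB' (by omega) (Wp.eq (Wp.ite (fun h4 => ?_) (fun h4 => ?_)))
        -- An empty summary leaves the minimum as the only key, so it is also the new maximum.
        · have hnil : highs (R \ {y}) L = ∅ := by
            rcases hhe with e | ⟨_, _, _, _, _, _, e⟩
            · exact e.1
            · omega
          refine Wp.read hB' (by omega) ?_
          rw [hF' b (by omega), e0]
          refine Wp.writeAt hB' (by omega) (by have := hSlt x' hx'.1; omega)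
            (Wp.tail (Wp.leave (Wp.ret ⟨change m₃ x' hF' hR' hx' fun u hu => ?_,
              hFm.update (by omega) (by omega), rfl, by omega, fun e => absurd e hns⟩)))
          rcases hmem' u hu with rfl | hu
          · exact le_rfl
          · have : u / L ∈ highs (R \ {y}) L := by
              refine ⟨u % L, Nat.mod_lt _ hL0, ?_⟩
              rw [mul_comm, Nat.div_add_mod]
              exact hu
            rw [hnil] at this
            exact absurd this (by simp)
        -- The new maximum is the maximum of the last nonempty cluster.
        · obtain ⟨_, s, _, hs, hsle, _, hs1⟩ := hhe.resolve_left (fun e => h4 e.2.2)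
          have hs2 : s < 2 ^ (j - j / 2) := hR'.2.lt hs
          have hA' := Rest.addr_cases (b := b) hj hs2
          have hps' := pow_lt_word hB (show 1 ≤ j / 2 by omega) (hA'.2.1.trans hb)
          have hp2 := pow_lt_word hB (show 1 ≤ j - j / 2 by omega) (hse.trans hb)
          obtain ⟨_, v, _, hv, hle', _, g2⟩ := ((hR'.1 s hs2).endPts).resolve_left (fun e => by
            have := mem_highs_iff.1 hs
            rw [e.1] at this
            exact Set.not_nonempty_empty this)
          have hvS := hmem _ hv.2
          have hvj : s * L + v < 2 ^ j := hSlt _ hvS.1.1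
          rw [hs1]
          refine Wp.sub (by omega) ?_
          rw [Nat.add_sub_cancel]
          refine Wp.clusterAddr hB hj hb hs2 (Wp.readAt hB' (by omega) ?_)
          rw [g2]
          refine Wp.shl (by rw [← hL]; omega) (Wp.add (by rw [← hL]; omega)
            (Wp.writeAt hB' (by omega) (by rw [← hL]; omega) (Wp.tail (Wp.leave (Wp.ret ?_)))))
          rw [← hL]
          refine ⟨change m₃ (s * L + v) hF' hR' hvS.1 fun u hu => ?_,
            hFm.update (by omega) (by omega), rfl, by omega, fun e => absurd e hns⟩
          rcases hmem' u hu with rfl | hu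
          · exact hvS.2
          · obtain ⟨h', l', hl', rfl, -, -⟩ := exists_key hL0 u
            rcases (hsle h' ⟨l', hl', hu⟩).2.eq_or_lt with rfl | hlt
            · exact Nat.add_le_add_left (hle' l' ⟨hl', hu⟩).2 _
            · exact (key_lt (L := L) hl' hlt v).le
      · exact Wp.tail (Wp.leave (Wp.ret ⟨keep m₃ (by omega) hF' hR', hFm, rfl, by omega,
          fun e => absurd e hns⟩))
    · have hnon : (lows R L h \ {l}).Nonempty := by
        rw [Set.nonempty_iff_ne_empty, Ne, hV₂.endPts.eq_empty_iff]
        exact h0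
      have hhighs : highs (R \ {y}) L = highs R L := by
        rw [hye]
        exact highs_diff_of_nonempty hl hnon
      have hF' : Frame m₁ m₂ (b + 2) (b + sz j) := fun a ha => hF₂ a (by omega)
      have hFm := hF.trans hF' (by omega) le_rfl
      have hR' : Rest m₂ b j (R \ {y}) := by
        refine hR.exchange hj hh hlows (fun a ha1 ha2 ha3 => hF₂ a (by omega)) ?_ ?_
        · rw [← hL, hlowsh]
          exact hV₂
        · rw [← hL, hhighs]
          exact hR.2.congr fun a ha1 ha2 => hF₂ a (by omega)
      refine Wp.eq (Wp.ite (fun h3 => ?_) (fun h3 => ?_))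
      · obtain ⟨_, v, _, hv, hle', _, g2⟩ := hV₂.endPts.resolve_left (fun e => by
          rw [e.1] at hnon
          exact Set.not_nonempty_empty hnon)
        have hvR : h * L + v ∈ R \ {y} := by
          rw [← hlowsh] at hv
          exact hv.2
        have hvS := hmem _ hvR
        have hvj : h * L + v < 2 ^ j := hSlt _ hvS.1.1
        refine Wp.readAt hB' (by omega) ?_
        rw [g2]
        refine Wp.shl (by rw [← hL]; omega) (Wp.add (by rw [← hL]; omega)
          (Wp.writeAt hB' (by omega) (by rw [← hL]; omega) (Wp.tail (Wp.leave (Wp.ret ?_)))))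
        rw [← hL]
        refine ⟨change m₂ (h * L + v) hF' hR' hvS.1 fun u hu => ?_,
          hFm.update (by omega) (by omega), rfl, by omega, fun e => absurd e hns⟩
        rcases hmem' u hu with rfl | hu
        · exact hvS.2
        · have hule := (hle u hu.1.1).2
          obtain ⟨h', l', hl', rfl, -, -⟩ := exists_key hL0 u
          rcases lt_trichotomy h' h with hlt | rfl | hlt
          · exact (key_lt (L := L) hl' hlt v).le
          · have hlow : l' ∈ lows R L h' \ {l} := by
              rw [← hlowsh]
              exact ⟨hl', hu⟩
            exact Nat.add_le_add_left (hle' l' hlow).2 _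
          · have := key_lt (L := L) hl hlt l'
            omega
      · exact Wp.tail (Wp.leave (Wp.ret ⟨keep m₂ (by omega) hF' hR', hFm, rfl, by omega,
          fun e => absurd e hns⟩))
  refine Wp.shr_one (by omega) (Wp.sub (by omega) (Wp.add (by omega) (Wp.add (by omega)
    (Wp.eq (Wp.ite (fun h3 => ?_) (fun h3 => ?_))))))
  -- The deleted key is the minimum. The least key in the clusters, the minimum of the first
  -- nonempty one, replaces it and is then deleted from its cluster.
  · have hxy : x = y₀ := by omega
    have hhe := hR.2.endPts
    rw [← hL] at hhe
    have hzh : z₀ / L ∈ highs R L := by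
      refine ⟨z₀ % L, Nat.mod_lt _ hL0, ?_⟩
      rw [mul_comm, Nat.div_add_mod]
      exact hz₀R
    obtain ⟨s, _, hs, _, hsle, hs1, _⟩ := hhe.resolve_left (fun e => by
      rw [e.1] at hzh; exact absurd hzh (by simp))
    have hs2 : s < 2 ^ (j - j / 2) := hR.2.lt hs
    have hA' := Rest.addr_cases (b := b) hj hs2
    have hps' := pow_lt_word hB (show 1 ≤ j / 2 by omega) (hA'.2.1.trans hb)
    have hp2 := pow_lt_word hB (show 1 ≤ j - j / 2 by omega) (hse.trans hb)
    obtain ⟨u, v, hu, hv, hle', g1, g2⟩ := ((hR.1 s hs2).endPts).resolve_left (fun e => by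
      have := mem_highs_iff.1 hs
      rw [e.1] at this
      exact Set.not_nonempty_empty this)
    have huR : s * L + u ∈ R := hu.2
    have huj : s * L + u < 2 ^ j := hSlt _ huR.1
    refine Wp.read hB' (by omega) ?_
    rw [hs1]
    refine Wp.sub (by omega) ?_
    rw [Nat.add_sub_cancel]
    refine Wp.clusterAddr hB hj hb hs2 (Wp.read hB' (by omega) ?_)
    rw [g1]
    refine Wp.shl (by rw [← hL]; omega) (Wp.add (by rw [← hL]; omega) (Wp.sub (by rw [← hL]; omega)
      (Wp.write hB' (by omega) (by rw [← hL]; omega) ?_)))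
    rw [← hL, ← add_assoc (s * L), Nat.add_sub_cancel]
    have hSR : ∀ u, u ∈ S \ {x} ↔ u ∈ R := by
      intro u
      constructor
      · rintro ⟨hu, hne⟩
        rw [Set.mem_singleton_iff] at hne
        exact ⟨hu, by omega⟩
      · rintro ⟨hu, hne⟩
        refine ⟨hu, ?_⟩
        rw [Set.mem_singleton_iff]
        omega
    refine rest _ _ (s * L + u) (s * L + u) huR ((hSR _).2 huR) ?_ (Function.update_self _ _ _) ?_
      (hR.congr hj fun a ha1 ha2 => Function.update_of_ne (by omega) _ _) ?_
      ((Frame.refl m _ _).update le_rfl (by omega)) (by omega)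
    · intro u' hu'
      rw [hSR] at hu'
      obtain ⟨h', l', hl', rfl, -, -⟩ := exists_key hL0 u'
      rcases (hsle h' ⟨l', hl', hu'⟩).1.eq_or_lt with rfl | hlt
      · exact Nat.add_le_add_left (hle' l' ⟨hl', hu'⟩).1 _
      · exact (key_lt (L := L) hu.1 hlt l').le
    · rw [Function.update_of_ne (by omega), h2]
    · rw [Function.update_self]
      ext u'
      rw [Set.mem_ofPred_eq, hSR, Set.mem_sdiff, Set.mem_singleton_iff]
      simp
  · refine rest m _ x y₀ ⟨hxS, h3⟩ ⟨hy₀, ?_⟩ (fun u hu => (hle u hu.1).1) h1 h2 hR ?_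
      (Frame.refl _ _ _) (by omega)
    · rw [Set.mem_singleton_iff]; omega
    · ext u'
      simp only [R, Set.mem_ofPred_eq, Set.mem_sdiff, Set.mem_singleton_iff]
      tauto

/-! ## Inclusion-minimal intervals -/

theorem exists_minimal_subinterval {C : Set (ℕ × ℕ)} (hC : C.Finite) {p : ℕ × ℕ} (hp : p ∈ C) :
    ∃ q ∈ minimalIntervals C, p.1 ≤ q.1 ∧ q.2 ≤ p.2 := by
  -- A shortest member inside `p` contains no other member. Lengths are taken in `ℤ`, as nothing
  -- forces the first component of a pair to be at most the second.
  obtain ⟨q, ⟨hq, h1, h2⟩, hmin⟩ := Set.exists_min_image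
    {q ∈ C | p.1 ≤ q.1 ∧ q.2 ≤ p.2} (fun q => (q.2 : ℤ) - q.1)
    (hC.subset (Set.sep_subset _ _)) ⟨p, hp, le_rfl, le_rfl⟩
  refine ⟨q, ⟨hq, fun q' hq' h3 h4 => ?_⟩, h1, h2⟩
  have := hmin q' ⟨hq', h1.trans h3, h4.trans h2⟩
  exact Prod.ext (by omega) (by omega)

/-- The inclusion-minimal intervals after a new interval has come in. -/
theorem mem_minimalIntervals_insert {C : Set (ℕ × ℕ)} (hC : C.Finite) {x y : ℕ × ℕ} :
    y ∈ minimalIntervals (insert x C) ↔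
      (y ∈ minimalIntervals C ∧ ¬ (y.1 ≤ x.1 ∧ x.2 ≤ y.2)) ∨
      (y = x ∧ ¬ ∃ s ∈ minimalIntervals C, ¬ (s.1 ≤ x.1 ∧ x.2 ≤ s.2) ∧ x.1 ≤ s.1 ∧ s.2 ≤ x.2) := by
  constructor
  · rintro ⟨hy, hmin⟩
    rcases eq_or_ne y x with rfl | hne
    · right
      refine ⟨rfl, ?_⟩
      rintro ⟨s, hs, h1, h2, h3⟩
      obtain rfl := hmin s (Set.mem_insert_of_mem _ hs.1) h2 h3
      exact h1 ⟨le_rfl, le_rfl⟩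
    · left
      refine ⟨⟨hy.resolve_left hne, fun q hq => hmin q (Set.mem_insert_of_mem _ hq)⟩, ?_⟩
      rintro ⟨h1, h2⟩
      exact hne (hmin x (Set.mem_insert _ _) h1 h2).symm
  · rintro (⟨⟨hy, hmin⟩, hn⟩ | ⟨rfl, hn⟩)
    · refine ⟨Set.mem_insert_of_mem _ hy, ?_⟩
      rintro q (rfl | hq) h1 h2
      · exact absurd ⟨h1, h2⟩ hn
      · exact hmin q hq h1 h2
    · refine ⟨Set.mem_insert _ _, ?_⟩
      rintro q (rfl | hq) h1 h2
      · rfl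
      · obtain ⟨s, hs, h3, h4⟩ := exists_minimal_subinterval hC hq
        -- A minimal `s` inside `q` also lies inside `y`. By hypothesis it cannot be a survivor, so
        -- it contains `y`; then `y`, `q` and `s` coincide.
        have : s.1 ≤ y.1 ∧ y.2 ≤ s.2 := by
          by_contra hcon
          exact hn ⟨s, hs, hcon, h1.trans h3, h4.trans h2⟩
        exact Prod.ext (by omega) (by omega)

/-- The intervals with right ends in `S` and left ends given by `f`. -/
def graphOn (S : Finset ℕ) (f : ℕ → ℕ) : Set (ℕ × ℕ) := {p | p.2 ∈ S ∧ p.1 = f p.2}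

/-- Otherwise the interval with the larger right end would contain the other one. This monotonicity
lets one predecessor or successor query stand for a search through the whole set. -/
theorem graphOn_strictMono {S : Finset ℕ} {f : ℕ → ℕ} {C : Set (ℕ × ℕ)}
    (h : graphOn S f = minimalIntervals C) {r r' : ℕ} (hr : r ∈ S) (hr' : r' ∈ S)
    (hlt : r < r') : f r < f r' := by
  by_contra! hle
  have h1 : ((f r, r) : ℕ × ℕ) ∈ minimalIntervals C := by rw [← h]; exact ⟨hr, rfl⟩
  have h2 : ((f r', r') : ℕ × ℕ) ∈ minimalIntervals C := by rw [← h]; exact ⟨hr', rfl⟩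
  have := congrArg Prod.snd (h2.2 _ h1.1 hle hlt.le)
  simp only at this
  omega

/-- The keys that remain when the intervals that contain `[ℓ, r]` are deleted. -/
def remaining (S : Finset ℕ) (f : ℕ → ℕ) (ℓ r : ℕ) : Finset ℕ :=
  S.filter fun s => ¬ (f s ≤ ℓ ∧ r ≤ s)

theorem mem_remaining {S : Finset ℕ} {f : ℕ → ℕ} {ℓ r s : ℕ} :
    s ∈ remaining S f ℓ r ↔ s ∈ S ∧ ¬ (f s ≤ ℓ ∧ r ≤ s) := Finset.mem_filter

theorem remaining_eq_self {S : Finset ℕ} {f : ℕ → ℕ} {ℓ r : ℕ}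
    (h : ∀ s ∈ S, r ≤ s → ℓ < f s) : remaining S f ℓ r = S :=
  Finset.filter_true_of_mem fun s hs hc => absurd (h s hs hc.2) (by omega)

/-- The final set does not depend on which containing interval is removed first, so the inner loop
may take them one at a time. -/
theorem remaining_erase {S : Finset ℕ} {f : ℕ → ℕ} {ℓ r s : ℕ} (hs : f s ≤ ℓ ∧ r ≤ s) :
    remaining (S.erase s) f ℓ r = remaining S f ℓ r := by
  ext x
  simp only [mem_remaining, Finset.mem_erase]
  constructor
  · rintro ⟨⟨_, h⟩, h'⟩; exact ⟨h, h'⟩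
  · rintro ⟨h, h'⟩; exact ⟨⟨fun e => h' (e ▸ hs), h⟩, h'⟩

theorem graphOn_remaining_of_contains {S : Finset ℕ} {f : ℕ → ℕ} {C : Set (ℕ × ℕ)}
    (hC : C.Finite) (h : graphOn S f = minimalIntervals C) {ℓ r : ℕ}
    (hc : ∃ s ∈ remaining S f ℓ r, ℓ ≤ f s ∧ s ≤ r) :
    graphOn (remaining S f ℓ r) f = minimalIntervals (insert (ℓ, r) C) := by
  ext p
  rw [mem_minimalIntervals_insert hC, ← h, or_iff_left]
  · simp only [graphOn, Set.mem_ofPred_eq, mem_remaining]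
    constructor
    · rintro ⟨⟨h1, h2⟩, h3⟩; exact ⟨⟨h1, h3⟩, by rwa [h3]⟩
    · rintro ⟨⟨h1, h3⟩, h2⟩; exact ⟨⟨h1, by rwa [← h3]⟩, h3⟩
  · rintro ⟨_, hn⟩
    obtain ⟨s, hs, h1⟩ := hc
    rw [mem_remaining] at hs
    exact hn ⟨(f s, s), ⟨hs.1, rfl⟩, hs.2, h1⟩

/-- The key `r` cannot be among the survivors: the interval stored there would either contain `[ℓ,
r]` or lie inside it. So overwriting the left end at `r` damages no interval that is still in use.
-/
theorem graphOn_insert_remaining {S : Finset ℕ} {f g : ℕ → ℕ} {C : Set (ℕ × ℕ)}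
    (hC : C.Finite) (h : graphOn S f = minimalIntervals C) {ℓ r : ℕ}
    (hc : ¬ ∃ s ∈ remaining S f ℓ r, ℓ ≤ f s ∧ s ≤ r)
    (hr : g r = ℓ) (hg : ∀ s, s ≠ r → g s = f s) :
    graphOn (insert r (remaining S f ℓ r)) g = minimalIntervals (insert (ℓ, r) C) := by
  have hrS : r ∉ remaining S f ℓ r := by
    intro hmem
    have := (mem_remaining.1 hmem).2
    exact hc ⟨r, hmem, by omega, le_rfl⟩
  ext p
  rw [mem_minimalIntervals_insert hC, ← h]
  simp only [graphOn, Set.mem_ofPred_eq, Finset.mem_insert]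
  constructor
  · rintro ⟨h1 | h1, h2⟩
    · right
      refine ⟨Prod.ext (by rw [h2, h1, hr]) h1, ?_⟩
      rintro ⟨q, ⟨hs, hq⟩, h3, h4⟩
      rw [hq] at h3 h4
      exact hc ⟨q.2, mem_remaining.2 ⟨hs, h3⟩, h4⟩
    · left
      have hne : p.2 ≠ r := by rintro rfl; exact hrS h1
      rw [hg _ hne] at h2
      rw [mem_remaining] at h1
      exact ⟨⟨h1.1, h2⟩, by rw [h2]; exact h1.2⟩
  · rintro (⟨⟨h1, h2⟩, h3⟩ | ⟨rfl, _⟩)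
    · have hmem : p.2 ∈ remaining S f ℓ r := mem_remaining.2 ⟨h1, by rwa [← h2]⟩
      have hne : p.2 ≠ r := by rintro rfl; exact hrS hmem
      exact ⟨.inr hmem, by rw [hg _ hne, h2]⟩
    · exact ⟨.inl rfl, hr.symm⟩

/-! ## The candidates -/

theorem candidates_zero (n : ℕ) (mem : ℕ → ℕ) : candidates n mem 0 = ∅ := by
  ext p
  simp only [candidates, Set.mem_ofPred_eq, Set.mem_empty_iff_false, iff_false]
  rintro ⟨k, hk, _⟩
  have := hk.1
  have := hk.2
  omega

theorem candidates_succ (n : ℕ) (mem : ℕ → ℕ) (t : ℕ) : candidates n mem (t + 1) =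
    insert (mem (arr n 2 (mem (arr n 1 (t + 1)))), mem (arr n 3 (mem (arr n 1 (t + 1)))))
      (candidates n mem t) := by
  ext p
  simp only [candidates, Set.mem_ofPred_eq, Set.mem_insert_iff, Set.mem_Icc]
  constructor
  · rintro ⟨k, hk, rfl⟩
    rcases hk.2.eq_or_lt with rfl | hlt
    · exact .inl rfl
    · exact .inr ⟨k, ⟨hk.1, by omega⟩, rfl⟩
  · rintro (rfl | ⟨k, hk, rfl⟩)
    · exact ⟨t + 1, ⟨by omega, le_rfl⟩, rfl⟩
    · exact ⟨k, ⟨hk.1, by omega⟩, rfl⟩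

theorem candidates_finite (n : ℕ) (mem : ℕ → ℕ) (t : ℕ) : (candidates n mem t).Finite := by
  refine ((Set.finite_Icc 1 t).image fun k =>
    (mem (arr n 2 (mem (arr n 1 k))), mem (arr n 3 (mem (arr n 1 k))))).subset ?_
  rintro p ⟨k, hk, rfl⟩
  exact ⟨k, hk, rfl⟩

/-- Every key is the right end of a candidate. The bound ensures that the inner loop, which has fuel
`n + 1`, cannot run out. -/
theorem card_keys_le {n t : ℕ} {mem f : ℕ → ℕ} {S : Finset ℕ}
    (h : graphOn S f = minimalIntervals (candidates n mem t)) : S.card ≤ t := by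
  have : S ⊆ (Finset.Icc 1 t).image fun k => mem (arr n 3 (mem (arr n 1 k))) := by
    intro s hs
    have : ((f s, s) : ℕ × ℕ) ∈ minimalIntervals (candidates n mem t) := by
      rw [← h]; exact ⟨hs, rfl⟩
    obtain ⟨k, hk, e⟩ := this.1
    exact Finset.mem_image.2 ⟨k, Finset.mem_Icc.2 hk, (congrArg Prod.snd e).symm⟩
  have h1 := Finset.card_le_card this
  have h2 := Finset.card_image_le (s := Finset.Icc 1 t)
    (f := fun k => mem (arr n 3 (mem (arr n 1 k))))
  rw [Nat.card_Icc] at h2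
  omega

/-- The memory holds tables and an order of the positions that fit the text `T`. -/
structure LoopInput (T : ℕ → ℕ) (n : ℕ) (mem : ℕ → ℕ) : Prop where
  table : ∀ i ∈ Set.Icc 1 n,
    mem (arr n 2 i) ≤ i ∧ i ≤ mem (arr n 3 i) ∧ mem (arr n 3 i) ≤ n + 1
  sorted : IsSortedInput T n mem

/-- Strictly decreasing values make the listed positions distinct, and `n` distinct members of `[1,
n]` are all of them. -/
theorem LoopInput.surj {T mem : ℕ → ℕ} {n : ℕ} (h : LoopInput T n mem) {i : ℕ}
    (hi : i ∈ Set.Icc 1 n) : ∃ k ∈ Set.Icc 1 n, mem (arr n 1 k) = i := by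
  have himg : (Finset.Icc 1 n).image (fun k => mem (arr n 1 k)) = Finset.Icc 1 n := by
    apply Finset.eq_of_subset_of_card_le
    · intro x hx
      obtain ⟨k, hk, rfl⟩ := Finset.mem_image.1 hx
      exact Finset.mem_Icc.2 (h.sorted.1 k (Finset.mem_Icc.1 hk))
    · rw [Finset.card_image_of_injOn]
      intro k hk k' hk' e
      simp only at e
      rw [Finset.mem_coe, Finset.mem_Icc] at hk hk'
      rcases lt_trichotomy k k' with hlt | rfl | hlt
      · have := h.sorted.2 k hk k' hk' hlt
        rw [e] at this; omega
      · rfl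
      · have := h.sorted.2 k' hk' k hk hlt
        rw [e] at this; omega
  have : i ∈ (Finset.Icc 1 n).image (fun k => mem (arr n 1 k)) := by
    rw [himg]; exact Finset.mem_Icc.2 hi
  obtain ⟨k, hk, e⟩ := Finset.mem_image.1 this
  exact ⟨k, Finset.mem_Icc.1 hk, e⟩

theorem LoopInput.candidates_bounds {T mem : ℕ → ℕ} {n t : ℕ} (h : LoopInput T n mem)
    (ht : t ≤ n) {p : ℕ × ℕ} (hp : p ∈ candidates n mem t) :
    p.1 ≤ n ∧ 1 ≤ p.2 ∧ p.2 ≤ n + 1 := by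
  obtain ⟨k, hk, rfl⟩ := hp
  have hi := h.sorted.1 k ⟨hk.1, hk.2.trans ht⟩
  have h1 := h.table _ hi
  have h2 := hi.1
  have h3 := hi.2
  simp only
  omega

theorem LoopInput.le_leftMax_iff {T mem : ℕ → ℕ} {n t ℓ : ℕ} (h : LoopInput T n mem)
    (ht : t + 1 ≤ n) (hℓ : 1 ≤ ℓ) :
    ℓ ≤ leftMax T (fun j => mem (arr n 2 j)) (fun j => mem (arr n 3 j)) (mem (arr n 1 (t + 1))) ↔
      ∃ p ∈ candidates n mem t, p.2 < mem (arr n 1 (t + 1)) ∧ ℓ ≤ p.1 := by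
  have hi := h.sorted.1 (t + 1) ⟨by omega, ht⟩
  have hi2 := hi.2
  rw [CTMSeq.le_leftMax_iff hℓ]
  constructor
  · rintro ⟨j, h1, ⟨h2, h3⟩, h4⟩
    obtain ⟨k, hk, rfl⟩ := h.surj (i := j) ⟨h1.1, by omega⟩
    refine ⟨_, ⟨k, ⟨hk.1, ?_⟩, rfl⟩, h3, h4⟩
    -- A position that comes later in the order has a smaller value, so `T i < T j` places `j` among
    -- the first `t`.
    by_contra! hlt
    rcases (show t + 1 ≤ k from hlt).eq_or_lt with rfl | hlt
    · omega
    · have := h.sorted.2 _ ⟨by omega, ht⟩ k hk hlt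
      omega
  · rintro ⟨p, ⟨k, hk, rfl⟩, h3, h4⟩
    have hk' : k ∈ Set.Icc 1 n := ⟨hk.1, hk.2.trans (by omega)⟩
    have hj := h.sorted.1 k hk'
    have htab := h.table _ hj
    have hk2 := hk.2
    simp only at h3 h4
    -- The bound `j ≤ i - 1` is a consequence of `j ≤ B j < i`.
    exact ⟨_, ⟨hj.1, by omega⟩, ⟨h.sorted.2 k hk' _ ⟨by omega, ht⟩ (by omega), h3⟩, h4⟩

/-- The left end of the interval with the largest right end below `i` is the value wanted. -/
theorem LoopInput.leftMax_eq {T mem f : ℕ → ℕ} {n t : ℕ} {S : Finset ℕ} (h : LoopInput T n mem)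
    (ht : t + 1 ≤ n) (hS : graphOn S f = minimalIntervals (candidates n mem t)) {v : ℕ}
    (hv : (v = 0 ∧ ∀ s ∈ S, mem (arr n 1 (t + 1)) ≤ s) ∨
      ∃ s ∈ S, s < mem (arr n 1 (t + 1)) ∧ v = f s ∧
        ∀ s' ∈ S, s' < mem (arr n 1 (t + 1)) → s' ≤ s) :
    v = leftMax T (fun j => mem (arr n 2 j)) (fun j => mem (arr n 3 j))
      (mem (arr n 1 (t + 1))) := by
  refine Nat.le_antisymm ?_ ?_
  · rcases Nat.eq_zero_or_pos v with rfl | hpos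
    · exact Nat.zero_le _
    · rw [h.le_leftMax_iff ht hpos]
      obtain ⟨s, hs, h1, rfl, _⟩ := hv.resolve_left (by omega)
      have : ((f s, s) : ℕ × ℕ) ∈ minimalIntervals (candidates n mem t) := by
        rw [← hS]; exact ⟨hs, rfl⟩
      exact ⟨_, this.1, h1, le_rfl⟩
  · by_contra! hlt
    obtain ⟨p, hp, h1, h2⟩ := (h.le_leftMax_iff (ℓ := v + 1) ht (by omega)).1 hlt
    obtain ⟨q, hq, h3, h4⟩ := exists_minimal_subinterval (candidates_finite n mem t) hp
    rw [← hS] at hq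
    obtain ⟨hq1, hq2⟩ := hq
    rcases hv with ⟨_, hv⟩ | ⟨s, hs, h5, rfl, h6⟩
    · have := hv _ hq1; omega
    -- The minimal interval `q` also ends before `i`, hence not after `s`, and by monotonicity its
    -- left end is at most that of `s`.
    · rcases (h6 _ hq1 (by omega)).eq_or_lt with e | hlt
      · rw [e] at hq2; omega
      · have := graphOn_strictMono hS hq1 hs hlt; omega

/-! ## The main loop -/

/-- Number of bits of the keys. -/
def keyBits (n : ℕ) : ℕ := Nat.clog 2 (n + 3)

/-- A bound of the addresses in use. -/
def memBound (n : ℕ) : ℕ := arr n 9 0 + sz (keyBits n)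

/-- The registers after `setup`. -/
def regs (n : ℕ) : Regs :=
  ⟨n, arr n 1 0, arr n 2 0, arr n 3 0, arr n 4 0, arr n 5 0, arr n 9 0, keyBits n⟩

theorem arr_add (n k i : ℕ) : arr n k 0 + i = arr n k i := rfl

theorem le_two_pow_keyBits (n : ℕ) : n + 3 ≤ 2 ^ keyBits n := Nat.le_pow_clog (by omega) _

theorem two_le_keyBits {n : ℕ} (hn : 1 ≤ n) : 2 ≤ keyBits n := by
  by_contra! h
  have h1 := le_two_pow_keyBits n
  have h2 : 2 ^ keyBits n ≤ 2 ^ 1 := Nat.pow_le_pow_right (by omega) (by omega)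
  omega

theorem two_pow_keyBits_le {n : ℕ} (hn : 1 ≤ n) : 2 ^ keyBits n ≤ 2 * (n + 2) := by
  have h1 := Nat.pow_pred_clog_lt_self (b := 2) (by omega) (x := n + 3) (by omega)
  have h2 := two_le_keyBits hn
  have h3 : keyBits n = (Nat.clog 2 (n + 3)).pred + 1 := by
    rw [Nat.pred_eq_sub_one]; unfold keyBits at *; omega
  rw [h3, pow_succ]
  omega

theorem memBound_le {n : ℕ} (hn : 1 ≤ n) : memBound n ≤ 60 * n := by
  have := two_pow_keyBits_le hn
  unfold memBound arr sz
  omega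

/-- The program passes the number of bits as fuel to the tree operations; this bound shows that it
covers their depth. -/
theorem lev_le_self {j : ℕ} (hj : 1 ≤ j) : lev j ≤ j := by
  have h1 := Nat.lt_two_pow_self (n := j - 1)
  have h2 : Nat.clog 2 j ≤ j - 1 := Nat.clog_le_of_le_pow (by omega)
  unfold lev; omega

section Loop

variable {w K n d : ℕ}

/-- The time is bounded with a potential of `140 * lev` for each key. A round that deletes costs at
most `50 * lev` for the query, `80 * lev` for the deletion and a few single operations, which the
key removed pays for. Only the last round, which deletes nothing, costs extra: at most `60 * lev`.
-/
theorem deleteLoop_spec (hB : memBound n + 8 ≤ 2 ^ w) (hn : 1 ≤ n)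
    (hK : d + lev (keyBits n) ≤ K) {f : ℕ → ℕ} {ℓ r : ℕ} (hr : 1 ≤ r) (hrn : r ≤ n + 1)
    (fuel : ℕ) : ∀ {S : Finset ℕ} {m : ℕ → ℕ} {t : ℕ},
      Veb m (arr n 9 0) (keyBits n) ↑S → (∀ s ∈ S, m (arr n 5 s) = f s) →
      (∀ s ∈ S, s ≤ n + 1) → (∀ s ∈ S, ∀ s' ∈ S, s < s' → f s < f s') → S.card < fuel →
      Wp w (memBound n) K (deleteLoop (regs n) fuel ℓ r) m t d fun _ m' t' d' => d' = d ∧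
        Veb m' (arr n 9 0) (keyBits n) ↑(remaining S f ℓ r) ∧
        Frame m m' (arr n 9 0) (memBound n) ∧
        t' + 140 * lev (keyBits n) * (remaining S f ℓ r).card ≤
          t + 140 * lev (keyBits n) * S.card + 60 * lev (keyBits n) := by
  have hB' : memBound n ≤ 2 ^ w := by omega
  have hlev := lev_pos (keyBits n)
  have hpow := le_two_pow_keyBits n
  have hbits := two_le_keyBits hn
  have hlb := lev_le_self (show 1 ≤ keyBits n by omega)
  have hp := pow_lt_word hB (show 1 ≤ keyBits n by omega) le_rfl
  induction fuel with
  | zero => intro S m t _ _ _ _ h; omega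
  | succ fuel ih =>
    intro S m t hV hf hS hmono hcard
    rw [deleteLoop]
    refine Wp.tick (Wp.sub (by omega) (Wp.bind ((vebSucc_spec hB (keyBits n) hV (by omega) le_rfl
      hlb hK).mono ?_)))
    rintro q m' t' d' ⟨rfl, rfl, hq, ht⟩
    refine Wp.lt (Wp.ite (fun h0 => ?_) (fun h0 => ?_))
    swap
    · have hself : remaining S f ℓ r = S := by
        refine remaining_eq_self fun s hs hrs => ?_
        rcases hq with hq | ⟨_, _, _, _, _⟩
        · have := hq.2 s hs; omega
        · omega
      rw [hself]
      exact Wp.ret ⟨rfl, hV, Frame.refl _ _ _, by omega⟩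
    obtain ⟨s, hs, hrs, rfl, hmin⟩ := hq.resolve_left (by omega)
    rw [Finset.mem_coe] at hs
    have hsn := hS s hs
    refine Wp.sub (by omega) ?_
    rw [Nat.add_sub_cancel]
    refine Wp.readAt hB' (by unfold memBound; simp only [regs, arr]; omega) ?_
    rw [show (regs n).asc + s = arr n 5 s from rfl, hf s hs]
    refine Wp.lt (Wp.ite (fun h1 => ?_) (fun h1 => ?_))
    -- The first interval that ends at or after `r` starts to the right of `ℓ`; as left ends
    -- increase, so do all later ones, and nothing is left to delete.
    · have hself : remaining S f ℓ r = S := by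
        refine remaining_eq_self fun s' hs' hrs' => ?_
        rcases (hmin s' hs' (by omega)).eq_or_lt with rfl | hlt
        · exact h1
        · exact h1.trans (hmono s hs s' hs' hlt)
      rw [hself]
      exact Wp.ret ⟨rfl, hV, Frame.refl _ _ _, by omega⟩
    -- The second test of the program always fails: a successor of `r - 1` is at least `r`.
    refine Wp.lt (Wp.ite_neg (by omega) ?_)
    refine Wp.bind ((vebDelete_spec hB (keyBits n) hV (Finset.mem_coe.2 hs) le_rfl hlb hK).mono ?_)
    rintro _ m₁ t₁ _ ⟨hV₁, hF₁, rfl, ht₁, -⟩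
    rw [← Finset.coe_erase] at hV₁
    have hcs := Finset.card_erase_add_one hs
    refine (ih hV₁ (fun s' hs' => ?_) (fun s' hs' => hS s' (Finset.mem_of_mem_erase hs'))
      (fun s₁ h₁ s₂ h₂ => hmono s₁ (Finset.mem_of_mem_erase h₁) s₂ (Finset.mem_of_mem_erase h₂))
      (by omega)).mono ?_
    · have hs' := Finset.mem_of_mem_erase hs'
      have := hS s' hs'
      rw [hF₁ _ (by simp only [arr]; omega), hf s' hs']
    rw [remaining_erase ⟨by omega, by omega⟩]
    rintro _ m₂ t₂ _ ⟨rfl, hV₂, hF₂, ht₂⟩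
    refine ⟨rfl, hV₂, hF₁.trans hF₂ le_rfl le_rfl, ?_⟩
    rw [← hcs, mul_add]
    omega

/-- Among the intervals that end at or before `r`, the one with the largest right end also has the
largest left end. If it does not lie inside `[ℓ, r]`, none does. -/
theorem insertIfMinimal_spec (hB : memBound n + 8 ≤ 2 ^ w) (hn : 1 ≤ n)
    (hK : d + lev (keyBits n) ≤ K) {ℓ r : ℕ} (hrn : r ≤ n + 1) (hℓ : ℓ ≤ n)
    {S : Finset ℕ} {m : ℕ → ℕ} {t : ℕ}
    (hV : Veb m (arr n 9 0) (keyBits n) ↑S) (hS : ∀ s ∈ S, s ≤ n + 1)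
    (hmono : ∀ s ∈ S, ∀ s' ∈ S, s < s' → m (arr n 5 s) < m (arr n 5 s'))
    (hnot : ∀ s ∈ S, ¬ (m (arr n 5 s) ≤ ℓ ∧ r ≤ s)) :
    Wp w (memBound n) K (insertIfMinimal (regs n) ℓ r) m t d fun _ m' t' d' => d' = d ∧
      t' ≤ t + 120 * lev (keyBits n) ∧
      ((∃ s ∈ S, ℓ ≤ m (arr n 5 s) ∧ s ≤ r) ∧ m' = m ∨
        (¬ ∃ s ∈ S, ℓ ≤ m (arr n 5 s) ∧ s ≤ r) ∧
        Veb m' (arr n 9 0) (keyBits n) ↑(insert r S) ∧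
        ∀ a, a < arr n 9 0 → m' a = Function.update m (arr n 5 r) ℓ a) := by
  have hB' : memBound n ≤ 2 ^ w := by omega
  have hlev := lev_pos (keyBits n)
  have hpow := le_two_pow_keyBits n
  have hbits := two_le_keyBits hn
  have hlb := lev_le_self (show 1 ≤ keyBits n by omega)
  have hp := pow_lt_word hB (show 1 ≤ keyBits n by omega) le_rfl
  have hadd : (¬ ∃ s ∈ S, ℓ ≤ m (arr n 5 s) ∧ s ≤ r) → ∀ t₁, t₁ ≤ t + 60 * lev (keyBits n) →
      Wp w (memBound n) K (do
        vebInsert (keyBits n) (arr n 9 0) (keyBits n) r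
        writeAt (arr n 5 0) r ℓ) m t₁ d fun _ m' t' d' => d' = d ∧
      t' ≤ t + 120 * lev (keyBits n) ∧
      ((∃ s ∈ S, ℓ ≤ m (arr n 5 s) ∧ s ≤ r) ∧ m' = m ∨
        (¬ ∃ s ∈ S, ℓ ≤ m (arr n 5 s) ∧ s ≤ r) ∧
        Veb m' (arr n 9 0) (keyBits n) ↑(insert r S) ∧
        ∀ a, a < arr n 9 0 → m' a = Function.update m (arr n 5 r) ℓ a) := by
    intro hno t₁ ht₁
    have hrS : r ∉ (S : Set ℕ) := fun hmem => by
      have := hnot r hmem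
      exact hno ⟨r, hmem, by omega, le_rfl⟩
    refine Wp.bind ((vebInsert_spec hB (keyBits n) hV (by omega) hrS le_rfl hlb hK).mono ?_)
    rintro _ m₁ t₂ _ ⟨hV₁, hF₁, rfl, ht₂⟩
    have hvl : ℓ < 2 ^ w := by omega
    refine Wp.tail (Wp.writeAt hB' (by unfold memBound; simp only [arr]; omega) hvl
      (Wp.ret ⟨rfl, by omega, .inr ⟨hno, ?_, fun a ha => ?_⟩⟩))
    · rw [Finset.coe_insert]
      exact hV₁.congr fun a ha1 ha2 => Function.update_of_ne
        (by simp only [arr] at *; omega) _ _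
    · rw [arr_add]
      by_cases e : a = arr n 5 r
      · subst e; rw [Function.update_self, Function.update_self]
      · rw [Function.update_of_ne e, Function.update_of_ne e, hF₁ a (.inl ha)]
  unfold insertIfMinimal
  refine Wp.add (by omega) (Wp.bind ((vebPred_spec hB (keyBits n) hV (by omega) le_rfl
    hlb hK).mono ?_))
  rintro q m' t' d' ⟨rfl, rfl, hq, ht⟩
  refine Wp.lt (Wp.ite (fun h0 => ?_) (fun h0 => ?_))
  · obtain ⟨s, hs, hsr, rfl, hmax⟩ := hq.resolve_left (by omega)
    rw [Finset.mem_coe] at hs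
    have hsn := hS s hs
    refine Wp.sub (by omega) ?_
    rw [Nat.add_sub_cancel]
    refine Wp.readAt hB' (by unfold memBound; simp only [regs, arr]; omega) ?_
    rw [show (regs n).asc + s = arr n 5 s from rfl]
    refine Wp.lt (Wp.lt ?_)
    -- A predecessor of `r + 1` is at most `r`, so containment is decided by the left ends alone.
    have hbool : (!decide (m' (arr n 5 s) < ℓ) && !decide (r < s)) =
        decide (ℓ ≤ m' (arr n 5 s)) := by
      rw [decide_eq_false (show ¬ r < s by omega), ← decide_not]
      simp
    simp only [hbool]
    refine Wp.ite (fun h1 => ?_) (fun h1 => ?_)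
    · exact Wp.ret ⟨rfl, by omega, .inl ⟨⟨s, hs, h1, by omega⟩, rfl⟩⟩
    · refine hadd ?_ _ (by omega)
      rintro ⟨s', hs', h2, h3⟩
      rcases (hmax s' hs' (by omega)).eq_or_lt with rfl | hlt
      · exact h1 h2
      · have := hmono s' hs' s hs hlt; omega
  · refine hadd ?_ _ (by omega)
    rintro ⟨s', hs', h2, h3⟩
    rcases hq with hq | ⟨_, _, _, _, _⟩
    · have := hq.2 s' hs'; omega
    · omega

/-- The invariant of the main loop after `k` rounds. -/
structure LoopInv (T : ℕ → ℕ) (n : ℕ) (mem : ℕ → ℕ) (t₀ k : ℕ) (m : ℕ → ℕ) (t : ℕ) : Prop where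
  frame : ∀ a, a < arr n 4 0 → m a = mem a
  dict : ∃ S : Finset ℕ, Veb m (arr n 9 0) (keyBits n) ↑S ∧
    graphOn S (fun s => m (arr n 5 s)) = minimalIntervals (candidates n mem k) ∧
    t + 140 * lev (keyBits n) * S.card ≤ t₀ + 400 * lev (keyBits n) * k
  out : ∀ k' ∈ Set.Icc 1 k, m (arr n 4 (mem (arr n 1 k'))) =
    leftMax T (fun j => mem (arr n 2 j)) (fun j => mem (arr n 3 j)) (mem (arr n 1 k'))

/-- The allowance of `400 * lev` per round covers a predecessor query, the unpaid last round of the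
inner loop, the containment test with the insertion, and `140 * lev` of potential for the new key.
-/
theorem processPosition_spec (hB : memBound n + 8 ≤ 2 ^ w) (hn : 1 ≤ n)
    (hK : d + lev (keyBits n) ≤ K) {T mem : ℕ → ℕ} (hin : LoopInput T n mem) {k : ℕ}
    (hk : k < n) {m : ℕ → ℕ} {t₀ t : ℕ} (hI : LoopInv T n mem t₀ k m t) :
    Wp w (memBound n) K (processPosition (regs n) (1 + k)) m (t + 2) d fun _ m' t' d' =>
      d' = d ∧ LoopInv T n mem t₀ (k + 1) m' t' := by
  have hB' : memBound n ≤ 2 ^ w := by omega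
  have hlev := lev_pos (keyBits n)
  have hpow := le_two_pow_keyBits n
  have hbits := two_le_keyBits hn
  have hlb := lev_le_self (show 1 ≤ keyBits n by omega)
  have hp := pow_lt_word hB (show 1 ≤ keyBits n by omega) le_rfl
  have hMB : arr n 9 0 ≤ memBound n := Nat.le_add_right _ _
  obtain ⟨hframe, ⟨S, hV, hgraph, htime⟩, hout⟩ := hI
  rw [add_comm 1 k]
  set i := mem (arr n 1 (k + 1)) with hi
  have hin1 := hin.sorted.1 (k + 1) ⟨by omega, hk⟩
  rw [← hi] at hin1
  have hi1 := hin1.1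
  have hi2 := hin1.2
  have htab := hin.table i hin1
  set ℓ := mem (arr n 2 i) with hℓ
  set r := mem (arr n 3 i) with hr
  have hS : ∀ s ∈ S, s ≤ n + 1 := by
    intro s hs
    have : ((m (arr n 5 s), s) : ℕ × ℕ) ∈ minimalIntervals (candidates n mem k) := by
      rw [← hgraph]; exact ⟨hs, rfl⟩
    exact (hin.candidates_bounds hk.le this.1).2.2
  have hfval : ∀ s ∈ S, m (arr n 5 s) ≤ n := by
    intro s hs
    have : ((m (arr n 5 s), s) : ℕ × ℕ) ∈ minimalIntervals (candidates n mem k) := by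
      rw [← hgraph]; exact ⟨hs, rfl⟩
    exact (hin.candidates_bounds hk.le this.1).1
  have hcard := card_keys_le hgraph
  -- the part of the round after the output
  have body : ∀ t₁, t₁ ≤ t + 10 + 50 * lev (keyBits n) →
      Wp w (memBound n) K (do
        let ℓnew ← readAt (arr n 2 0) i
        let rnew ← readAt (arr n 3 0) i
        deleteLoop (regs n) (n + 1) ℓnew rnew
        insertIfMinimal (regs n) ℓnew rnew)
        (Function.update m (arr n 4 i) (leftMax T (fun j => mem (arr n 2 j))
          (fun j => mem (arr n 3 j)) i)) t₁ d fun _ m' t' d' =>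
      d' = d ∧ LoopInv T n mem t₀ (k + 1) m' t' := by
    intro t₁ ht₁
    set m₁ := Function.update m (arr n 4 i) (leftMax T (fun j => mem (arr n 2 j))
          (fun j => mem (arr n 3 j)) i) with hm₁
    have hm₁ne : ∀ a, a ≠ arr n 4 i → m₁ a = m a := fun a ha => Function.update_of_ne ha _ _
    have hframe₁ : ∀ a, a < arr n 4 0 → m₁ a = mem a := fun a ha => by
      rw [hm₁ne a (by simp only [arr] at *; omega), hframe a ha]
    have hV₁ : Veb m₁ (arr n 9 0) (keyBits n) ↑S := hV.congr fun a ha1 ha2 =>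
      hm₁ne a (by simp only [arr] at *; omega)
    have hf₁ : ∀ s, m₁ (arr n 5 s) = m (arr n 5 s) := fun s =>
      hm₁ne _ (by simp only [arr]; omega)
    have hout₁ : ∀ k' ∈ Set.Icc 1 (k + 1), m₁ (arr n 4 (mem (arr n 1 k'))) =
        leftMax T (fun j => mem (arr n 2 j)) (fun j => mem (arr n 3 j)) (mem (arr n 1 k')) := by
      intro k' hk'
      rcases hk'.2.eq_or_lt with rfl | hlt
      · exact Function.update_self _ _ _
      · rw [hm₁ne, hout k' ⟨hk'.1, by omega⟩]
        -- Earlier positions have strictly larger values, so none of them is `i` and their outputs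
        -- are not overwritten.
        have := hin.sorted.2 k' ⟨hk'.1, by omega⟩ (k + 1) ⟨by omega, hk⟩ hlt
        intro e
        have e : mem (arr n 1 k') = i := by simp only [arr] at *; omega
        rw [e] at this
        exact lt_irrefl _ this
    refine Wp.readAt hB' (by simp only [arr] at *; omega) (Wp.readAt hB'
      (by simp only [arr] at *; omega) ?_)
    rw [arr_add, arr_add, hframe₁ _ (by simp only [arr]; omega),
      hframe₁ _ (by simp only [arr]; omega), ← hℓ, ← hr]
    refine Wp.bind ((deleteLoop_spec hB hn hK (f := fun s => m (arr n 5 s)) (by omega) (by omega)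
      (n + 1) hV₁ (fun s _ => hf₁ s) hS (fun s hs s' hs' => graphOn_strictMono hgraph hs hs')
      (by omega)).mono ?_)
    rintro _ m₂ t₂ _ ⟨rfl, hV₂, hF₂, ht₂⟩
    set S' := remaining S (fun s => m (arr n 5 s)) ℓ r with hS'
    have hf₂ : ∀ s ∈ S', m₂ (arr n 5 s) = m (arr n 5 s) := by
      intro s hs
      have := hS s (mem_remaining.1 hs).1
      rw [hF₂ _ (by simp only [arr]; omega), hf₁]
    refine (insertIfMinimal_spec hB hn hK (by omega) (by omega) hV₂
      (fun s hs => hS s (mem_remaining.1 hs).1) ?_ ?_).mono ?_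
    · intro s hs s' hs' hlt
      rw [hf₂ s hs, hf₂ s' hs']
      exact graphOn_strictMono hgraph (mem_remaining.1 hs).1 (mem_remaining.1 hs').1 hlt
    · intro s hs
      rw [hf₂ s hs]
      exact (mem_remaining.1 hs).2
    have hexists : (∃ s ∈ S', ℓ ≤ m₂ (arr n 5 s) ∧ s ≤ r) ↔
        ∃ s ∈ S', ℓ ≤ m (arr n 5 s) ∧ s ≤ r := by
      constructor
      · rintro ⟨s, hs, h⟩; exact ⟨s, hs, by rwa [← hf₂ s hs]⟩
      · rintro ⟨s, hs, h⟩; exact ⟨s, hs, by rwa [hf₂ s hs]⟩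
    rintro _ m₃ t₃ _ ⟨rfl, ht₃, hcase⟩
    refine ⟨rfl, ?_⟩
    rw [hexists] at hcase
    have hmul : 400 * lev (keyBits n) * (k + 1) =
        400 * lev (keyBits n) * k + 400 * lev (keyBits n) := by ring
    rcases hcase with ⟨hex, rfl⟩ | ⟨hnex, hV₃, hm₃⟩
    · refine ⟨fun a ha => ?_, ⟨S', hV₂, ?_, by omega⟩, fun k' hk' => ?_⟩
      · rw [hF₂ a (by simp only [arr] at *; omega), hframe₁ a ha]
      · rw [candidates_succ, ← hi, ← hℓ, ← hr,
          ← graphOn_remaining_of_contains (candidates_finite n mem k) hgraph hex]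
        ext p
        simp only [graphOn, Set.mem_ofPred_eq]
        exact and_congr_right fun hp => by rw [hf₂ _ hp]
      · have := (hin.sorted.1 k' ⟨hk'.1, hk'.2.trans hk⟩).2
        rw [hF₂ _ (by simp only [arr] at this ⊢; omega), hout₁ k' hk']
    · have hrS' : r ∉ S' := fun hmem => by
        have := (mem_remaining.1 hmem).2
        exact hnex ⟨r, hmem, by omega, le_rfl⟩
      have hm₃' : ∀ a, a < arr n 9 0 → a ≠ arr n 5 r → m₃ a = m₁ a := fun a ha hne => by
        rw [hm₃ a ha, Function.update_of_ne hne, hF₂ a (.inl ha)]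
      refine ⟨fun a ha => ?_, ⟨insert r S', hV₃, ?_, ?_⟩, fun k' hk' => ?_⟩
      · rw [hm₃' a (by simp only [arr] at *; omega) (by simp only [arr] at *; omega), hframe₁ a ha]
      · rw [candidates_succ, ← hi, ← hℓ, ← hr]
        -- The left ends after the insertion. They agree with the array in memory only at keys of
        -- the dictionary, which is all that `graphOn` looks at.
        set g : ℕ → ℕ := fun s => if s = r then ℓ else m (arr n 5 s) with hg
        rw [← graphOn_insert_remaining (g := g) (candidates_finite n mem k) hgraph hnex (if_pos rfl)
          (fun s hs => if_neg hs)]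
        ext p
        simp only [graphOn, Set.mem_ofPred_eq]
        refine and_congr_right fun hp => ?_
        have e : m₃ (arr n 5 p.2) = g p.2 := by
          rcases eq_or_ne p.2 r with e | e
          · rw [e, hm₃ _ (by simp only [arr]; omega), Function.update_self]
            exact (if_pos rfl).symm
          · have hpS := (Finset.mem_insert.1 hp).resolve_left e
            have := hS _ (mem_remaining.1 hpS).1
            rw [hm₃' _ (by simp only [arr]; omega) (by simp only [arr]; omega), hf₁, hg]
            exact (if_neg e).symm
        rw [e]
      · rw [Finset.card_insert_of_notMem hrS']
        have : 140 * lev (keyBits n) * (S'.card + 1) =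
          140 * lev (keyBits n) * S'.card + 140 * lev (keyBits n) := by ring
        omega
      · have := (hin.sorted.1 k' ⟨hk'.1, hk'.2.trans hk⟩).2
        rw [hm₃' _ (by simp only [arr] at this ⊢; omega) (by simp only [arr] at this ⊢; omega),
          hout₁ k' hk']
  unfold processPosition
  refine Wp.readAt hB' (by simp only [regs, arr] at *; omega) ?_
  rw [show (regs n).ord + (k + 1) = arr n 1 (k + 1) from rfl,
    hframe _ (by simp only [arr]; omega), ← hi]
  refine Wp.bind ((vebPred_spec hB (keyBits n) hV (by omega) le_rfl hlb hK).mono ?_)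
  rintro q m' t' d' ⟨rfl, rfl, hq, ht⟩
  refine Wp.eq (Wp.ite (fun h0 => ?_) (fun h0 => ?_))
  · have hv := hin.leftMax_eq hk hgraph (v := 0) (.inl ⟨rfl, by
      rcases hq with hq | ⟨_, _, _, _, _⟩
      · exact hq.2
      · omega⟩)
    refine Wp.writeAt hB' (by simp only [regs, arr] at *; omega) (by omega) ?_
    have := body (t' + 1 + 2) (by omega)
    rw [← hv] at this
    exact this
  · obtain ⟨s, hs, hsr, rfl, hmax⟩ := hq.resolve_left (by omega)
    have hsn := hS s hs
    have hv := hin.leftMax_eq hk hgraph (.inr ⟨s, hs, hsr, rfl, hmax⟩)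
    have hfs := hfval s hs
    refine Wp.sub (by omega) ?_
    rw [Nat.add_sub_cancel]
    refine Wp.readAt hB' (by simp only [regs, arr] at *; omega) ?_
    rw [show (regs n).asc + s = arr n 5 s from rfl]
    refine Wp.writeAt hB' (by simp only [regs, arr] at *; omega) (by omega) ?_
    have := body (t' + 1 + 1 + 2 + 2) (by omega)
    rw [← hv] at this
    exact this

end Loop

/-! ### Setting up the registers, clearing the tree, and the procedure as a whole. -/

section Update

variable {w K n d : ℕ}

theorem findBits_spec {B x : ℕ} (hw : 2 * x < 2 ^ w) (hx : 2 ≤ x) (fuel : ℕ) :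
    ∀ {k t : ℕ} {m : ℕ → ℕ}, k ≤ Nat.clog 2 x → Nat.clog 2 x - k < fuel →
      Wp w B K (findBits fuel x k) m t d fun q m' t' d' =>
        q = Nat.clog 2 x ∧ m' = m ∧ d' = d ∧ t' ≤ t + 2 + 3 * (Nat.clog 2 x - k) := by
  -- Rounding `x` up to a power of two at most doubles it, so the last power that the search
  -- computes still fits in a word.
  have hle : 2 ^ Nat.clog 2 x < 2 ^ w := by
    have h1 := Nat.pow_pred_clog_lt_self (b := 2) (by omega) (x := x) (by omega)
    have h2 := Nat.clog_pos (b := 2) (by omega) hx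
    have h3 : Nat.clog 2 x = (Nat.clog 2 x).pred + 1 := by rw [Nat.pred_eq_sub_one]; omega
    rw [h3, pow_succ]
    omega
  have hclog : Nat.clog 2 x < 2 ^ w := Nat.lt_two_pow_self.trans hle
  induction fuel with
  | zero => intro k t m _ h; omega
  | succ fuel ih =>
    intro k t m hk hfuel
    rw [findBits]
    have hpk : 1 * 2 ^ k < 2 ^ w := by
      rw [one_mul]
      exact (Nat.pow_le_pow_right (by omega) hk).trans_lt hle
    refine Wp.shl hpk (Wp.lt (Wp.ite (fun h => ?_) (fun h => ?_)))
    · have hlt : k < Nat.clog 2 x := by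
        rwa [one_mul, ← Nat.lt_clog_iff_pow_lt (by omega)] at h
      refine Wp.add (by omega) ((ih (by omega) (by omega)).mono ?_)
      rintro q m' t' _ ⟨rfl, rfl, rfl, ht⟩
      exact ⟨rfl, rfl, rfl, by omega⟩
    · have hge : Nat.clog 2 x ≤ k := by
        by_contra! hlt
        rw [Nat.lt_clog_iff_pow_lt (by omega)] at hlt
        omega
      exact Wp.ret ⟨by omega, rfl, rfl, by omega⟩

theorem setup_spec (hB : memBound n + 8 ≤ 2 ^ w) (hn : 1 ≤ n) {m : ℕ → ℕ} {t : ℕ}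
    (h0 : m 0 = n) : Wp w (memBound n) K setup m t d fun e m' t' d' =>
      e = regs n ∧ m' = m ∧ d' = d ∧ t' ≤ t + 20 * n := by
  have hMB : arr n 9 0 ≤ memBound n := Nat.le_add_right _ _
  have hbits := two_le_keyBits hn
  have hpow := two_pow_keyBits_le hn
  have hlt := Nat.lt_two_pow_self (n := keyBits n)
  have hkey : keyBits n ≤ n + 1 := by
    refine Nat.clog_le_of_le_pow ?_
    have := Nat.lt_two_pow_self (n := n)
    have h2 : 2 ≤ 2 ^ n := two_le_two_pow hn
    rw [pow_succ]; omega
  simp only [arr] at hMB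
  unfold setup
  refine Wp.read (by omega) (by omega) ?_
  rw [h0]
  refine Wp.add (by omega) (Wp.add (by omega) (Wp.add (by omega) (Wp.add (by omega)
    (Wp.add (by omega) (Wp.add (by omega) (Wp.add (by omega) (Wp.add (by omega)
    (Wp.add (by omega) (Wp.add (by omega) (Wp.add (by omega) ?_))))))))))
  have h3 : 2 * (n + 3) < 2 ^ w := by omega
  refine Wp.bind ((findBits_spec h3 (by omega) (n + 3) (k := 1)
    (show 1 ≤ keyBits n by omega) (show keyBits n - 1 < n + 3 by omega)).mono ?_)
  rintro q m' t' _ ⟨rfl, rfl, rfl, ht⟩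
  have ht : t' ≤ _ + 2 + 3 * (keyBits n - 1) := ht
  refine Wp.ret ⟨?_, rfl, rfl, by omega⟩
  simp only [regs, arr, Regs.mk.injEq]
  exact ⟨trivial, by omega, by omega, by omega, by omega, by omega, by omega, rfl⟩

theorem clearDict_spec (hB : memBound n + 8 ≤ 2 ^ w) (hn : 1 ≤ n) {m : ℕ → ℕ} {t : ℕ} :
    Wp w (memBound n) K (clearDict (regs n)) m t d fun _ m' t' d' =>
      d' = d ∧ Frame m m' (arr n 9 0) (memBound n) ∧ Veb m' (arr n 9 0) (keyBits n) ∅ ∧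
        t' ≤ t + 100 * n := by
  have hbits := two_le_keyBits hn
  have hpow := two_pow_keyBits_le hn
  have hsz4 := sz_add_four (show 1 ≤ keyBits n by omega)
  have hMB : memBound n = arr n 9 0 + sz (keyBits n) := rfl
  have ha : arr n 9 0 = 4 + 9 * (n + 2) := rfl
  unfold clearDict
  refine Wp.vebSize (show 3 * 2 ^ keyBits n < 2 ^ w by omega) ((Wp.forUp
    (fun k m' t' => Frame m m' (arr n 9 0) (memBound n) ∧ (∀ i < k, m' (arr n 9 i) = 0) ∧
      t' ≤ t + 3 + 4 * k) ?_ ?_).mono ?_)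
  · exact ⟨Frame.refl _ _ _, by omega, by omega⟩
  · rintro k hk m₁ t₁ ⟨hF, hz, ht⟩
    have hk : k < sz (keyBits n) := hk
    refine Wp.tail (Wp.writeAt (by omega) (by simp only [regs]; omega) (by omega)
      (Wp.ret ⟨rfl, hF.update (by simp only [regs]; omega) (by simp only [regs]; omega), ?_,
        by omega⟩))
    intro i hi
    simp only [regs, zero_add, arr_add]
    rcases eq_or_ne i k with rfl | hne
    · exact Function.update_self _ _ _
    · rw [Function.update_of_ne (by simp only [arr]; omega), hz i (by omega)]
  · rintro _ m' t' _ ⟨rfl, hF, hz, ht⟩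
    have ht : t' ≤ t + 3 + 4 * sz (keyBits n) := ht
    refine ⟨rfl, hF, veb_empty_of_zero (by omega) fun a ha1 ha2 => ?_, by omega⟩
    obtain ⟨i, rfl⟩ := Nat.exists_eq_add_of_le ha1
    exact hz i (by simp only [regs]; omega)

/-- UPDATE-LEFT-MAX for a node with a left child. -/
theorem updateLeftMaxRounds_spec (hB : memBound n + 8 ≤ 2 ^ w) (hn : 1 ≤ n)
    (hK : d + lev (keyBits n) ≤ K) {T mem : ℕ → ℕ} (hin : LoopInput T n mem) (h0 : mem 0 = n)
    (h1 : mem 1 ≠ 0) {r t : ℕ} (hr : r ≤ n) :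
    Wp w (memBound n) K (updateLeftMaxRounds r) mem t d fun _ m' t' _ =>
      dictionary n m' = minimalIntervals (candidates n mem r) ∧
      (∀ k ∈ Set.Icc 1 r, m' (arr n 4 (mem (arr n 1 k))) =
        leftMax T (fun j => mem (arr n 2 j)) (fun j => mem (arr n 3 j)) (mem (arr n 1 k))) ∧
      t' ≤ t + 600 * (n * lev (keyBits n)) := by
  have hMB : arr n 9 0 ≤ memBound n := Nat.le_add_right _ _
  have ha : arr n 9 0 = 4 + 9 * (n + 2) := rfl
  have hlev := lev_pos (keyBits n)
  unfold updateLeftMaxRounds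
  refine Wp.bind ((setup_spec hB hn h0).mono ?_)
  rintro _ _ t₁ _ ⟨rfl, rfl, rfl, ht₁⟩
  refine Wp.read (by omega) (by omega) (Wp.eq (Wp.ite_neg h1 (Wp.bind
    ((clearDict_spec hB hn).mono ?_))))
  rintro _ m₂ t₂ _ ⟨rfl, hF, hV, ht₂⟩
  refine (Wp.forUp (LoopInv T n _ (t₂ + 1)) ?_
    fun k hk m t hI => processPosition_spec hB hn hK hin (by omega) hI).mono ?_
  · refine ⟨fun a ha' => hF a (by simp only [arr] at *; omega), ⟨∅, by simpa using hV, ?_, by simp⟩,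
      fun k' hk' => ?_⟩
    · rw [candidates_zero]
      ext p
      simp [graphOn, minimalIntervals]
    · have := hk'.1
      have := hk'.2
      omega
  · rintro _ m' t' _ ⟨rfl, hframe, ⟨S, hV', hgraph, ht⟩, hout⟩
    refine ⟨?_, hout, ?_⟩
    · rw [← hgraph]
      ext p
      simp only [dictionary, graphOn, Set.mem_ofPred_eq]
      rw [show Nat.clog 2 (n + 3) = keyBits n from rfl, hV'.vebSet_eq, Finset.mem_coe]
    · have e1 : 400 * lev (keyBits n) * r ≤ 400 * lev (keyBits n) * n := Nat.mul_le_mul_left _ hr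
      have e2 : 400 * lev (keyBits n) * n = 400 * (n * lev (keyBits n)) := by ring
      have e3 : n * 1 ≤ n * lev (keyBits n) := Nat.mul_le_mul_left _ hlev
      omega

/-- UPDATE-LEFT-MAX for a node without a left child. -/
theorem updateLeftMaxRounds_spec_of_nil (hB : memBound n + 8 ≤ 2 ^ w) (hn : 1 ≤ n)
    {mem : ℕ → ℕ} (h0 : mem 0 = n) (h1 : mem 1 = 0) {t : ℕ} :
    Wp w (memBound n) K (updateLeftMaxRounds n) mem t d fun _ m' t' _ =>
      (∀ i ∈ Set.Icc 1 n, m' (arr n 4 i) = i) ∧ t' ≤ t + 600 * (n * lev (keyBits n)) := by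
  have hMB : arr n 9 0 ≤ memBound n := Nat.le_add_right _ _
  have ha : arr n 9 0 = 4 + 9 * (n + 2) := rfl
  have hlev := lev_pos (keyBits n)
  unfold updateLeftMaxRounds
  refine Wp.bind ((setup_spec hB hn h0).mono ?_)
  rintro _ _ t₁ _ ⟨rfl, rfl, rfl, ht₁⟩
  refine Wp.read (by omega) (by omega) (Wp.eq (Wp.ite_pos h1 ((Wp.forUp
    (fun k m' t' => (∀ i ∈ Set.Icc 1 k, m' (arr n 4 i) = i) ∧ t' ≤ t₁ + 3 + 4 * k) ?_ ?_).mono ?_)))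
  · refine ⟨fun i hi => ?_, by omega⟩
    have := hi.1
    have := hi.2
    omega
  · rintro k hk m t ⟨hI, ht⟩
    refine Wp.tail (Wp.writeAt (by omega) (by simp only [regs, arr] at *; omega) (by omega)
      (Wp.ret ⟨rfl, fun i hi => ?_, by omega⟩))
    rw [show (regs n).lv + (1 + k) = arr n 4 (1 + k) from rfl]
    rcases eq_or_ne i (1 + k) with rfl | hne
    · exact Function.update_self _ _ _
    · have h1 := hi.1
      have h2 := hi.2
      rw [Function.update_of_ne (by simp only [arr]; omega), hI i ⟨h1, by omega⟩]
  · rintro _ m' t' _ ⟨rfl, hI, ht⟩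
    have e3 : n * 1 ≤ n * lev (keyBits n) := Nat.mul_le_mul_left _ hlev
    exact ⟨hI, by omega⟩

/-- UPDATE-LEFT-MAX with the list of positions given. -/
theorem updateLeftMax_spec (hB : memBound n + 8 ≤ 2 ^ w) (hn : 1 ≤ n)
    (hK : d + lev (keyBits n) ≤ K) {T mem : ℕ → ℕ}
    (hin : mem 1 ≠ 0 → LoopInput T n mem) (h0 : mem 0 = n) {t : ℕ} :
    Wp w (memBound n) K updateLeftMax mem t d fun _ m' t' _ =>
      (mem 1 = 0 → ∀ i ∈ Set.Icc 1 n, m' (arr n 4 i) = i) ∧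
      (mem 1 ≠ 0 → ∀ i ∈ Set.Icc 1 n, m' (arr n 4 i) =
        leftMax T (fun j => mem (arr n 2 j)) (fun j => mem (arr n 3 j)) i) ∧
      t' ≤ t + 700 * (n * lev (keyBits n)) := by
  have hMB : arr n 9 0 ≤ memBound n := Nat.le_add_right _ _
  have ha : arr n 9 0 = 4 + 9 * (n + 2) := rfl
  have e3 : n * 1 ≤ n * lev (keyBits n) := Nat.mul_le_mul_left _ (lev_pos _)
  unfold updateLeftMax
  refine Wp.read (by omega) (by omega) ?_
  rw [h0]
  by_cases h1 : mem 1 = 0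
  · refine (updateLeftMaxRounds_spec_of_nil hB hn h0 h1).mono ?_
    rintro _ m' t' _ ⟨h, ht⟩
    exact ⟨fun _ => h, fun h => absurd h1 h, by omega⟩
  · refine (updateLeftMaxRounds_spec hB hn hK (hin h1) h0 h1 le_rfl).mono ?_
    rintro _ m' t' _ ⟨-, h, ht⟩
    refine ⟨fun h => absurd h h1, fun _ i hi => ?_, by omega⟩
    obtain ⟨k, hk, rfl⟩ := (hin h1).surj hi
    exact h k hk

end Update

/-! ## Radix sort -/

/-- The cells from `b` on hold the members of the list. -/
def Seg (m : ℕ → ℕ) : ℕ → List ℕ → Prop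
  | _, [] => True
  | b, x :: l => m b = x ∧ Seg m (b + 1) l

theorem seg_append {m : ℕ → ℕ} {l₁ l₂ : List ℕ} : ∀ {b : ℕ},
    Seg m b (l₁ ++ l₂) ↔ Seg m b l₁ ∧ Seg m (b + l₁.length) l₂ := by
  induction l₁ with
  | nil => intro b; simp [Seg]
  | cons x l ih =>
    intro b
    simp only [List.cons_append, Seg, ih, List.length_cons, and_assoc]
    rw [show b + 1 + l.length = b + (l.length + 1) by omega]

theorem Seg.congr {m m' : ℕ → ℕ} {l : List ℕ} : ∀ {b : ℕ}, Seg m b l →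
    (∀ a, b ≤ a → a < b + l.length → m' a = m a) → Seg m' b l := by
  induction l with
  | nil => intro b _ _; trivial
  | cons x l ih =>
    intro b h hm
    rw [List.length_cons] at hm
    exact ⟨by rw [hm b le_rfl (by omega)]; exact h.1,
      ih h.2 fun a ha1 ha2 => hm a (by omega) (by omega)⟩

theorem Seg.getElem {m : ℕ → ℕ} {l : List ℕ} : ∀ {b k : ℕ}, Seg m b l → (hk : k < l.length) →
    m (b + k) = l[k] := by
  induction l with
  | nil => intro b k _ hk; simp at hk
  | cons x l ih =>
    intro b k h hk
    cases k with
    | zero => exact h.1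
    | succ k =>
      rw [List.getElem_cons_succ, ← ih h.2 (by simpa using hk)]
      congr 1; omega

/-- The linked list that starts at `i`, with the successors of its members in an array at `nx`. -/
inductive Linked (m : ℕ → ℕ) (nx : ℕ) : ℕ → List ℕ → Prop
  | nil : Linked m nx 0 []
  | cons {i : ℕ} {l : List ℕ} (hi : i ≠ 0) (h : Linked m nx (m (nx + i)) l) :
      Linked m nx i (i :: l)

theorem Linked.congr {m m' : ℕ → ℕ} {nx i : ℕ} {l : List ℕ} (h : Linked m nx i l)
    (hm : ∀ x ∈ l, m' (nx + x) = m (nx + x)) : Linked m' nx i l := by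
  induction h with
  | nil => exact .nil
  | @cons i l hi h ih =>
    refine .cons hi ?_
    rw [hm i (by simp)]
    exact ih fun x hx => hm x (by simp [hx])

/-! ### The passes of the radix sort on the machine. -/

section Passes

variable {w K n d : ℕ}

theorem collect_spec (hB : memBound n + 8 ≤ 2 ^ w) (fuel : ℕ) :
    ∀ {i t : ℕ} {m : ℕ → ℕ} {l : List ℕ}, Linked m (arr n 7 0) i l → (∀ x ∈ l, x ≤ n) →
      1 ≤ m 3 → m 3 + l.length ≤ n + 1 → l.length < fuel →
      Wp w (memBound n) K (collect fuel (arr n 1 0) (arr n 7 0) i) m t d fun _ m' t' d' =>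
        d' = d ∧ m' 3 = m 3 + l.length ∧ Seg m' (arr n 1 (m 3)) l ∧
        (∀ a, a ≠ 3 → a < arr n 1 (m 3) ∨ arr n 1 (m 3 + l.length) ≤ a → m' a = m a) ∧
        t' ≤ t + 1 + 8 * l.length := by
  have hMB : arr n 9 0 ≤ memBound n := Nat.le_add_right _ _
  simp only [arr] at hMB
  induction fuel with
  | zero => intro i t m l _ _ _ _ h; omega
  | succ fuel ih =>
    intro i t m l hl hn hpos hlen hfuel
    rw [collect]
    cases hl with
    | nil =>
      exact Wp.eq (Wp.ite_pos rfl (Wp.ret ⟨rfl, rfl, trivial, fun _ _ _ => rfl, by omega⟩))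
    | @cons i l hi h =>
      rw [List.length_cons] at *
      have hin := hn i (by simp)
      refine Wp.eq (Wp.ite_neg hi (Wp.read (by omega) (by omega) (Wp.writeAt (by omega)
        (by simp only [arr]; omega) (by omega) (Wp.add (by omega) (Wp.write (by omega) (by omega)
        (by omega) (Wp.readAt (by omega) (by simp only [arr]; omega) ?_))))))
      rw [arr_add]
      set m₁ := Function.update (Function.update m (arr n 1 (m 3)) i) 3 (m 3 + 1) with hm₁
      have h3 : m₁ 3 = m 3 + 1 := Function.update_self _ _ _
      have hne : ∀ a, a ≠ 3 → a ≠ arr n 1 (m 3) → m₁ a = m a := fun a h1 h2 => by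
        rw [hm₁, Function.update_of_ne h1, Function.update_of_ne h2]
      have hnx : ∀ x, x ≤ n → m₁ (arr n 7 0 + x) = m (arr n 7 0 + x) := fun x hx =>
        hne _ (by simp only [arr]; omega) (by simp only [arr]; omega)
      rw [hnx i hin]
      refine (ih (h.congr fun x hx => hnx x (hn x (by simp [hx]))) (fun x hx => hn x (by simp [hx]))
        (by omega) (by omega) (by omega)).mono ?_
      rintro _ m' t' _ ⟨rfl, g3, hseg, hfr, ht⟩
      rw [h3] at g3 hseg hfr
      refine ⟨rfl, by omega, ⟨?_, hseg⟩, fun a ha hor => ?_, by omega⟩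
      · rw [hfr _ (by simp only [arr]; omega) (.inl (by simp only [arr]; omega)), hm₁,
          Function.update_of_ne (by simp only [arr]; omega), Function.update_self]
      · rw [hfr a ha (by simp only [arr] at *; omega), hne a ha (by simp only [arr] at *; omega)]

/-- The concatenation of the first `k` of the buckets, which are taken in decreasing order of
their digits. -/
def buckets (O : List ℕ) (dig : ℕ → ℕ) (N k : ℕ) : List ℕ :=
  (List.range k).flatMap fun i => O.filter fun x => dig x = N - 1 - i

theorem buckets_succ (O : List ℕ) (dig : ℕ → ℕ) (N k : ℕ) : buckets O dig N (k + 1) =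
    buckets O dig N k ++ O.filter fun x => dig x = N - 1 - k := by
  simp [buckets, List.range_succ, List.flatMap_append]

theorem buckets_perm (O : List ℕ) (dig : ℕ → ℕ) {N : ℕ} (hdig : ∀ x ∈ O, dig x < N) {k : ℕ}
    (hk : k ≤ N) : (buckets O dig N k).Perm (O.filter fun x => N - k ≤ dig x) := by
  induction k with
  | zero =>
    have : O.filter (fun x => N - 0 ≤ dig x) = [] := by
      rw [List.filter_eq_nil_iff]
      intro x hx
      have := hdig x hx
      simp only [decide_eq_true_eq]
      omega
    rw [this]
    simp [buckets]
  | succ k ih =>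
    rw [buckets_succ]
    have hp := List.filter_append_perm (fun x => decide (N - k ≤ dig x))
      (O.filter fun x => N - (k + 1) ≤ dig x)
    rw [List.filter_filter, List.filter_filter] at hp
    have e1 : O.filter (fun x => decide (N - k ≤ dig x) && decide (N - (k + 1) ≤ dig x)) =
        O.filter fun x => decide (N - k ≤ dig x) := by
      refine List.filter_congr fun x _ => ?_
      by_cases h : N - k ≤ dig x
      · simp [h, show N - (k + 1) ≤ dig x by omega]
      · simp [h]
    have e2 : O.filter (fun x => (!decide (N - k ≤ dig x)) && decide (N - (k + 1) ≤ dig x)) =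
        O.filter fun x => decide (dig x = N - 1 - k) := by
      refine List.filter_congr fun x _ => ?_
      rw [← decide_not, ← Bool.decide_and]
      refine decide_eq_decide.2 ?_
      omega
    rw [e1, e2] at hp
    exact ((ih (by omega)).append_right _).trans hp

theorem buckets_length_le (O : List ℕ) (dig : ℕ → ℕ) {N : ℕ} (hdig : ∀ x ∈ O, dig x < N) {k : ℕ}
    (hk : k ≤ N) : (buckets O dig N k).length ≤ O.length := by
  rw [(buckets_perm O dig hdig hk).length_eq]
  exact List.length_filter_le _ _

theorem buckets_perm_self (O : List ℕ) (dig : ℕ → ℕ) {N : ℕ} (hdig : ∀ x ∈ O, dig x < N) :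
    (buckets O dig N N).Perm O := by
  have h := buckets_perm O dig hdig le_rfl
  rwa [List.filter_eq_self.2 (by simp)] at h

/-- This is the step of least-significant-digit sorting. Modulo `M * N` a number is its part modulo
`M` plus `M` times the new digit. Between buckets the digit outweighs the lower part; within a
bucket the order of `O` is preserved, and it sorts by the lower part. -/
theorem buckets_pairwise {O : List ℕ} {dig T : ℕ → ℕ} {N M : ℕ}
    (hO : O.Pairwise fun i j => T j % M ≤ T i % M) (hdig : ∀ x ∈ O, dig x = T x / M % N) :
    (buckets O dig N N).Pairwise fun i j => T j % (M * N) ≤ T i % (M * N) := by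
  unfold buckets
  rw [List.pairwise_flatMap]
  constructor
  · intro a _
    refine List.Pairwise.imp_of_mem ?_ (hO.filter _)
    intro i j hi hj hij
    rw [List.mem_filter, decide_eq_true_eq] at hi hj
    rw [Nat.mod_mul, Nat.mod_mul, ← hdig i hi.1, ← hdig j hj.1, hi.2, hj.2]
    omega
  · refine List.Pairwise.imp_of_mem ?_ List.pairwise_lt_range
    intro a b ha hb hab x hx y hy
    rw [List.mem_range] at ha hb
    rw [List.mem_filter, decide_eq_true_eq] at hx hy
    rw [Nat.mod_mul, Nat.mod_mul, ← hdig x hx.1, ← hdig y hy.1]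
    -- For `M = 0` division by zero makes all digits `0`, so there are no two different nonempty
    -- buckets.
    rcases Nat.eq_zero_or_pos M with rfl | hM
    · have ex := hdig x hx.1
      have ey := hdig y hy.1
      rw [Nat.div_zero, Nat.zero_mod] at ex ey
      omega
    · have h1 : T y % M < M := Nat.mod_lt _ hM
      have h2 : M * (dig y + 1) ≤ M * dig x := Nat.mul_le_mul_left _ (by omega)
      rw [mul_add, mul_one] at h2
      omega

/-- What `p` passes of the radix sort have done. -/
structure PassInv (T : ℕ → ℕ) (n : ℕ) (mem : ℕ → ℕ) (p : ℕ) (m : ℕ → ℕ) (O : List ℕ) : Prop where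
  perm : O.Perm (List.range' 1 n)
  seg : Seg m (arr n 1 1) O
  pairwise : O.Pairwise fun i j => T j % (n + 2) ^ p ≤ T i % (n + 2) ^ p
  quot : ∀ x ∈ O, m (arr n 8 x) = T x / (n + 2) ^ p
  frame : ∀ a, a < 2 ∨ arr n 2 0 ≤ a ∧ a < arr n 4 0 → m a = mem a

theorem PassInv.mem_iff {T mem m : ℕ → ℕ} {p : ℕ} {O : List ℕ} (h : PassInv T n mem p m O)
    {x : ℕ} : x ∈ O ↔ 1 ≤ x ∧ x ≤ n := by
  rw [h.perm.mem_iff, List.mem_range'_1]; omega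

theorem PassInv.length_eq {T mem m : ℕ → ℕ} {p : ℕ} {O : List ℕ} (h : PassInv T n mem p m O) :
    O.length = n := by
  rw [h.perm.length_eq, List.length_range']

theorem PassInv.nodup {T mem m : ℕ → ℕ} {p : ℕ} {O : List ℕ} (h : PassInv T n mem p m O) :
    O.Nodup := h.perm.nodup_iff.2 List.nodup_range'

/-- The state of a distribution pass after the positions in `O₂` have been moved. -/
structure DistInv (n : ℕ) (m₀ : ℕ → ℕ) (O₁ O₂ : List ℕ) (m : ℕ → ℕ) : Prop where
  linked : ∀ c < n + 2, Linked m (arr n 7 0) (m (arr n 6 c))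
    (O₂.filter fun x => m₀ (arr n 8 x) % (n + 2) = c)
  todo : ∀ x ∈ O₁, m (arr n 8 x) = m₀ (arr n 8 x)
  done : ∀ x ∈ O₂, m (arr n 8 x) = m₀ (arr n 8 x) / (n + 2)
  more : m 2 = 0 ↔ ∀ x ∈ O₂, m₀ (arr n 8 x) / (n + 2) = 0
  frame : ∀ a, a ≠ 2 → a < arr n 6 0 → m a = m₀ a

/-- The list is traversed from its end and each position is put in front of its bucket, so every
bucket finally has the order of `O`. This is what makes the pass stable. `O₂` is the suffix already
moved. -/
theorem distribute_spec (hB : memBound n + 8 ≤ 2 ^ w) (hn : 1 ≤ n) {m₀ m : ℕ → ℕ} {t : ℕ}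
    {O : List ℕ}
    (hO : ∀ x ∈ O, 1 ≤ x ∧ x ≤ n) (hlen : O.length = n) (hnd : O.Nodup)
    (hseg : Seg m₀ (arr n 1 1) O) (hq : ∀ x ∈ O, m₀ (arr n 8 x) < 2 ^ w)
    (hI : DistInv n m₀ O [] m) :
    Wp w (memBound n) K (forUp 0 n (fun k => do
      let k' ← sub n k
      let i ← readAt (arr n 1 0) k'
      let q ← readAt (arr n 8 0) i
      let d ← mod q (n + 2)
      let q' ← div q (n + 2)
      writeAt (arr n 8 0) i q'
      if ← lt 0 q' then
        write 2 1
      let h ← readAt (arr n 6 0) d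
      writeAt (arr n 7 0) i h
      writeAt (arr n 6 0) d i)) m t d fun _ m' t' d' =>
        d' = d ∧ DistInv n m₀ [] O m' ∧ t' ≤ t + 1 + 30 * n := by
  have hMB : arr n 9 0 ≤ memBound n := Nat.le_add_right _ _
  simp only [arr] at hMB
  refine (Wp.forUp (fun k m' t' => ∃ O₁ O₂, O = O₁ ++ O₂ ∧ O₂.length = k ∧
    DistInv n m₀ O₁ O₂ m' ∧ t' ≤ t + 1 + 30 * k) ⟨O, [], by simp, rfl, hI, by omega⟩ ?_).mono ?_
  swap
  · rintro _ m' t' _ ⟨rfl, O₁, O₂, rfl, hl, hI', ht⟩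
    rw [List.length_append] at hlen
    obtain rfl := List.length_eq_zero_iff.1 (show O₁.length = 0 by omega)
    exact ⟨rfl, hI', ht⟩
  rintro k hk m₁ t₁ ⟨O₁', O₂, rfl, hl, hI₁, ht₁⟩
  rw [List.length_append] at hlen
  obtain ⟨O₁, x, rfl⟩ : ∃ O₁ x, O₁' = O₁ ++ [x] :=
    ⟨_, _, (List.dropLast_append_getLast (l := O₁') (by
      rintro rfl; rw [List.length_nil] at hlen; omega)).symm⟩
  rw [List.length_append, List.length_singleton] at hlen
  have hxm : x ∈ O₁ ++ [x] ++ O₂ := by simp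
  have hx := hO x hxm
  have hqx := hq x hxm
  have hord : m₁ (arr n 1 (n - k)) = x := by
    rw [hI₁.frame _ (by simp only [arr]; omega) (by simp only [arr]; omega)]
    rw [seg_append, seg_append] at hseg
    rw [← hseg.1.2.1]
    congr 1
    simp only [arr]; omega
  rw [List.nodup_append, List.nodup_append] at hnd
  have hx1 : ∀ y ∈ O₁, y ≠ x := fun y hy => hnd.1.2.2 y hy x (by simp)
  have hx2 : ∀ y ∈ O₂, y ≠ x := fun y hy => (hnd.2.2 x (by simp) y hy).symm
  have hO₂ : ∀ y ∈ O₂, y ≤ n := fun y hy => (hO y (by simp [hy])).2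
  have hO₁ : ∀ y ∈ O₁, y ≤ n := fun y hy => (hO y (by simp [hy])).2
  set q := m₀ (arr n 8 x) with hqdef
  have hmod : q % (n + 2) < n + 2 := Nat.mod_lt _ (by omega)
  have hdiv : q / (n + 2) ≤ q := Nat.div_le_self _ _
  have final : ∀ v t₂, t₂ ≤ t₁ + 20 → (v = 0 ↔ m₁ 2 = 0 ∧ q / (n + 2) = 0) →
      Wp w (memBound n) K (do
        let h ← readAt (arr n 6 0) (q % (n + 2))
        writeAt (arr n 7 0) x h
        writeAt (arr n 6 0) (q % (n + 2)) x)
        (Function.update (Function.update m₁ (arr n 8 x) (q / (n + 2))) 2 v) t₂ d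
        fun _ m' t' d' => d' = d ∧ ∃ O₁' O₂', O₁ ++ [x] ++ O₂ = O₁' ++ O₂' ∧ O₂'.length = k + 1 ∧
          DistInv n m₀ O₁' O₂' m' ∧ t' ≤ t + 1 + 30 * (k + 1) := by
    intro v t₂ ht₂ hv
    set m₂ := Function.update (Function.update m₁ (arr n 8 x) (q / (n + 2))) 2 v with hm₂
    have hne₂ : ∀ a, a ≠ 2 → a ≠ arr n 8 x → m₂ a = m₁ a := fun a h1 h2 => by
      rw [hm₂, Function.update_of_ne h1, Function.update_of_ne h2]
    have hlk := hI₁.linked (q % (n + 2)) hmod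
    have hhead : m₁ (arr n 6 (q % (n + 2))) ≤ n := by
      generalize hl' : O₂.filter (fun x => m₀ (arr n 8 x) % (n + 2) = q % (n + 2)) = l' at hlk
      generalize hi' : m₁ (arr n 6 (q % (n + 2))) = i' at hlk
      cases hlk with
      | nil => omega
      | cons _ _ =>
        have : i' ∈ O₂ := List.mem_of_mem_filter (hl' ▸ List.mem_cons_self)
        exact hO₂ _ this
    refine Wp.readAt (by omega) (by simp only [arr]; omega) ?_
    rw [arr_add, hne₂ _ (by simp only [arr]; omega) (by simp only [arr]; omega)]
    refine Wp.writeAt (by omega) (by simp only [arr]; omega) (by omega) (Wp.tail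
      (Wp.writeAt (by omega) (by simp only [arr]; omega) (by omega) (Wp.ret ?_)))
    rw [arr_add, arr_add]
    set m₃ := Function.update (Function.update m₂ (arr n 7 x) (m₁ (arr n 6 (q % (n + 2)))))
      (arr n 6 (q % (n + 2))) x with hm₃
    have hne₃ : ∀ a, a ≠ arr n 7 x → a ≠ arr n 6 (q % (n + 2)) → m₃ a = m₂ a := fun a h1 h2 => by
      rw [hm₃, Function.update_of_ne h2, Function.update_of_ne h1]
    refine ⟨rfl, O₁, x :: O₂, by simp, by simp [hl], ⟨fun c hc => ?_, fun y hy => ?_, fun y hy => ?_,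
      ?_, fun a ha1 ha2 => ?_⟩, by omega⟩
    · have hold : Linked m₃ (arr n 7 0) (m₁ (arr n 6 c))
          (O₂.filter fun x => m₀ (arr n 8 x) % (n + 2) = c) := by
        refine (hI₁.linked c hc).congr fun y hy => ?_
        have hy' := List.mem_of_mem_filter hy
        have := hx2 y hy'
        have := hO₂ y hy'
        rw [hne₃ _ (by simp only [arr]; omega) (by simp only [arr]; omega),
          hne₂ _ (by simp only [arr]; omega) (by simp only [arr]; omega)]
      by_cases hcq : q % (n + 2) = c
      · rw [List.filter_cons_of_pos (by simpa using hcq), ← hcq, hm₃, Function.update_self]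
        refine .cons (by omega) ?_
        rw [arr_add, Function.update_of_ne (by simp only [arr]; omega), Function.update_self, ← hm₃,
          hcq]
        exact hold
      · rw [List.filter_cons_of_neg (by simpa using hcq),
          hne₃ _ (by simp only [arr]; omega) (by simp only [arr]; omega),
          hne₂ _ (by simp only [arr]; omega) (by simp only [arr]; omega)]
        exact hold
    · have := hx1 y hy
      have := hO₁ y hy
      rw [hne₃ _ (by simp only [arr]; omega) (by simp only [arr]; omega),
        hne₂ _ (by simp only [arr]; omega) (by simp only [arr]; omega), hI₁.todo y (by simp [hy])]
    · rcases List.mem_cons.1 hy with rfl | hy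
      · rw [hne₃ _ (by simp only [arr]; omega) (by simp only [arr]; omega), hm₂,
          Function.update_of_ne (by simp only [arr]; omega), Function.update_self]
      · have := hx2 y hy
        have := hO₂ y hy
        rw [hne₃ _ (by simp only [arr]; omega) (by simp only [arr]; omega),
          hne₂ _ (by simp only [arr]; omega) (by simp only [arr]; omega), hI₁.done y hy]
    · rw [hne₃ _ (by simp only [arr]; omega) (by simp only [arr]; omega), hm₂, Function.update_self,
        hv, hI₁.more, List.forall_mem_cons, and_comm]
    · rw [hne₃ _ (by simp only [arr] at *; omega) (by simp only [arr] at *; omega),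
        hne₂ _ ha1 (by simp only [arr] at *; omega), hI₁.frame a ha1 ha2]
  rw [zero_add]
  refine Wp.sub (by omega) (Wp.readAt (by omega) (by simp only [arr]; omega) ?_)
  rw [arr_add, hord]
  refine Wp.readAt (by omega) (by simp only [arr]; omega) ?_
  rw [arr_add, hI₁.todo x (by simp), ← hqdef]
  refine Wp.mod (by omega) (Wp.div (hdiv.trans_lt hqx) (Wp.writeAt (by omega)
    (by simp only [arr]; omega) (hdiv.trans_lt hqx) (Wp.lt (Wp.ite (fun h0 => ?_) (fun h0 => ?_)))))
  · refine Wp.write (by omega) (by omega) (by omega) ?_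
    exact final 1 _ (by omega) (by omega)
  -- Cell `2` is not written in this branch. Writing back the value it holds brings the branch under
  -- `final`.
  · have := final (m₁ 2) _ (show t₁ + 2 + 1 + 2 + 2 + 1 + 1 + 2 + 1 ≤ t₁ + 20 by omega)
      (by rw [and_iff_left (Nat.eq_zero_of_not_pos h0)])
    have e : Function.update (Function.update m₁ (arr n 8 x) (q / (n + 2))) 2 (m₁ 2) =
        Function.update m₁ (arr n 8 x) (q / (n + 2)) := by
      have h2 : m₁ 2 = Function.update m₁ (arr n 8 x) (q / (n + 2)) 2 :=
        (Function.update_of_ne (by simp only [arr]; omega) _ _).symm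
      rw [h2, Function.update_eq_self]
    rw [e] at this
    exact this

/-- Collecting writes only to the order and to cell `3`, so the heads and links of the buckets still
to come stay intact. -/
theorem gather_spec (hB : memBound n + 8 ≤ 2 ^ w) (hn : 1 ≤ n) {m : ℕ → ℕ} {t : ℕ} {O : List ℕ}
    {dig : ℕ → ℕ} (hO : ∀ x ∈ O, x ≤ n) (hlen : O.length = n) (hdig : ∀ x ∈ O, dig x < n + 2)
    (hlk : ∀ c < n + 2, Linked m (arr n 7 0) (m (arr n 6 c)) (O.filter fun x => dig x = c))
    (h3 : m 3 = 1) :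
    Wp w (memBound n) K (forUp 1 (n + 2) (fun k => do
      let d ← sub (n + 2) k
      let i ← readAt (arr n 6 0) d
      collect (n + 1) (arr n 1 0) (arr n 7 0) i)) m t d fun _ m' t' d' =>
        d' = d ∧ Seg m' (arr n 1 1) (buckets O dig (n + 2) (n + 2)) ∧
        (∀ a, a ≠ 3 → a < arr n 1 0 ∨ arr n 2 0 ≤ a → m' a = m a) ∧ t' ≤ t + 40 * n := by
  have hMB : arr n 9 0 ≤ memBound n := Nat.le_add_right _ _
  simp only [arr] at hMB
  refine (Wp.forUp (fun k m' t' => k ≤ n + 2 → m' 3 = 1 + (buckets O dig (n + 2) k).length ∧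
    Seg m' (arr n 1 1) (buckets O dig (n + 2) k) ∧
    (∀ a, a ≠ 3 → a < arr n 1 0 ∨ arr n 2 0 ≤ a → m' a = m a) ∧
    t' ≤ t + 1 + 8 * (buckets O dig (n + 2) k).length + 6 * k) ?_ ?_).mono ?_
  · exact fun _ => ⟨h3, trivial, fun _ _ _ => rfl, by simp⟩
  · intro k hk m₁ t₁ hI
    obtain ⟨hpos, hseg, hfr, ht⟩ := hI hk.le
    have hble := buckets_length_le O dig hdig (show k + 1 ≤ n + 2 from hk)
    rw [hlen, buckets_succ, List.length_append] at hble
    have hc : n + 2 - (1 + k) = n + 2 - 1 - k := by omega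
    refine Wp.sub (by omega) (Wp.readAt (by omega) (by simp only [arr]; omega) ?_)
    rw [arr_add, hc, hfr _ (by simp only [arr]; omega) (.inr (by simp only [arr]; omega))]
    have hlk₁ : Linked m₁ (arr n 7 0) (m (arr n 6 (n + 2 - 1 - k)))
        (O.filter fun x => dig x = n + 2 - 1 - k) := by
      refine (hlk _ (by omega)).congr fun x hx => ?_
      have := hO x (List.mem_of_mem_filter hx)
      exact hfr _ (by simp only [arr]; omega) (.inr (by simp only [arr]; omega))
    refine (collect_spec hB (n + 1) hlk₁ (fun x hx => hO x (List.mem_of_mem_filter hx)) (by omega)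
      (by omega) (by omega)).mono ?_
    rintro _ m' t' _ ⟨rfl, g3, gseg, gfr, gt⟩
    refine ⟨rfl, fun _ => ?_⟩
    rw [buckets_succ, List.length_append, seg_append]
    have epos : arr n 1 (m₁ 3) = arr n 1 1 + (buckets O dig (n + 2) k).length := by
      rw [hpos]; simp only [arr]; omega
    refine ⟨by omega, ⟨hseg.congr fun a ha1 ha2 => ?_, by rwa [← epos]⟩, fun a ha1 ha2 => ?_,
      by omega⟩
    · exact gfr a (by simp only [arr] at *; omega) (.inl (by omega))
    · rw [gfr a ha1 (by simp only [arr] at *; omega), hfr a ha1 ha2]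
  · rintro _ m' t' _ ⟨rfl, hI⟩
    obtain ⟨-, hseg, hfr, ht⟩ := hI le_rfl
    have hble := buckets_length_le O dig hdig (le_refl (n + 2))
    exact ⟨rfl, hseg, hfr, by omega⟩

/-- Another pass after the first `p + 1` requires a character `T x ≥ (n + 2) ^ (p + 1)`. Together
with `T x < 2 ^ w` this gives `p + 1 < w`, so fuel `w` suffices; together with `T x ≤ n ^ D` it
gives `p + 1 ≤ D`, so there are at most `D + 1` passes. When the loop stops, all characters are
below the current modulus and the order modulo it is the true order. -/
theorem radixLoop_spec (hB : memBound n + 8 ≤ 2 ^ w) (hn : 1 ≤ n) {T mem : ℕ → ℕ} {D : ℕ}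
    (hTw : ∀ i ∈ Set.Icc 1 n, T i < 2 ^ w) (hTD : ∀ i ∈ Set.Icc 1 n, T i ≤ n ^ D) (fuel : ℕ) :
    ∀ {p t : ℕ} {m : ℕ → ℕ} {O : List ℕ}, PassInv T n mem p m O → p < w → p ≤ D → fuel = w - p →
      Wp w (memBound n) K (radixLoop fuel n (n + 2) (arr n 1 0) (arr n 6 0) (arr n 7 0) (arr n 8 0))
        m t d fun _ m' t' d' => d' = d ∧
          (∃ p' O', PassInv T n mem p' m' O' ∧ ∀ x ∈ O', T x < (n + 2) ^ p') ∧
          t' ≤ t + 200 * n * (D + 1 - p) := by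
  have hMB : arr n 9 0 ≤ memBound n := Nat.le_add_right _ _
  simp only [arr] at hMB
  induction fuel with
  | zero => intro p t m O _ h1 _ h2; omega
  | succ fuel ih =>
    intro p t m O hI hpw hpD hfuel
    rw [radixLoop]
    refine Wp.tick (Wp.write (by omega) (by omega) (by omega) (Wp.write (by omega) (by omega)
      (by omega) ?_))
    set m₀ := Function.update (Function.update m 2 0) 3 1 with hm₀
    have hOn : ∀ x ∈ O, 1 ≤ x ∧ x ≤ n := fun x hx => hI.mem_iff.1 hx
    refine Wp.bind ((Wp.forUp (fun k m' t' => (∀ c < k, m' (arr n 6 c) = 0) ∧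
      (∀ a, a < arr n 6 0 ∨ arr n 7 0 ≤ a → m' a = m₀ a) ∧ t' ≤ t + 4 + 4 * k) ?_ ?_).mono ?_)
    · exact ⟨by omega, fun _ _ => rfl, by omega⟩
    · rintro k hk m' t' ⟨hz, hfr, ht⟩
      rw [zero_add]
      refine Wp.tail (Wp.writeAt (by omega) (by simp only [arr]; omega) (by omega)
        (Wp.ret ⟨rfl, fun c hc => ?_, fun a ha => ?_, by omega⟩))
      · rw [arr_add]
        rcases eq_or_ne c k with rfl | hne
        · exact Function.update_self _ _ _
        · rw [Function.update_of_ne (by simp only [arr]; omega), hz c (by omega)]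
      · rw [arr_add, Function.update_of_ne (by simp only [arr] at *; omega), hfr a ha]
    rintro _ m₁ t₁ _ ⟨rfl, hz, hfr, ht₁⟩
    have hm₁ : ∀ a, a ≠ 2 → a ≠ 3 → a < arr n 6 0 ∨ arr n 7 0 ≤ a → m₁ a = m a :=
      fun a h1 h2 h3 => by
        rw [hfr a h3, hm₀, Function.update_of_ne h2, Function.update_of_ne h1]
    have h12 : m₁ 2 = 0 := by
      rw [hfr 2 (.inl (by simp only [arr]; omega)), hm₀, Function.update_of_ne (by omega),
        Function.update_self]
    have h13 : m₁ 3 = 1 := by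
      rw [hfr 3 (.inl (by simp only [arr]; omega)), hm₀, Function.update_self]
    have hlen := hI.length_eq
    have hq₁ : ∀ x ∈ O, m₁ (arr n 8 x) = T x / (n + 2) ^ p := fun x hx => by
      rw [hm₁ _ (by simp only [arr]; omega) (by simp only [arr]; omega)
        (.inr (by simp only [arr]; omega)), hI.quot x hx]
    have hseg₁ : Seg m₁ (arr n 1 1) O := hI.seg.congr fun a ha1 ha2 =>
      hm₁ a (by simp only [arr] at *; omega) (by simp only [arr] at *; omega)
        (.inl (by simp only [arr] at *; omega))
    refine Wp.bind ((distribute_spec hB hn hOn hlen hI.nodup hseg₁ (fun x hx => ?_)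
      ⟨fun c hc => ?_, fun _ _ => rfl, by simp, by simp [h12], fun _ _ _ => rfl⟩).mono ?_)
    · rw [hq₁ x hx]
      exact (Nat.div_le_self _ _).trans_lt (hTw x (hOn x hx))
    · rw [hz c hc]; exact .nil
    rintro _ m₂ t₂ _ ⟨rfl, hI₂, ht₂⟩
    have h23 : m₂ 3 = 1 := by
      rw [hI₂.frame 3 (by omega) (by simp only [arr]; omega), h13]
    refine Wp.bind ((gather_spec hB hn (fun x hx => (hOn x hx).2) hlen
      (dig := fun x => m₁ (arr n 8 x) % (n + 2)) (fun x _ => Nat.mod_lt _ (by omega))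
      hI₂.linked h23).mono ?_)
    rintro _ m₃ t₃ _ ⟨rfl, hseg₃, hfr₃, ht₃⟩
    set O' := buckets O (fun x => m₁ (arr n 8 x) % (n + 2)) (n + 2) (n + 2) with hO'
    have hperm : O'.Perm O := buckets_perm_self O _ fun x _ => Nat.mod_lt _ (by omega)
    have hI₃ : PassInv T n mem (p + 1) m₃ O' := by
      refine ⟨hperm.trans hI.perm, hseg₃, ?_, fun x hx => ?_, fun a ha => ?_⟩
      · rw [pow_succ]
        exact buckets_pairwise hI.pairwise fun x hx => by rw [hq₁ x hx]
      · have hx := hperm.mem_iff.1 hx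
        rw [hfr₃ _ (by simp only [arr]; omega) (.inr (by simp only [arr]; omega)), hI₂.done x hx,
          hq₁ x hx, Nat.div_div_eq_div_mul, pow_succ]
      · rw [hfr₃ a (by simp only [arr] at *; omega) (by simp only [arr] at *; omega),
          hI₂.frame a (by simp only [arr] at *; omega) (by simp only [arr] at *; omega),
          hm₁ a (by simp only [arr] at *; omega) (by simp only [arr] at *; omega)
            (by simp only [arr] at *; omega), hI.frame a ha]
    have hmore : m₃ 2 = 0 ↔ ∀ x ∈ O, T x / (n + 2) ^ (p + 1) = 0 := by
      rw [hfr₃ 2 (by omega) (.inl (by simp only [arr]; omega)), hI₂.more]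
      refine forall₂_congr fun x hx => ?_
      rw [hq₁ x hx, Nat.div_div_eq_div_mul, pow_succ]
    have hpos : 0 < (n + 2) ^ (p + 1) := Nat.pow_pos (by omega)
    have hmul : 200 * n * (D + 1 - p) = 200 * n * (D - p) + 200 * n := by
      rw [show D + 1 - p = D - p + 1 by omega]; ring
    refine Wp.read (by omega) (by omega) (Wp.eq (Wp.ite (fun h0 => ?_) (fun h0 => ?_)))
    · refine Wp.ret ⟨rfl, ⟨p + 1, O', hI₃, fun x hx => ?_⟩, by omega⟩
      have := hmore.1 h0 x (hperm.mem_iff.1 hx)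
      exact (Nat.div_eq_zero_iff_lt hpos).1 this
    · rw [hmore] at h0
      push Not at h0
      obtain ⟨x, hx, hne⟩ := h0
      have hle : (n + 2) ^ (p + 1) ≤ T x := by
        by_contra! hlt
        exact hne (Nat.div_eq_of_lt hlt)
      have hx' : x ∈ Set.Icc 1 n := hOn x hx
      have hp1 : p + 1 < w := by
        have h2 : 2 ^ (p + 1) ≤ (n + 2) ^ (p + 1) := Nat.pow_le_pow_left (by omega) _
        exact (Nat.pow_lt_pow_iff_right (a := 2) (by omega)).1
          ((h2.trans hle).trans_lt (hTw x hx'))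
      have hp2 : p + 1 ≤ D := by
        by_contra! hlt
        have h1 : (n + 2) ^ D < (n + 2) ^ (p + 1) := Nat.pow_lt_pow_right (by omega) hlt
        have h2 : n ^ D ≤ (n + 2) ^ D := Nat.pow_le_pow_left (by omega) _
        have := hTD x hx'
        omega
      refine (ih hI₃ hp1 hp2 (by omega)).mono ?_
      rintro _ m' t' _ ⟨rfl, hex, ht⟩
      rw [show D + 1 - (p + 1) = D - p by omega] at ht
      exact ⟨rfl, hex, by omega⟩

theorem sortPositions_spec (hB : memBound n + 8 ≤ 2 ^ w) (hn : 1 ≤ n) {T mem : ℕ → ℕ} {D t : ℕ}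
    (hT : Set.InjOn T (Set.Icc 1 n)) (hTw : ∀ i ∈ Set.Icc 1 n, T i < 2 ^ w)
    (hTD : ∀ i ∈ Set.Icc 1 n, T i ≤ n ^ D) (h0 : mem 0 = n)
    (htext : ∀ i ∈ Set.Icc 1 n, mem (arr n 0 i) = T i) :
    Wp w (memBound n) K sortPositions mem t d fun _ m' t' d' => d' = d ∧ IsSortedInput T n m' ∧
      (∀ a, a < 2 ∨ arr n 2 0 ≤ a ∧ a < arr n 4 0 → m' a = mem a) ∧
      t' ≤ t + 200 * n * (D + 2) := by
  have hMB : arr n 9 0 ≤ memBound n := Nat.le_add_right _ _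
  simp only [arr] at hMB
  have hw : 0 < w := by
    by_contra! h
    obtain rfl : w = 0 := by omega
    simp at hB
  unfold sortPositions
  refine Wp.read (by omega) (by omega) ?_
  rw [h0]
  refine Wp.add (by omega) (Wp.add (by omega) (Wp.mul (by omega) (Wp.add (by omega)
    (Wp.add (by omega) (Wp.add (by omega) ?_)))))
  rw [show 4 + (n + 2) + 5 * (n + 2) = arr n 6 0 by simp only [arr]; omega,
    show arr n 6 0 + (n + 2) = arr n 7 0 by simp only [arr]; omega,
    show arr n 7 0 + (n + 2) = arr n 8 0 by simp only [arr]; omega,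
    show 4 + (n + 2) = arr n 1 0 by simp only [arr]; omega]
  refine Wp.bind ((Wp.forUp (fun k m' t' => Seg m' (arr n 1 1) (List.range' 1 k) ∧
    (∀ x ∈ Set.Icc 1 k, m' (arr n 8 x) = T x) ∧
    (∀ a, a < arr n 1 0 ∨ arr n 2 0 ≤ a ∧ a < arr n 8 0 → m' a = mem a) ∧ t' ≤ t + 8 + 8 * k)
    ?_ ?_).mono ?_)
  · refine ⟨trivial, fun x hx => ?_, fun _ _ => rfl, by omega⟩
    have := hx.1
    have := hx.2
    omega
  · rintro k hk m₁ t₁ ⟨hseg, hq, hfr, ht⟩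
    have hk1 : 1 + k ∈ Set.Icc 1 n := ⟨by omega, by omega⟩
    have hTk := hTw _ hk1
    refine Wp.writeAt (by omega) (by simp only [arr]; omega) (by omega) (Wp.readAt (by omega)
      (by omega) ?_)
    rw [arr_add, show 4 + (1 + k) = arr n 0 (1 + k) by simp only [arr]; omega,
      Function.update_of_ne (by simp only [arr]; omega),
      hfr _ (.inl (by simp only [arr]; omega)), htext _ hk1]
    refine Wp.tail (Wp.writeAt (by omega) (by simp only [arr]; omega) hTk (Wp.ret ?_))
    rw [arr_add]
    refine ⟨rfl, ?_, fun x hx => ?_, fun a ha => ?_, by omega⟩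
    · rw [List.range'_1_concat, seg_append, List.length_range']
      refine ⟨hseg.congr fun a ha1 ha2 => ?_, ?_, trivial⟩
      · rw [List.length_range'] at ha2
        rw [Function.update_of_ne (by simp only [arr] at *; omega),
          Function.update_of_ne (by simp only [arr] at *; omega)]
      · rw [show arr n 1 1 + k = arr n 1 (1 + k) by simp only [arr]; omega,
          Function.update_of_ne (by simp only [arr]; omega), Function.update_self]
    · have h1 := hx.1
      have h2 := hx.2
      rcases eq_or_ne x (1 + k) with rfl | hne
      · exact Function.update_self _ _ _
      · rw [Function.update_of_ne (by simp only [arr]; omega),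
          Function.update_of_ne (by simp only [arr]; omega), hq x ⟨h1, by omega⟩]
    · rw [Function.update_of_ne (by simp only [arr] at *; omega),
        Function.update_of_ne (by simp only [arr] at *; omega), hfr a ha]
  rintro _ m₁ t₁ _ ⟨rfl, hseg, hq, hfr, ht₁⟩
  have hI : PassInv T n mem 0 m₁ (List.range' 1 n) := by
    refine ⟨List.Perm.refl _, hseg, ?_, fun x hx => ?_, fun a ha => hfr a ?_⟩
    · simp only [pow_zero, Nat.mod_one, le_refl]
      exact List.pairwise_of_forall fun _ _ => trivial
    · rw [List.mem_range'_1] at hx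
      rw [hq x ⟨hx.1, by omega⟩, pow_zero, Nat.div_one]
    · simp only [arr] at *; omega
  refine Wp.wordSize ((radixLoop_spec hB hn hTw hTD w hI hw (Nat.zero_le _) rfl).mono ?_)
  rintro _ m' t' _ ⟨rfl, ⟨p, O, hI', hlt⟩, ht⟩
  have hlen := hI'.length_eq
  have hget : ∀ k (hk : k ∈ Set.Icc 1 n), m' (arr n 1 k) =
      O[k - 1]'(by have := hk.1; have := hk.2; omega) := by
    intro k hk
    have h1 := hk.1
    have h2 := hk.2
    rw [← hI'.seg.getElem]
    congr 1
    simp only [arr]; omega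
  refine ⟨rfl, ⟨fun k hk => ?_, fun k hk k' hk' hkk => ?_⟩, hI'.frame, ?_⟩
  · rw [hget k hk]
    exact hI'.mem_iff.1 (List.getElem_mem _)
  · rw [hget k hk, hget k' hk']
    have h1 := hk.1
    have h2 := hk'.2
    have hp := List.pairwise_iff_getElem.1 hI'.pairwise (k - 1) (k' - 1) (by omega) (by omega)
      (by omega)
    rw [Nat.mod_eq_of_lt (hlt _ (List.getElem_mem _)),
      Nat.mod_eq_of_lt (hlt _ (List.getElem_mem _))] at hp
    refine lt_of_le_of_ne hp fun e => ?_
    have e' := hT (hI'.mem_iff.1 (List.getElem_mem _)) (hI'.mem_iff.1 (List.getElem_mem _)) e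
    have := (hI'.nodup.getElem_inj_iff).1 e'
    omega
  · have e1 : 200 * n * (D + 2) = 200 * n * (D + 1 - 0) + 200 * n := by
      rw [Nat.sub_zero]; ring
    omega

end Passes

/-! ## The bounds as functions of `n` -/

/-- From `2 ^ keyBits n ≤ 2 * (n + 2) ≤ n ^ 3` and `log 2 > 1 / 2` one gets at most `6 * log n`
bits. Taking logarithms once more, with `6` rounded up to `2 ^ 3`, leaves `log log n` and additive
constants. -/
theorem lev_keyBits_le {n : ℕ} (hn : 3 ≤ n) :
    (lev (keyBits n) : ℝ) ≤ 2 * Real.log (Real.log n) + 8 := by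
  have hn' : (3 : ℝ) ≤ n := by exact_mod_cast hn
  have hlog2 : (0.6931471803 : ℝ) < Real.log 2 := Real.log_two_gt_d9
  have hlog1 : 1 < Real.log n := by
    rw [Real.lt_log_iff_exp_lt (by linarith)]
    linarith [Real.exp_one_lt_d9]
  have hll : 0 < Real.log (Real.log n) := Real.log_pos hlog1
  have hk := two_pow_keyBits_le (show 1 ≤ n by omega)
  have hb2 := two_le_keyBits (show 1 ≤ n by omega)
  have h1 : (keyBits n : ℝ) * Real.log 2 ≤ 3 * Real.log n := by
    have h : (2 : ℝ) ^ keyBits n ≤ (n : ℝ) ^ 3 := by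
      have : (2 : ℝ) ^ keyBits n ≤ 2 * (n + 2) := by exact_mod_cast hk
      nlinarith [mul_self_nonneg ((n : ℝ) - 3)]
    have := Real.log_le_log (by positivity) h
    rwa [Real.log_pow, Real.log_pow] at this
  have h2 : (keyBits n : ℝ) ≤ 6 * Real.log n := by
    have : (0 : ℝ) ≤ keyBits n := Nat.cast_nonneg _
    nlinarith
  set q := Nat.clog 2 (keyBits n) with hq
  have hq1 : 1 ≤ q := Nat.clog_pos (by omega) hb2
  have h3 : (2 : ℝ) ^ (q - 1) ≤ 6 * Real.log n := by
    have := Nat.pow_pred_clog_lt_self (b := 2) (by omega) (x := keyBits n) (by omega)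
    rw [← hq, Nat.pred_eq_sub_one] at this
    have : (2 : ℝ) ^ (q - 1) ≤ keyBits n := by exact_mod_cast this.le
    linarith
  have h4 : ((q : ℝ) - 1) * Real.log 2 ≤ 3 * Real.log 2 + Real.log (Real.log n) := by
    have h5 : (2 : ℝ) ^ (q - 1) ≤ 2 ^ 3 * Real.log n := by linarith
    have := Real.log_le_log (by positivity) h5
    rw [Real.log_pow, Real.log_mul (by norm_num) (by linarith), Real.log_pow,
      Nat.cast_sub hq1] at this
    simpa using this
  have h6 : (lev (keyBits n) : ℝ) = q + 1 := by simp [lev, ← hq]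
  rw [h6]
  nlinarith

/-- For `n ≥ 3` the iterated logarithm is at least `log log 3 > 0`, so the additive constant can be
absorbed into the factor. This is the reason for restricting the time bound to `n ≥ 3`. -/
theorem exists_lev_bound : ∃ A : ℝ, 0 ≤ A ∧ ∀ n : ℕ, 3 ≤ n →
    0 ≤ Real.log (Real.log n) ∧ (lev (keyBits n) : ℝ) ≤ A * Real.log (Real.log n) := by
  have h3 : 1 < Real.log 3 := by
    rw [Real.lt_log_iff_exp_lt (by norm_num)]
    linarith [Real.exp_one_lt_d9]
  have hpos : 0 < Real.log (Real.log 3) := Real.log_pos h3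
  refine ⟨2 + 8 / Real.log (Real.log 3), by positivity, fun n hn => ?_⟩
  have hn' : (3 : ℝ) ≤ n := by exact_mod_cast hn
  have hlog : Real.log 3 ≤ Real.log n := Real.log_le_log (by norm_num) hn'
  have hmono : Real.log (Real.log 3) ≤ Real.log (Real.log n) :=
    Real.log_le_log (by linarith) hlog
  refine ⟨hpos.le.trans hmono, (lev_keyBits_le hn).trans ?_⟩
  have : 8 ≤ 8 / Real.log (Real.log 3) * Real.log (Real.log n) := by
    rw [div_mul_eq_mul_div, le_div_iff₀ hpos]
    linarith
  rw [add_mul]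
  linarith

theorem lev_keyBits_le_self {n : ℕ} (hn : 1 ≤ n) : lev (keyBits n) ≤ 3 * n := by
  have h1 := lev_le_self (show 1 ≤ keyBits n by have := two_le_keyBits hn; omega)
  have h2 : keyBits n ≤ n + 2 := by
    refine Nat.clog_le_of_le_pow ?_
    have := Nat.lt_two_pow_self (n := n)
    rw [pow_add]; omega
  omega

/-- The input of UPDATE-LEFT-MAX with the order of the positions fits the main loop. -/
theorem IsInput.loopInput {P T mem m : ℕ → ℕ} {k n v w : ℕ} (hin : IsInput P k T n v w mem)
    (h1 : mem 1 ≠ 0) (hm : ∀ a, arr n 2 0 ≤ a ∧ a < arr n 4 0 → m a = mem a)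
    (hs : IsSortedInput T n m) : LoopInput T n m := by
  obtain ⟨_, htab⟩ := hin.child.resolve_left fun h => h1 h.1
  refine ⟨fun i hi => ?_, hs⟩
  have h := htab i hi
  have hi2 := hi.2
  rw [hm _ (by simp only [arr]; omega), hm _ (by simp only [arr]; omega)]
  exact ⟨h.1, h.2.1, h.2.2.1⟩

/-- Sorting preserves the two input tables but not the whole memory. The recursion reads them only
at positions in `[1, n]`, so its value is the same on the memory before and after. -/
theorem leftMax_congr {T A B A' B' : ℕ → ℕ} {n i : ℕ} (hi : i ∈ Set.Icc 1 n)
    (hA : ∀ j ∈ Set.Icc 1 n, A j = A' j) (hB : ∀ j ∈ Set.Icc 1 n, B j = B' j) :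
    leftMax T A B i = leftMax T A' B' i := by
  have key : ∀ ℓ, 1 ≤ ℓ → (ℓ ≤ leftMax T A B i ↔ ℓ ≤ leftMax T A' B' i) := by
    intro ℓ hℓ
    rw [le_leftMax_iff hℓ, le_leftMax_iff hℓ]
    refine exists_congr fun j => and_congr_right fun hj => ?_
    have hj' : j ∈ Set.Icc 1 n := ⟨hj.1, by have := hi.2; omega⟩
    rw [hA j hj', hB j hj']
  refine Nat.le_antisymm ?_ ?_
  · rcases Nat.eq_zero_or_pos (leftMax T A B i) with h | h
    · omega
    · exact (key _ h).1 le_rfl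
  · rcases Nat.eq_zero_or_pos (leftMax T A' B' i) with h | h
    · omega
    · exact (key _ h).2 le_rfl

end CTMSeq

/-! ### Assembling the lemma and its constants. -/

theorem lemma3 :
    (∃ C : ℝ, ∀ (n m w v : ℕ) (T P mem : ℕ → ℕ),
      1 ≤ n → v ∈ Set.Icc 1 m → C * n ≤ 2 ^ w →
      Set.InjOn T (Set.Icc 1 n) → Set.InjOn P (Set.Icc 1 m) →
      CTMSeq.IsInput P m T n v w mem → CTMSeq.IsSortedInput T n mem →
      (∃ s, CTMSeq.run CTMSeq.updateLeftMax w mem = some s ∧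
        CTMSeq.IsOutput P m T n v mem (fun i => s.mem (CTMSeq.arr n 4 i)) ∧
        (3 ≤ n → (s.time : ℝ) ≤ C * (n * Real.log (Real.log n))) ∧
        (s.space : ℝ) ≤ C * n) ∧
      (mem 1 ≠ 0 → ∀ t ≤ n, ∃ s, CTMSeq.run (CTMSeq.updateLeftMaxRounds t) w mem = some s ∧
        CTMSeq.dictionary n s.mem = CTMSeq.minimalIntervals (CTMSeq.candidates n mem t))) ∧
    (∀ d : ℕ, ∃ C : ℝ, ∀ (n m w v : ℕ) (T P mem : ℕ → ℕ),
      1 ≤ n → v ∈ Set.Icc 1 m → C * n ≤ 2 ^ w →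
      Set.InjOn T (Set.Icc 1 n) → Set.InjOn P (Set.Icc 1 m) →
      CTMSeq.IsInput P m T n v w mem → (∀ i ∈ Set.Icc 1 n, T i ≤ n ^ d) →
      ∃ s, CTMSeq.run CTMSeq.sortAndUpdateLeftMax w mem = some s ∧
        CTMSeq.IsOutput P m T n v mem (fun i => s.mem (CTMSeq.arr n 4 i)) ∧
        (3 ≤ n → (s.time : ℝ) ≤ C * (n * Real.log (Real.log n))) ∧
        (s.space : ℝ) ≤ C * n) := by
  open CTMSeq in
  obtain ⟨A, hA0, hA⟩ := exists_lev_bound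
  have hword : ∀ {C : ℝ} {n w : ℕ}, 100 ≤ C → 1 ≤ n → C * n ≤ 2 ^ w →
      memBound n + 8 ≤ 2 ^ w := by
    intro C n w hC hn h
    have h1 : (100 * n : ℝ) ≤ 2 ^ w :=
      (mul_le_mul_of_nonneg_right hC (Nat.cast_nonneg n)).trans h
    have h2 : 100 * n ≤ 2 ^ w := by exact_mod_cast h1
    have := memBound_le hn
    omega
  have hspace : ∀ {C : ℝ} {n s : ℕ}, 100 ≤ C → 1 ≤ n → s ≤ memBound n + lev (keyBits n) →
      (s : ℝ) ≤ C * n := by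
    intro C n s hC hn hs
    have h1 := memBound_le hn
    have h2 := lev_keyBits_le_self hn
    have h3 : s ≤ 100 * n := by omega
    have h4 : (s : ℝ) ≤ 100 * n := by exact_mod_cast h3
    exact h4.trans (mul_le_mul_of_nonneg_right hC (Nat.cast_nonneg n))
  -- The time needs only the factor `c * A`. The summand `100` makes the same constant large enough
  -- for the word size and the space, whatever `A` is.
  have htime : ∀ {c n t : ℕ}, 3 ≤ n → t ≤ c * (n * lev (keyBits n)) →
      (t : ℝ) ≤ (c * A + 100) * (n * Real.log (Real.log n)) := by
    intro c n t hn ht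
    obtain ⟨h0, hlev⟩ := hA n hn
    have h1 : (t : ℝ) ≤ c * (n * lev (keyBits n)) := by exact_mod_cast ht
    have h2 : (c * (n * lev (keyBits n)) : ℝ) ≤ c * (n * (A * Real.log (Real.log n))) := by
      gcongr
    have h3 : (0 : ℝ) ≤ n * Real.log (Real.log n) := mul_nonneg (Nat.cast_nonneg n) h0
    rw [add_mul]
    linarith
  constructor
  · refine ⟨(700 : ℕ) * A + 100, fun n m w v T P mem hn hv hw hT hP hin hs => ⟨?_, ?_⟩⟩
    · have hC : (100 : ℝ) ≤ (700 : ℕ) * A + 100 := by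
        have : (0 : ℝ) ≤ (700 : ℕ) * A := by positivity
        linarith
      obtain ⟨s, _, hrun, hsp, h0, h1, ht⟩ := (updateLeftMax_spec (d := 0) (hword hC hn hw) hn
        (Nat.zero_add _).le (T := T) (fun h1 => hin.loopInput h1 (fun _ _ => rfl) hs)
        hin.length (t := 0)).run
      rw [Nat.zero_add] at ht
      exact ⟨s, hrun, hin.isOutput hv hP hT h0 h1, fun hn3 => htime hn3 ht, hspace hC hn hsp⟩
    · intro h1 t ht
      have hC : (100 : ℝ) ≤ (700 : ℕ) * A + 100 := by
        have : (0 : ℝ) ≤ (700 : ℕ) * A := by positivity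
        linarith
      obtain ⟨s, _, hrun, _, hdict, _⟩ := (updateLeftMaxRounds_spec (d := 0) (hword hC hn hw) hn
        (Nat.zero_add _).le (hin.loopInput h1 (fun _ _ => rfl) hs) hin.length h1 (t := 0) ht).run
      exact ⟨s, hrun, hdict⟩
  · intro d
    refine ⟨(700 + 200 * (d + 2) : ℕ) * A + 100, fun n m w v T P mem hn hv hw hT hP hin hTd => ?_⟩
    have hC : (100 : ℝ) ≤ (700 + 200 * (d + 2) : ℕ) * A + 100 := by
      have : (0 : ℝ) ≤ (700 + 200 * (d + 2) : ℕ) * A := by positivity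
      linarith
    have hB := hword hC hn hw
    have hspec : Wp w (memBound n) (lev (keyBits n)) sortAndUpdateLeftMax mem 0 0
        fun _ m' t' _ => (mem 1 = 0 → ∀ i ∈ Set.Icc 1 n, m' (arr n 4 i) = i) ∧
          (mem 1 ≠ 0 → ∀ i ∈ Set.Icc 1 n, m' (arr n 4 i) =
            leftMax T (fun j => mem (arr n 2 j)) (fun j => mem (arr n 3 j)) i) ∧
          t' ≤ (700 + 200 * (d + 2)) * (n * lev (keyBits n)) := by
      refine Wp.bind ((sortPositions_spec hB hn hT hin.fits hTd hin.length hin.text).mono ?_)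
      rintro _ m₁ t₁ _ ⟨rfl, hs, hfr, ht₁⟩
      have e0 : m₁ 0 = mem 0 := hfr 0 (.inl (by omega))
      have e1 : m₁ 1 = mem 1 := hfr 1 (.inl (by omega))
      refine (updateLeftMax_spec hB hn (Nat.zero_add _).le (T := T)
        (fun h1 => hin.loopInput (by rwa [← e1]) (fun a ha => hfr a (.inr ha)) hs)
        (e0.trans hin.length)).mono ?_
      rintro _ m' t' _ ⟨h0, h1, ht⟩
      rw [e1] at h0 h1
      refine ⟨h0, fun h i hi => (h1 h i hi).trans (leftMax_congr hi (fun j hj => ?_) fun j hj => ?_),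
        ?_⟩
      · have := hj.2
        exact hfr _ (.inr (by simp only [arr]; omega))
      · have := hj.2
        exact hfr _ (.inr (by simp only [arr]; omega))
      -- The linear cost of sorting is charged to the same product `n * lev`, using `1 ≤ lev`.
      · have e3 : 200 * n * (d + 2) * 1 ≤ 200 * n * (d + 2) * lev (keyBits n) :=
          Nat.mul_le_mul_left _ (lev_pos _)
        have e4 : (700 + 200 * (d + 2)) * (n * lev (keyBits n)) =
            700 * (n * lev (keyBits n)) + 200 * n * (d + 2) * lev (keyBits n) := by ring
        omega
    obtain ⟨s, _, hrun, hsp, h0, h1, ht⟩ := hspec.run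
    exact ⟨s, hrun, hin.isOutput hv hP hT h0 h1, fun hn3 => htime hn3 ht, hspace hC hn hsp⟩
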